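/- Let $M$ be a connected smooth manifold (without boundary, Hausdorff, second countable) and let $(E,g)$ be a sub-Riemannian structure on $M$: $E\subseteq TM$ is a smooth subbundle and $g$ is a smooth positive definite metric tensor on $E$. For $k\ge 0$ let $E^{-k}_x\subseteq T_xM$ be the span of the values at $x$ of all iterated brackets $[X_1,[X_2,\dots,[X_{j-1},X_j]\cdots]]$ with $1\le j\le k$ and $X_i\in\Gamma(E)$ (so $E^0=0$, $E^{-1}=E$). Assume that $E$ is bracket-generating (these brackets span $TM$) and equiregular (every $E^{-k}$ is a smooth subbundle of $TM$), and let $s$ be the least integer with $E^{-s}=TM$. Let $\mathrm{gr}=\mathrm{gr}(E)=\bigoplus_{k=1}^{s}\mathrm{gr}_{-k}$ with $\mathrm{gr}_{-k}=E^{-k}/E^{-k+1}$ be the nonholonomic tangent bundle. Each fiber $\mathrm{gr}_x$ carries the graded Lie bracket determined by $$[\![\,X_x \bmod E_x^{-i+1},\ Y_x \bmod E_x^{-j+1}\,]\!]=[X,Y]|_x \bmod E_x^{-i-j+1},\qquad X\in\Gamma(E^{-i}),\ Y\in\Gamma(E^{-j}),$$ and the inner product $g_x$ on $\mathrm{gr}_{x,-1}=E_x$.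 A Carnot algebra is a finite-dimensional real graded Lie algebra $\mathfrak g_-=\mathfrak g_{-s'}\oplus\cdots\oplus\mathfrak g_{-1}$ with $[\mathfrak g_{-1},\mathfrak g_{-k}]=\mathfrak g_{-k-1}$ for $1\le k<s'$ and $[\mathfrak g_{-1},\mathfrak g_{-s'}]=0$, together with an inner product on $\mathfrak g_{-1}$; an isometry is a Lie algebra isomorphism that maps the degree $-1$ part isometrically onto the degree $-1$ part. $(M,E,g)$ has constant symbol if there is a Carnot algebra $\mathfrak g_-$ such that $\mathrm{gr}_x$ is isometric to $\mathfrak g_-$ for every $x\in M$. A connection $\nabla$ on the vector bundle $\mathrm{gr}$ is called strongly compatible if each $\mathrm{gr}_{-k}$ is parallel, the restriction of $\nabla$ to $\mathrm{gr}_{-1}=E$ satisfies $Y\langle A,B\rangle_g=\langle\nabla_YA,B\rangle_g+\langle A,\nabla_YB\rangle_g$ for $Y\in\Gamma(TM)$, $A,B\in\Gamma(E)$, and $$\nabla_Y[\![A,B]\!]=[\![\nabla_YA,B]\!]+[\![A,\nabla_YB]\!]\qquad\text{for all } Y\in\Gamma(TM),\ A,B\in\Gamma(\mathrm{gr}).$$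 **Proposition.** There exists a strongly compatible connection on $\mathrm{gr}(E)$ if and only if $(M,E,g)$ has constant symbol. -/

import Mathlib

open scoped Manifold ContDiff Topology DirectSum

noncomputable section

namespace SubRiemannian

section Fields

variable {n : ℕ} {M : Type*} [TopologicalSpace M] [ChartedSpace (EuclideanSpace ℝ (Fin n)) M]

/-- A (not necessarily smooth) vector field on the `n`-dimensional manifold `M`. -/
abbrev VField (n : ℕ) (M : Type*) [TopologicalSpace M]
    [ChartedSpace (EuclideanSpace ℝ (Fin n)) M] : Type _ :=
  ∀ x : M, TangentSpace (𝓡 n) x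

/-- A (not necessarily smooth or constant rank) distribution: a subspace of each tangent space. -/
abbrev Distribution (n : ℕ) (M : Type*) [TopologicalSpace M]
    [ChartedSpace (EuclideanSpace ℝ (Fin n)) M] : Type _ :=
  ∀ x : M, Submodule ℝ (TangentSpace (𝓡 n) x)

variable [IsManifold (𝓡 n) ∞ M]

/-- The vector field `X` is smooth on the set `U`. -/
def SmoothOn (X : VField n M) (U : Set M) : Prop :=
  ContMDiffOn (𝓡 n) (𝓡 n).tangent ∞ (fun x => (⟨x, X x⟩ : TangentBundle (𝓡 n) M)) U

/-- `X ∈ Γ(TM)`. -/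
def IsSmooth (X : VField n M) : Prop :=
  ContMDiff (𝓡 n) (𝓡 n).tangent ∞ (fun x => (⟨x, X x⟩ : TangentBundle (𝓡 n) M))

/-- `X ∈ Γ(D)`: a global smooth vector field with values in `D`. -/
structure IsSection (D : Distribution n M) (X : VField n M) : Prop where
  smooth : IsSmooth X
  mem : ∀ x, X x ∈ D x

/-- `D` is a smooth subbundle of `TM`: around each point it has a smooth local frame. -/
def IsSubbundle (D : Distribution n M) : Prop :=
  ∀ x₀ : M, ∃ U : Set M, IsOpen U ∧ x₀ ∈ U ∧ ∃ (r : ℕ) (X : Fin r → VField n M),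
    (∀ i, SmoothOn (X i) U) ∧
    ∀ x ∈ U, LinearIndependent ℝ (fun i => X i x) ∧
      Submodule.span ℝ (Set.range fun i => X i x) = D x

/-- `IsIteratedBracket D j Z`: the vector field `Z` equals `[X₁, [X₂, ⋯ [X_{j-1}, X_j] ⋯ ]]`
for some `X₁, …, X_j ∈ Γ(D)`, where `j ≥ 1`. -/
inductive IsIteratedBracket (D : Distribution n M) : ℕ → VField n M → Prop
  | one {X : VField n M} (hX : IsSection D X) : IsIteratedBracket D 1 X
  | succ {j : ℕ} {X Z : VField n M} (hX : IsSection D X) (hZ : IsIteratedBracket D j Z) :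
      IsIteratedBracket D (j + 1) (VectorField.mlieBracket (𝓡 n) X Z)

/-- `flag D k x` is the space `D^{-k}_x` spanned by the values at `x` of the iterated brackets of
at most `k` sections of `D`; in particular `D^0 = 0`. -/
def flag (D : Distribution n M) (k : ℕ) : Distribution n M := fun x =>
  Submodule.span ℝ {v | ∃ j ≤ k, ∃ Z : VField n M, IsIteratedBracket D j Z ∧ Z x = v}

/-- `E` is bracket-generating: the iterated brackets of sections of `E` span `TM`. -/
def IsBracketGenerating (E : Distribution n M) : Prop :=
  ∀ x, ⨆ k, flag E k x = ⊤

/-- `E` is equiregular: every `E^{-k}` is a subbundle of `TM`. -/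
def IsEquiregular (E : Distribution n M) : Prop :=
  ∀ k, IsSubbundle (flag E k)

theorem IsIteratedBracket.one_le {D : Distribution n M} {j : ℕ} {Z : VField n M}
    (h : IsIteratedBracket D j Z) : 1 ≤ j := by
  induction h <;> omega

theorem flag_zero (D : Distribution n M) (x : M) : flag D 0 x = ⊥ := by
  rw [flag, Submodule.span_eq_bot]
  rintro v ⟨j, hj, Z, hZ, -⟩
  have := hZ.one_le
  omega

/-- A vector in a smooth subbundle is the value of a global smooth section. -/
theorem IsSubbundle.exists_isSection [T2Space M] {D : Distribution n M} (hD : IsSubbundle D)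
    {x : M} {v : TangentSpace (𝓡 n) x} (hv : v ∈ D x) : ∃ X, IsSection D X ∧ X x = v := by
  obtain ⟨U, hU, hxU, r, X, hX, hspan⟩ := hD x
  rw [← (hspan x hxU).2, Submodule.mem_span_range_iff_exists_fun] at hv
  obtain ⟨c, rfl⟩ := hv
  obtain ⟨f, -, hf⟩ :=
    (SmoothBumpFunction.nhds_basis_tsupport (I := 𝓡 n) x).mem_iff.1 (hU.mem_nhds hxU)
  refine ⟨fun y => f y • ∑ i, c i • X i y, ⟨?_, fun y => ?_⟩, by simp⟩
  · have h : ContMDiffOn (𝓡 n) ((𝓡 n).prod 𝓘(ℝ, EuclideanSpace ℝ (Fin n))) ∞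
        (fun y => (⟨y, ∑ i, c i • X i y⟩ : TangentBundle (𝓡 n) M)) U :=
      ContMDiffOn.sum_section fun i _ => (contMDiffOn_const (c := c i)).smul_section (hX i)
    exact ContMDiffOn.smul_section_of_tsupport (f.contMDiff.contMDiffOn) hU hf h
  · by_cases hy : y ∈ U
    · rw [← (hspan y hy).2]
      exact Submodule.smul_mem _ _ (Submodule.sum_mem _ fun i _ =>
        Submodule.smul_mem _ _ (Submodule.subset_span ⟨i, rfl⟩))
    · have : f y = 0 := image_eq_zero_of_notMem_tsupport fun h => hy (hf h)
      simp [this]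

/-- `E^{-1} = E`. -/
theorem IsSubbundle.flag_one [T2Space M] {E : Distribution n M} (hE : IsSubbundle E) (x : M) :
    flag E 1 x = E x := by
  apply le_antisymm
  · refine Submodule.span_le.2 ?_
    rintro v ⟨j, hj, Z, hZ, rfl⟩
    cases hZ with
    | one hX => exact hX.mem x
    | succ hX hZ => have := hZ.one_le; omega
  · intro v hv
    obtain ⟨X, hX, rfl⟩ := hE.exists_isSection hv
    exact Submodule.subset_span ⟨1, le_rfl, X, .one hX, rfl⟩

end Fields

/-- A sub-Riemannian structure `(E, g)` on `M`: a smooth subbundle `E` of `TM` with a smooth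
positive definite metric tensor `g` on `E`. -/
structure Structure (n : ℕ) (M : Type*) [TopologicalSpace M]
    [ChartedSpace (EuclideanSpace ℝ (Fin n)) M] [IsManifold (𝓡 n) ∞ M] where
  E : Distribution n M
  isSubbundle : IsSubbundle E
  g : ∀ x, E x →ₗ[ℝ] E x →ₗ[ℝ] ℝ
  g_symm : ∀ x (u v : E x), g x u v = g x v u
  g_pos : ∀ x (u : E x), u ≠ 0 → 0 < g x u u
  g_smooth : ∀ (X Y : VField n M) (hX : IsSection E X) (hY : IsSection E Y),
    ContMDiff (𝓡 n) 𝓘(ℝ, ℝ) ∞ fun x => g x ⟨X x, hX.mem x⟩ ⟨Y x, hY.mem x⟩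

/-- A Carnot algebra: a finite-dimensional real graded Lie algebra
`𝔤 = 𝔤_{-s} ⊕ ⋯ ⊕ 𝔤_{-1}` with `[𝔤_{-1}, 𝔤_{-k}] = 𝔤_{-k-1}` and an inner product on `𝔤_{-1}`.
Here `layer k` is `𝔤_{-k}`, with `𝔤_{-k} = 0` unless `1 ≤ k ≤ s`. -/
structure CarnotAlgebra where
  carrier : Type
  [lieRing : LieRing carrier]
  [lieAlgebra : LieAlgebra ℝ carrier]
  finiteDimensional : FiniteDimensional ℝ carrier
  step : ℕ
  layer : ℕ → Submodule ℝ carrier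
  layer_zero : layer 0 = ⊥
  layer_of_step_lt : ∀ k, step < k → layer k = ⊥
  isInternal : DirectSum.IsInternal layer
  lie_mem : ∀ i j, ∀ a ∈ layer i, ∀ b ∈ layer j, ⁅a, b⁆ ∈ layer (i + j)
  span_lie : ∀ k, 1 ≤ k →
    Submodule.span ℝ {c | ∃ a ∈ layer 1, ∃ b ∈ layer k, ⁅a, b⁆ = c} = layer (k + 1)
  inner : layer 1 →ₗ[ℝ] layer 1 →ₗ[ℝ] ℝ
  inner_symm : ∀ a b, inner a b = inner b a
  inner_pos : ∀ a, a ≠ 0 → 0 < inner a a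

attribute [instance] CarnotAlgebra.lieRing CarnotAlgebra.lieAlgebra

namespace Structure

variable {n : ℕ} {M : Type*} [TopologicalSpace M] [ChartedSpace (EuclideanSpace ℝ (Fin n)) M]
  [IsManifold (𝓡 n) ∞ M] (S : Structure n M)

/-- `gr_{x,-k} = E^{-k}_x / E^{-k+1}_x`. For `k = 0` this is the zero space `E^0_x / E^0_x`. -/
abbrev GrPiece (x : M) (k : ℕ) : Type :=
  ↥(flag S.E k x) ⧸ (flag S.E (k - 1) x).submoduleOf (flag S.E k x)

/-- The class in `gr_{x,-k}` of a vector of `E^{-k}_x`. -/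
def grMk (x : M) (k : ℕ) (v : TangentSpace (𝓡 n) x) (hv : v ∈ flag S.E k x) : S.GrPiece x k :=
  Submodule.Quotient.mk ⟨v, hv⟩

/-- The fiber `gr_x = ⨁ₖ E^{-k}_x / E^{-k+1}_x` of the nonholonomic tangent bundle. For a
bracket-generating equiregular `E` the summands with `k` greater than the step vanish. -/
abbrev Gr (x : M) : Type := ⨁ k : ℕ, S.GrPiece x k

/-- The identification `E_x = gr_{x,-1}`, sending `v` to its class. -/
def horizontalEquiv [T2Space M] (x : M) : S.E x ≃ₗ[ℝ] S.GrPiece x 1 :=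
  (LinearEquiv.ofEq _ _ (S.isSubbundle.flag_one x).symm).trans
    (Submodule.quotEquivOfEqBot ((flag S.E (1 - 1) x).submoduleOf (flag S.E 1 x)) (by
      rw [Nat.sub_self, flag_zero, Submodule.submoduleOf, Submodule.comap_bot]
      exact Submodule.ker_subtype _)).symm

/-- The inner product of `gr_{x,-1} = E_x`. -/
def grInner [T2Space M] (x : M) (a b : S.GrPiece x 1) : ℝ :=
  S.g x ((S.horizontalEquiv x).symm a) ((S.horizontalEquiv x).symm b)

/-- `c = [X, Y]|_x mod E^{-i-j+1}_x` for some sections `X` of `E^{-i}` and `Y` of `E^{-j}` with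
`a = X_x mod E^{-i+1}_x` and `b = Y_x mod E^{-j+1}_x`. -/
def IsLeviBracket (x : M) {i j : ℕ} (a : S.GrPiece x i) (b : S.GrPiece x j)
    (c : S.GrPiece x (i + j)) : Prop :=
  ∃ (X Y : VField n M) (hX : IsSection (flag S.E i) X) (hY : IsSection (flag S.E j) Y)
    (hXY : VectorField.mlieBracket (𝓡 n) X Y x ∈ flag S.E (i + j) x),
    S.grMk x i (X x) (hX.mem x) = a ∧ S.grMk x j (Y x) (hY.mem x) = b ∧
    S.grMk x (i + j) (VectorField.mlieBracket (𝓡 n) X Y x) hXY = c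

open Classical in
/-- The Levi bracket `gr_{x,-i} × gr_{x,-j} → gr_{x,-i-j}` of homogeneous elements: the class of
the bracket of vector fields extending them. For equiregular `E` the element `c` exists and does
not depend on the extensions, so that the choice made here is immaterial. -/
def leviBracket (x : M) {i j : ℕ} (a : S.GrPiece x i) (b : S.GrPiece x j) :
    S.GrPiece x (i + j) :=
  if h : ∃ c, S.IsLeviBracket x a b c then h.choose else 0

open Classical in
/-- The Levi bracket on `gr_x`, extended from homogeneous elements by
`⟦a, b⟧ = ∑_{i,j} ⟦a_i, b_j⟧`. -/
def grBracket (x : M) (a b : S.Gr x) : S.Gr x :=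
  ∑ i ∈ DFinsupp.support a, ∑ j ∈ DFinsupp.support b,
    DirectSum.of (S.GrPiece x) (i + j) (S.leviBracket x (a i) (b j))

/-- The linear isomorphism `φ : 𝔤 → gr_x` is an isometry of Carnot algebras: it is compatible with
the brackets and maps `𝔤_{-1}` onto `gr_{x,-1}` isometrically. -/
structure IsIsometry [T2Space M] (𝔤 : CarnotAlgebra) (x : M) (φ : 𝔤.carrier ≃ₗ[ℝ] S.Gr x) :
    Prop where
  map_lie : ∀ a b, φ ⁅a, b⁆ = S.grBracket x (φ a) (φ b)
  map_layer : (𝔤.layer 1).map φ.toLinearMap =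
    LinearMap.range (DirectSum.lof ℝ ℕ (S.GrPiece x) 1)
  map_inner : ∀ a b : 𝔤.layer 1, S.grInner x (φ a 1) (φ b 1) = 𝔤.inner a b

/-- `(M, E, g)` has constant symbol: all `gr_x` are isometric to one Carnot algebra. -/
def HasConstantSymbol [T2Space M] : Prop :=
  ∃ 𝔤 : CarnotAlgebra, ∀ x : M, ∃ φ : 𝔤.carrier ≃ₗ[ℝ] S.Gr x, S.IsIsometry 𝔤 x φ

/-- `A ∈ Γ(gr)`: in each degree, the section `A` is near each point the class of a smooth section
of `E^{-k}`. -/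
def IsSmoothGr (A : ∀ x, S.Gr x) : Prop :=
  ∀ (k : ℕ) (x₀ : M), ∃ (X : VField n M) (hX : IsSection (flag S.E k) X),
    ∀ᶠ x in 𝓝 x₀, A x k = S.grMk x k (X x) (hX.mem x)

/-- A connection on the vector bundle `gr`, as a Koszul covariant derivative
`∇ : Γ(TM) × Γ(gr) → Γ(gr)`. Values at arguments that are not smooth carry no meaning. -/
structure GrConnection where
  nabla : VField n M → (∀ x, S.Gr x) → ∀ x, S.Gr x
  smooth : ∀ Y A, IsSmooth Y → S.IsSmoothGr A → S.IsSmoothGr (nabla Y A)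
  add_left : ∀ Y Y' A, IsSmooth Y → IsSmooth Y' → S.IsSmoothGr A →
    ∀ x, nabla (fun z => Y z + Y' z) A x = nabla Y A x + nabla Y' A x
  smul_left : ∀ (f : M → ℝ) Y A, ContMDiff (𝓡 n) 𝓘(ℝ, ℝ) ∞ f → IsSmooth Y → S.IsSmoothGr A →
    ∀ x, nabla (fun z => f z • Y z) A x = f x • nabla Y A x
  add_right : ∀ Y A B, IsSmooth Y → S.IsSmoothGr A → S.IsSmoothGr B →
    ∀ x, nabla Y (fun z => A z + B z) x = nabla Y A x + nabla Y B x
  leibniz : ∀ (f : M → ℝ) Y A, ContMDiff (𝓡 n) 𝓘(ℝ, ℝ) ∞ f → IsSmooth Y → S.IsSmoothGr A →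
    ∀ x, nabla Y (fun z => f z • A z) x =
      mvfderiv (𝓡 n) f x (Y x) • A x + f x • nabla Y A x

variable {S}

/-- The section `A` of `gr` takes values in `gr_{-k}`. -/
def IsInDegree (k : ℕ) (A : ∀ x, S.Gr x) : Prop :=
  ∀ x m, m ≠ k → A x m = 0

/-- The connection is compatible: each `gr_{-k}` is parallel, and the restriction of the
connection to `gr_{-1} = E` is compatible with `g`. -/
structure GrConnection.IsCompatible [T2Space M] (D : S.GrConnection) : Prop where
  parallel : ∀ k Y A, IsSmooth Y → S.IsSmoothGr A → IsInDegree k A → IsInDegree k (D.nabla Y A)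
  metric : ∀ Y A B, IsSmooth Y → S.IsSmoothGr A → S.IsSmoothGr B →
    IsInDegree 1 A → IsInDegree 1 B → ∀ x,
    mvfderiv (𝓡 n) (fun z => S.grInner z (A z 1) (B z 1)) x (Y x) =
      S.grInner x (D.nabla Y A x 1) (B x 1) + S.grInner x (A x 1) (D.nabla Y B x 1)

/-- The connection is strongly compatible: it is compatible and
`∇_Y ⟦A, B⟧ = ⟦∇_Y A, B⟧ + ⟦A, ∇_Y B⟧`. -/
structure GrConnection.IsStronglyCompatible [T2Space M] (D : S.GrConnection) : Prop extends
    D.IsCompatible where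
  bracket : ∀ Y A B, IsSmooth Y → S.IsSmoothGr A → S.IsSmoothGr B → ∀ x,
    D.nabla Y (fun z => S.grBracket z (A z) (B z)) x =
      S.grBracket x (D.nabla Y A x) (B x) + S.grBracket x (A x) (D.nabla Y B x)

end Structure

end SubRiemannian

end

/-! In a local frame adapted to the filtration, every fiber of gr becomes the same graded space F =
ℝⁿ. The grading becomes a fixed diagonal operator D (`degOp`), and the bracket together with the
inner product becomes a smooth function T of the point, with values in the bilinear maps F × F → F ×
ℝ (`tensor`). Graded isometries between fibers are the invertible maps that commute with D and carry
T(x) to T(y) (`IsIntertwiner`). A connection with matrix A is strongly compatible if A commutes with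
D and dT(Y) = `infAct` T A, and conversely. The proposition thus compares T staying locally in one
orbit with its derivative being a smoothly chosen infinitesimal action.

From a connection to constant symbol: along a radial segment of a chart, the solution of h' = -A h
carries T at the center to T at the endpoint, by uniqueness for linear differential equations
(`isIntertwiner_of_transport`). So nearby fibers are isometric, and connectedness gives all fibers.
The fiber at any one point serves as the model Carnot algebra.

From constant symbol to a connection: two facts are needed. First, dT(v) lies in the image of
`infAct` T. As T moves inside one orbit this is a tangency statement,
`exists_infAct_eq_of_hasDerivAt`; it is proved by compactness, using intertwiners closest to the
identity and a limit of their normalized displacements. Second, A ↦ `infAct` T A has locally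
constant rank, because an intertwiner conjugates the stabilizers; hence it has a smooth generalized
inverse. Applying that inverse to dT gives a local connection. All conditions are affine in the
connection, so a partition of unity glues the local solutions.

Two properties of T make this work: its form is positive definite on gr_{-1}, and gr_{-1} generates.
They make intertwiners invertible and keep them bounded, which gives the compactness. -/

noncomputable section

namespace SubRiemannian

open Set Filter Metric

/-! ### Algebra and bounds for maps intertwining two structure tensors -/

section Intertwiner

variable {F : Type*} [NormedAddCommGroup F] [NormedSpace ℝ F]

/-- The infinitesimal action of an endomorphism `A` on a pair consisting of a bilinear product
and a bilinear form, encoded as a bilinear map with values in `F × ℝ`. -/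
def infAct (T : F →L[ℝ] F →L[ℝ] F × ℝ) (A : F →L[ℝ] F) : F →L[ℝ] F →L[ℝ] F × ℝ :=
  T ∘L A + ((ContinuousLinearMap.compL ℝ F F (F × ℝ)).flip A) ∘L T -
    (ContinuousLinearMap.compL ℝ F (F × ℝ) (F × ℝ) (A.prodMap 0)) ∘L T

@[simp]
theorem infAct_apply (T : F →L[ℝ] F →L[ℝ] F × ℝ) (A : F →L[ℝ] F) (a b : F) :
    infAct T A a b = T (A a) b + T a (A b) - (A (T a b).1, 0) := by
  simp [infAct, ContinuousLinearMap.compL_apply, Prod.map]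

/-- The infinitesimal action as a linear map in both arguments. -/
def infActₗ : (F →L[ℝ] F →L[ℝ] F × ℝ) →ₗ[ℝ] (F →L[ℝ] F) →ₗ[ℝ] (F →L[ℝ] F →L[ℝ] F × ℝ) :=
  LinearMap.mk₂ ℝ infAct
    (fun _ _ _ => by
      ext <;> simp <;> abel)
    (fun _ _ _ => by
      ext <;> simp [smul_sub])
    (fun _ _ _ => by
      ext <;> simp <;> abel)
    (fun _ _ _ => by
      ext <;> simp [smul_sub])

@[simp]
theorem infActₗ_apply (T : F →L[ℝ] F →L[ℝ] F × ℝ) (A : F →L[ℝ] F) :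
    infActₗ T A = infAct T A := rfl

/-- `h` commutes with the degree operator `D` and carries the product and the form of `T` to those
of `T'`. -/
structure IsIntertwiner (D h : F →L[ℝ] F) (T T' : F →L[ℝ] F →L[ℝ] F × ℝ) : Prop where
  commute : Commute h D
  map : ∀ a b, T' (h a) (h b) = (h (T a b).1, (T a b).2)

variable {D h k : F →L[ℝ] F} {T T' T'' : F →L[ℝ] F →L[ℝ] F × ℝ}

theorem IsIntertwiner.apply_comm (hh : IsIntertwiner D h T T') (a : F) : D (h a) = h (D a) :=
  (DFunLike.congr_fun hh.commute.eq a).symm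

theorem IsIntertwiner.mul (hk : IsIntertwiner D k T' T'') (hh : IsIntertwiner D h T T') :
    IsIntertwiner D (k * h) T T'' where
  commute := hk.commute.mul_left hh.commute
  map a b := by simp [hk.map, hh.map]

theorem IsIntertwiner.one : IsIntertwiner D 1 T T where
  commute := Commute.one_left _
  map a b := by simp

theorem IsIntertwiner.inverse (hh : IsIntertwiner D h T T') (hkh : k * h = 1) (hhk : h * k = 1) :
    IsIntertwiner D k T' T where
  commute := by
    calc k * D = k * D * (h * k) := by rw [hhk, mul_one]
      _ = k * (D * h) * k := by simp only [mul_assoc]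
      _ = k * h * (D * k) := by rw [← hh.commute.eq]; simp only [mul_assoc]
      _ = D * k := by rw [hkh, one_mul]
  map a b := by
    have e (x : F) : h (k x) = x := DFunLike.congr_fun hhk x
    have e' (x : F) : k (h x) = x := DFunLike.congr_fun hkh x
    have := hh.map (k a) (k b)
    rw [e, e] at this
    simp [this, e']

/-- The form is positive definite on the eigenspace of `D` for the eigenvalue `1`. -/
def PosOn (D : F →L[ℝ] F) (T : F →L[ℝ] F →L[ℝ] F × ℝ) : Prop :=
  ∀ a, D a = a → a ≠ 0 → 0 < (T a a).2

/-- The eigenspace of `D` for the eigenvalue `1` generates `F`. -/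
def GenBy (D : F →L[ℝ] F) (T : F →L[ℝ] F →L[ℝ] F × ℝ) : Prop :=
  ∀ V : Submodule ℝ F, (∀ a, D a = a → a ∈ V) → (∀ a, D a = a → ∀ b ∈ V, (T a b).1 ∈ V) → V = ⊤

variable [FiniteDimensional ℝ F]

/-- Preserving a positive definite form makes `h` injective on the 1-eigenspace of `D`, hence
bijective there by finite dimension. Its range contains that eigenspace and is stable under
multiplication by it, so generation forces the range to be everything. -/
theorem IsIntertwiner.surjective (hh : IsIntertwiner D h T T') (hpos : PosOn D T)
    (hgen : GenBy D T') : Function.Surjective h := by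
  have hE : ∀ a, D a = a → ∃ a', D a' = a' ∧ h a' = a := by
    let E₁ : Submodule ℝ F := LinearMap.ker ((D - 1 : F →L[ℝ] F) : F →ₗ[ℝ] F)
    have hE₁ : ∀ a, a ∈ E₁ ↔ D a = a := fun a => by simp [E₁, sub_eq_zero]
    let r : E₁ →ₗ[ℝ] E₁ := (h : F →ₗ[ℝ] F).restrict fun a ha => by
      rw [hE₁] at ha ⊢
      simp [hh.apply_comm, ha]
    have hr : Function.Injective r := by
      rw [← LinearMap.ker_eq_bot, LinearMap.ker_eq_bot']
      rintro ⟨a, ha⟩ hra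
      have h0 : h a = 0 := congrArg Subtype.val hra
      by_contra hne
      have := hpos a ((hE₁ a).1 ha) (fun h => hne (by simpa using h))
      have e := congrArg Prod.snd (hh.map a a)
      simp [h0] at e
      linarith
    intro a ha
    obtain ⟨⟨a', ha'⟩, e⟩ := LinearMap.injective_iff_surjective.1 hr ⟨a, (hE₁ a).2 ha⟩
    exact ⟨a', (hE₁ a').1 ha', congrArg Subtype.val e⟩
  rw [← ContinuousLinearMap.coe_coe, ← LinearMap.range_eq_top]
  refine hgen _ (fun a ha => ?_) fun a ha b hb => ?_
  · obtain ⟨a', -, rfl⟩ := hE a ha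
    exact ⟨a', rfl⟩
  · obtain ⟨a', -, rfl⟩ := hE a ha
    obtain ⟨b', rfl⟩ := hb
    exact ⟨(T a' b').1, by simp [hh.map]⟩

theorem IsIntertwiner.exists_inverse (hh : IsIntertwiner D h T T') (hpos : PosOn D T)
    (hgen : GenBy D T') : ∃ k : F →L[ℝ] F, k * h = 1 ∧ h * k = 1 := by
  have hs := hh.surjective hpos hgen
  have hi : Function.Injective h := LinearMap.injective_iff_surjective (f := (h : F →ₗ[ℝ] F)).2 hs
  let e : F ≃ₗ[ℝ] F := LinearEquiv.ofBijective (h : F →ₗ[ℝ] F) ⟨hi, hs⟩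
  refine ⟨LinearMap.toContinuousLinearMap (e.symm : F →ₗ[ℝ] F), ?_, ?_⟩
  · ext a
    exact e.symm_apply_apply a
  · ext a
    exact e.apply_symm_apply a

/-- A bilinear form that is positive definite on a subspace is bounded below there. -/
theorem exists_pos_le_of_posOn (hpos : PosOn D T) :
    ∃ δ > 0, ∀ a, D a = a → δ * ‖a‖ ^ 2 ≤ (T a a).2 := by
  let K : Set F := {a | D a = a} ∩ sphere 0 1
  have hK : IsCompact K := (isCompact_sphere (0 : F) 1).inter_left
    (isClosed_eq D.continuous continuous_id)
  have hc : Continuous fun a : F => (T a a).2 := by fun_prop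
  rcases K.eq_empty_or_nonempty with hKe | hKn
  · refine ⟨1, one_pos, fun a ha => ?_⟩
    by_cases h0 : a = 0
    · simp [h0]
    · exfalso
      have : (‖a‖⁻¹ • a) ∈ K := ⟨by simp [ha], by simp [norm_smul, h0]⟩
      rw [hKe] at this
      exact this
  · obtain ⟨m, hm, hmin⟩ := hK.exists_isMinOn hKn hc.continuousOn
    refine ⟨(T m m).2, hpos m hm.1 ?_, fun a ha => ?_⟩
    · rintro rfl
      simpa using hm.2
    · by_cases h0 : a = 0
      · simp [h0]
      · have h1 : (‖a‖⁻¹ • a) ∈ K := ⟨by simp [ha], by simp [norm_smul, h0]⟩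
        have h2 := hmin h1
        simp only [mem_ofPred_eq, map_smul, smul_apply, Prod.smul_snd,
          smul_eq_mul] at h2
        have h3 : 0 < ‖a‖ := norm_pos_iff.2 h0
        have h4 : ‖a‖ ^ 2 * (‖a‖⁻¹ * (‖a‖⁻¹ * (T a a).2)) = (T a a).2 := by
          field_simp
        nlinarith [sq_nonneg ‖a‖, mul_le_mul_of_nonneg_left h2 (sq_nonneg ‖a‖)]

/-- Intertwiners with a fixed source and a convergent target are uniformly bounded. -/
theorem exists_bound_intertwiner {ι : Type*} {l : Filter ι} {S : ι → F →L[ℝ] F →L[ℝ] F × ℝ}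
    {T₀ : F →L[ℝ] F →L[ℝ] F × ℝ} (hS : Tendsto S l (𝓝 T₀)) (hpos : PosOn D T₀)
    (hgen : GenBy D T) :
    ∃ C, ∀ᶠ t in l, ∀ h, IsIntertwiner D h T (S t) → ‖h‖ ≤ C := by
  have hnorm := tendsto_iff_norm_sub_tendsto_zero (E := F →L[ℝ] F →L[ℝ] F × ℝ).1 hS
  have hv : ∀ v : F, ∃ C, ∀ᶠ t in l, ∀ h, IsIntertwiner D h T (S t) → ‖h v‖ ≤ C := by
    -- Vectors whose images are eventually bounded form a subspace, so by generation it suffices to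
    -- treat the 1-eigenspace and products with it.
    let V : Submodule ℝ F :=
      { carrier := {v | ∃ C, ∀ᶠ t in l, ∀ h, IsIntertwiner D h T (S t) → ‖h v‖ ≤ C}
        add_mem' := by
          rintro a b ⟨C, hC⟩ ⟨C', hC'⟩
          refine ⟨C + C', ?_⟩
          filter_upwards [hC, hC'] with t h1 h2 h hh
          rw [map_add]
          exact (norm_add_le _ _).trans (add_le_add (h1 h hh) (h2 h hh))
        zero_mem' := ⟨0, by simp⟩
        smul_mem' := by
          rintro c a ⟨C, hC⟩
          refine ⟨‖c‖ * C, ?_⟩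
          filter_upwards [hC] with t h1 h hh
          rw [map_smul, norm_smul]
          exact mul_le_mul_of_nonneg_left (h1 h hh) (norm_nonneg _) }
    have hball : ∀ᶠ t in l, ‖S t - T₀‖ ≤ 1 := by
      exact hnorm.eventually (Iic_mem_nhds one_pos)
    suffices hV : V = ⊤ from fun v => by
      have : v ∈ V := hV ▸ Submodule.mem_top
      exact this
    have hone : ∀ a, D a = a → a ∈ V := by
      intro a ha
      obtain ⟨δ, hδ, hle⟩ := exists_pos_le_of_posOn hpos
      -- `S t` takes the value `(T a a).2` at `h a`, while it keeps at least half of the lower bound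
      -- `δ` of `T₀`. Hence ‖h a‖² ≤ 2 (T a a).2 / δ, and x ≤ x² + 1 removes the square.
      refine ⟨((T a a).2 * (2 / δ)) + 1, ?_⟩
      have hsm : ∀ᶠ t in l, ‖S t - T₀‖ ≤ δ / 2 :=
        hnorm.eventually (Iic_mem_nhds (half_pos hδ))
      filter_upwards [hsm] with t ht h hh
      have h1 : D (h a) = h a := by rw [hh.apply_comm, ha]
      have h2 := hle _ h1
      have h3 : (S t (h a) (h a)).2 = (T a a).2 := by rw [hh.map]
      have h4 : ‖((S t - T₀) (h a) (h a)).2‖ ≤ δ / 2 * ‖h a‖ * ‖h a‖ := by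
        refine (norm_snd_le _).trans (((S t - T₀).le_opNorm₂ _ _).trans ?_)
        gcongr
      have h5 : ((S t - T₀) (h a) (h a)).2 = (T a a).2 - (T₀ (h a) (h a)).2 := by
        simp [h3]
      rw [h5, Real.norm_eq_abs] at h4
      have h6 := (abs_le.1 h4).1
      have h7 : ‖h a‖ ^ 2 ≤ (T a a).2 * (2 / δ) := by
        rw [mul_div_assoc', le_div_iff₀ hδ]
        nlinarith
      nlinarith [sq_nonneg (‖h a‖ - 1)]
    refine hgen V hone fun a ha b hb => ?_
    · obtain ⟨C, hC⟩ := hb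
      obtain ⟨C', hC'⟩ := hone a ha
      refine ⟨(‖T₀‖ + 1) * C' * C, ?_⟩
      filter_upwards [hC, hC', hball] with t h1 h2 h3 h hh
      have e : h (T a b).1 = (S t (h a) (h b)).1 := by rw [hh.map]
      have hn : ‖S t‖ ≤ ‖T₀‖ + 1 := by
        have := norm_add_le T₀ (S t - T₀)
        rw [show T₀ + (S t - T₀) = S t by abel] at this
        linarith
      rw [e]
      refine (norm_fst_le _).trans (((S t).le_opNorm₂ _ _).trans ?_)
      have hb := h1 h hh
      have ha := h2 h hh
      have hC0 : 0 ≤ C' := (norm_nonneg _).trans ha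
      gcongr
  let b := Module.finBasis ℝ F
  choose C hC using fun i => hv (b i)
  obtain ⟨K, hK, hle⟩ := b.exists_opNorm_le (F := F)
  refine ⟨K * ∑ i, |C i|, ?_⟩
  filter_upwards [eventually_all.2 hC] with t ht h hh
  refine hle (Finset.sum_nonneg fun i _ => abs_nonneg _) fun i => ?_
  exact (ht i h hh).trans ((le_abs_self _).trans
    (Finset.single_le_sum (f := fun i => |C i|) (fun i _ => abs_nonneg _) (Finset.mem_univ i)))

end Intertwiner

end SubRiemannian
end

noncomputable section

namespace SubRiemannian

open Set Filter Metric

/-! ### Transport of tensors by linear differential equations -/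

section Transport

variable {F : Type*} [NormedAddCommGroup F] [NormedSpace ℝ F]

/-- Uniqueness for the linear equation `y' = -A y` on `[0, 1]`. -/
theorem eqOn_of_linear_ode {E : Type*} [NormedAddCommGroup E] [NormedSpace ℝ E]
    {A : ℝ → E →L[ℝ] E} (hA : ContinuousOn A (Icc 0 1)) {f g : ℝ → E}
    (hf : ∀ t ∈ Icc (0 : ℝ) 1, HasDerivWithinAt f (A t (f t)) (Icc 0 1) t)
    (hg : ∀ t ∈ Icc (0 : ℝ) 1, HasDerivWithinAt g (A t (g t)) (Icc 0 1) t)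
    (h0 : f 0 = g 0) : f 1 = g 1 := by
  obtain ⟨C, hC⟩ := isCompact_Icc.exists_bound_of_continuousOn hA
  have hIci : ∀ {f : ℝ → E}, (∀ t ∈ Icc (0 : ℝ) 1, HasDerivWithinAt f (A t (f t)) (Icc 0 1) t) →
      ∀ t ∈ Ico (0 : ℝ) 1, HasDerivWithinAt f (A t (f t)) (Ici t) t := fun hf t ht =>
    (hf t (Ico_subset_Icc_self ht)).mono_of_mem_nhdsWithin (Icc_mem_nhdsGE_of_mem ht)
  refine ODE_solution_unique_of_mem_Icc_right (v := fun t y => A t y) (s := fun _ => univ)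
    (K := Real.toNNReal C) (fun t ht => ?_) (fun t ht => (hf t ht).continuousWithinAt) (hIci hf)
    (fun _ _ => mem_univ _) (fun t ht => (hg t ht).continuousWithinAt) (hIci hg)
    (fun _ _ => mem_univ _) h0 (right_mem_Icc.2 zero_le_one)
  refine ((A t).lipschitz.weaken ?_).lipschitzOnWith
  rw [← NNReal.coe_le_coe, coe_nnnorm]
  exact (hC t (Ico_subset_Icc_self ht)).trans (Real.le_coe_toNNReal C)

variable {D : F →L[ℝ] F} {A h : ℝ → F →L[ℝ] F} {T : ℝ → F →L[ℝ] F →L[ℝ] F × ℝ}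

/-- If `T` evolves by the infinitesimal action of `A`, then the solution of `h' = -A h` intertwines
the initial and the final value of `T`. -/
theorem isIntertwiner_of_transport (hA : ContinuousOn A (Icc 0 1))
    (hD : ∀ t ∈ Icc (0 : ℝ) 1, Commute (A t) D)
    (hT : ∀ t ∈ Icc (0 : ℝ) 1, HasDerivWithinAt T (infAct (T t) (A t)) (Icc 0 1) t)
    (hh : ∀ t ∈ Icc (0 : ℝ) 1, HasDerivWithinAt h (-(A t * h t)) (Icc 0 1) t)
    (h0 : h 0 = 1) : IsIntertwiner D (h 1) (T 0) (T 1) where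
  commute := by
    have key : ∀ a, (h 1 * D - D * h 1) a = 0 := by
      intro a
      refine eqOn_of_linear_ode (A := fun t => -(A t)) (f := fun t => (h t * D - D * h t) a)
        (g := fun _ => 0) hA.neg (fun t ht => ?_) (fun t ht => ?_) (by simp [h0])
      · have e1 : HasDerivWithinAt (fun t => h t (D a)) (-(A t (h t (D a)))) (Icc 0 1) t := by
          simpa using (hh t ht).clm_apply (hasDerivWithinAt_const t (Icc 0 1) (D a))
        have e2 : HasDerivWithinAt (fun t => h t a) (-(A t (h t a))) (Icc 0 1) t := by
          simpa using (hh t ht).clm_apply (hasDerivWithinAt_const t (Icc 0 1) a)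
        have e3 := e1.sub (D.hasFDerivAt.comp_hasDerivWithinAt t e2)
        have e4 : D (A t (h t a)) = A t (D (h t a)) :=
          (DFunLike.congr_fun (hD t ht).eq (h t a)).symm
        refine e3.congr_deriv ?_
        simp [e4]
        abel
      · simpa using hasDerivWithinAt_const t (Icc (0 : ℝ) 1) (0 : F)
    rw [commute_iff_eq, ← sub_eq_zero]
    exact ContinuousLinearMap.ext key
  map a b := by
    -- In the derivative of T(h a, h b) the two slot terms of `infAct` cancel against h' = -A h.
    -- What remains is the linear equation y' = -(A ⊕ 0) y, which the right-hand side also solves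
    -- with the same initial value.
    let N : ℝ → F × ℝ →L[ℝ] F × ℝ := fun t => -((A t).prodMap 0)
    have hN : ContinuousOn N (Icc 0 1) := by
      have : ContinuousOn (fun t => ContinuousLinearMap.prodMapL ℝ F F ℝ ℝ (A t, 0)) (Icc 0 1) :=
        (ContinuousLinearMap.continuous _).comp_continuousOn (hA.prodMk continuousOn_const)
      exact this.neg
    refine eqOn_of_linear_ode (A := N) (f := fun t => T t (h t a) (h t b))
      (g := fun t => (h t (T 0 a b).1, (T 0 a b).2)) hN (fun t ht => ?_) (fun t ht => ?_)
      (by simp [h0])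
    · have e (a : F) : HasDerivWithinAt (fun t => h t a) (-(A t (h t a))) (Icc 0 1) t := by
        simpa using (hh t ht).clm_apply (hasDerivWithinAt_const t (Icc 0 1) a)
      refine (((hT t ht).clm_apply (e a)).clm_apply (e b)).congr_deriv ?_
      ext
      · simp [N, Prod.map]
        abel
      · simp [N, Prod.map]
    · have e (a : F) : HasDerivWithinAt (fun t => h t a) (-(A t (h t a))) (Icc 0 1) t := by
        simpa using (hh t ht).clm_apply (hasDerivWithinAt_const t (Icc 0 1) a)
      refine ((e _).prodMk (hasDerivWithinAt_const t (Icc 0 1) _)).congr_deriv ?_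
      simp [N, Prod.map]

/-- Existence of parallel transport for a connection matrix of small norm. -/
theorem exists_transport [CompleteSpace F] (hA : ContinuousOn A (Icc 0 1))
    (hle : ∀ t ∈ Icc (0 : ℝ) 1, ‖A t‖ ≤ 1 / 2) :
    ∃ h : ℝ → F →L[ℝ] F, h 0 = 1 ∧
      ∀ t ∈ Icc (0 : ℝ) 1, HasDerivWithinAt h (-(A t * h t)) (Icc 0 1) t := by
  -- On the unit ball around the identity ‖B‖ ≤ 2, so ‖A t * B‖ ≤ 1 and the solution stays in the
  -- ball for the whole unit of time. The bound 1/2 is chosen for this.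
  have hpl : IsPicardLindelof (fun t (B : F →L[ℝ] F) => -(A t * B)) (tmin := 0) (tmax := 1)
      ⟨0, left_mem_Icc.2 zero_le_one⟩ (1 : F →L[ℝ] F) 1 0 1 (1 / 2) := by
    refine ⟨fun t ht => ?_, fun B hB => ?_, fun t ht B hB => ?_, by simp⟩
    · refine LipschitzOnWith.of_dist_le_mul fun B _ B' _ => ?_
      rw [dist_eq_norm, dist_eq_norm, show -(A t * B) - -(A t * B') = -(A t * (B - B')) by
        rw [mul_sub]; abel, norm_neg]
      refine (norm_mul_le _ _).trans ?_
      have := hle t ht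
      push_cast
      gcongr
    · exact (hA.mul continuousOn_const).neg
    · rw [norm_neg]
      refine (norm_mul_le _ _).trans ?_
      have h1 : ‖(1 : F →L[ℝ] F)‖ ≤ 1 := ContinuousLinearMap.norm_id_le
      have h2 : ‖B‖ ≤ 2 := by
        have := norm_add_le (B - 1) (1 : F →L[ℝ] F)
        rw [sub_add_cancel] at this
        rw [mem_closedBall, dist_eq_norm] at hB
        push_cast at hB
        linarith
      have := hle t ht
      push_cast
      nlinarith [norm_nonneg B, norm_nonneg (A t)]
  obtain ⟨h, h0, hh⟩ := hpl.exists_eq_forall_mem_Icc_hasDerivWithinAt₀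
  exact ⟨h, h0, hh⟩

/-- The exponential of an infinitesimal automorphism is an automorphism. -/
theorem isIntertwiner_exp [CompleteSpace F] {T : F →L[ℝ] F →L[ℝ] F × ℝ} {η : F →L[ℝ] F}
    (hη : Commute η D) (h0 : infAct T η = 0) (s : ℝ) :
    IsIntertwiner D (NormedSpace.exp (s • η)) T T := by
  have h0' : infAct T (-(s • η)) = 0 := by
    rw [← infActₗ_apply, map_neg, map_smul, infActₗ_apply, h0]
    ext <;> simp
  -- The exponential is the transport for the constant matrix `-(s • η)`, along which the constant
  -- tensor `T` satisfies the transport equation.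
  have := isIntertwiner_of_transport (D := D) (A := fun _ => -(s • η))
    (h := fun t => NormedSpace.exp (t • (s • η))) (T := fun _ => T) continuousOn_const
    (fun t _ => (hη.smul_left s).neg_left)
    (fun t _ => by
      rw [h0']
      exact hasDerivWithinAt_const (𝕜 := ℝ) (F := F →L[ℝ] F →L[ℝ] F × ℝ) _ _ _)
    (fun t _ => by
      simpa using! (hasDerivAt_exp_smul_const' (𝕂 := ℝ) (s • η) t).hasDerivWithinAt)
    (by simp)
  simpa using this

end Transport

/-! ### Curves inside an orbit have velocity tangent to the orbit -/

section Tangency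

variable {F : Type*} [NormedAddCommGroup F] [NormedSpace ℝ F] 
  {D : F →L[ℝ] F}

theorem tendsto_clm_apply₂ {ι : Type*} {l : Filter ι}
    {S : ι → F →L[ℝ] F →L[ℝ] F × ℝ} {T₀ : F →L[ℝ] F →L[ℝ] F × ℝ} {u v : ι → F} {a b : F}
    (hS : Tendsto S l (𝓝 T₀)) (hu : Tendsto u l (𝓝 a)) (hv : Tendsto v l (𝓝 b)) :
    Tendsto (fun t => S t (u t) (v t)) l (𝓝 (T₀ a b)) := by
  have hc : Continuous fun p : (F →L[ℝ] F →L[ℝ] F × ℝ) × F × F => p.1 p.2.1 p.2.2 := by fun_prop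
  exact (hc.tendsto (T₀, a, b)).comp (hS.prodMk_nhds (hu.prodMk_nhds hv))

theorem tendsto_clm_apply {ι : Type*} {l : Filter ι} {h : ι → F →L[ℝ] F} {h₀ : F →L[ℝ] F}
    (hh : Tendsto h l (𝓝 h₀)) (a : F) : Tendsto (fun t => h t a) l (𝓝 (h₀ a)) :=
  ((ContinuousLinearMap.apply ℝ F a).continuous.tendsto h₀).comp hh

theorem isClosed_isIntertwiner (T T' : F →L[ℝ] F →L[ℝ] F × ℝ) :
    IsClosed {h : F →L[ℝ] F | IsIntertwiner D h T T'} := by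
  have : {h : F →L[ℝ] F | IsIntertwiner D h T T'} = {h | h * D = D * h} ∩
      ⋂ a, ⋂ b, {h | T' (h a) (h b) = (h (T a b).1, (T a b).2)} := by
    ext h
    simp only [mem_inter_iff, mem_iInter, mem_ofPred_eq]
    exact ⟨fun hh => ⟨hh.commute.eq, hh.map⟩, fun hh => ⟨hh.1, hh.2⟩⟩
  rw [this]
  refine (isClosed_eq (by fun_prop) (by fun_prop)).inter
    (isClosed_iInter fun a => isClosed_iInter fun b => isClosed_eq (by fun_prop) (by fun_prop))

/-- A limit of intertwiners is an intertwiner. -/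
theorem isIntertwiner_of_tendsto {ι : Type*} {l : Filter ι} [l.NeBot]
    {S : ι → F →L[ℝ] F →L[ℝ] F × ℝ} {T T₀ : F →L[ℝ] F →L[ℝ] F × ℝ} {h : ι → F →L[ℝ] F}
    {h₀ : F →L[ℝ] F} (hS : Tendsto S l (𝓝 T₀)) (hh : Tendsto h l (𝓝 h₀))
    (hi : ∀ᶠ t in l, IsIntertwiner D (h t) T (S t)) : IsIntertwiner D h₀ T T₀ where
  commute := by
    refine tendsto_nhds_unique_of_eventuallyEq (hh.mul_const D) (hh.const_mul D) ?_
    filter_upwards [hi] with t ht using ht.commute.eq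
  map a b := by
    refine tendsto_nhds_unique_of_eventuallyEq
      (tendsto_clm_apply₂ hS (tendsto_clm_apply hh a) (tendsto_clm_apply hh b))
      ((tendsto_clm_apply hh (T a b).1).prodMk_nhds tendsto_const_nhds) ?_
    filter_upwards [hi] with t ht using ht.map a b

/-- Bounded maps to a proper space converge along ultrafilters. -/
theorem exists_tendsto_ultrafilter {ι E : Type*} [NormedAddCommGroup E] [ProperSpace E]
    (l : Ultrafilter ι) {f : ι → E} {C : ℝ} (hf : ∀ᶠ t in (l : Filter ι), ‖f t‖ ≤ C) :
    ∃ x, Tendsto f l (𝓝 x) := by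
  obtain ⟨x, -, hx⟩ := (isCompact_closedBall (0 : E) C).ultrafilter_le_nhds (l.map f)
    (by
      rw [Ultrafilter.coe_map, le_principal_iff, mem_map]
      filter_upwards [hf] with t ht
      simpa using ht)
  exact ⟨x, hx⟩

variable [FiniteDimensional ℝ F]

/-- Infinitesimal automorphisms are orthogonal to the displacement of an intertwiner that is closest
to the identity. -/
theorem inner_eq_zero_of_closest {H : Type*} [NormedAddCommGroup H] [InnerProductSpace ℝ H]
    (τ : (F →L[ℝ] F) ≃L[ℝ] H) {T T' : F →L[ℝ] F →L[ℝ] F × ℝ} {h η : F →L[ℝ] F}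
    (hh : IsIntertwiner D h T T')
    (hmin : ∀ k, IsIntertwiner D k T T' → ‖τ (h - 1)‖ ≤ ‖τ (k - 1)‖)
    (hη : Commute η D) (h0 : infAct T η = 0) : inner ℝ (τ (h - 1)) (τ (h * η)) = 0 := by
  -- The curve `h * exp (s • η)` consists of intertwiners, so its squared distance to the identity
  -- is minimal at s = 0; the derivative there is twice the required inner product.
  have hd : HasDerivAt (fun s : ℝ => τ (h * NormedSpace.exp (s • η) - 1)) (τ (h * η)) 0 := by
    have e := hasDerivAt_exp_smul_const' (𝕂 := ℝ) η (0 : ℝ)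
    simp only [zero_smul, NormedSpace.exp_zero, mul_one] at e
    exact (τ : (F →L[ℝ] F) →L[ℝ] H).hasFDerivAt.comp_hasDerivAt _ ((e.const_mul h).sub_const 1)
  have hd2 := hd.norm_sq
  have hm : IsLocalMin (fun s : ℝ => ‖τ (h * NormedSpace.exp (s • η) - 1)‖ ^ 2) 0 := by
    refine Eventually.of_forall fun s => ?_
    have := hmin _ (hh.mul (isIntertwiner_exp hη h0 s))
    simp only [zero_smul, NormedSpace.exp_zero, mul_one]
    gcongr
  have := hm.hasDerivAt_eq_zero hd2
  simpa using this

theorem tendsto_slope_zero {E : Type*} [NormedAddCommGroup E] [NormedSpace ℝ E] {f : ℝ → E} {f' : E}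
    (hf : HasDerivAt f f' 0) : Tendsto (fun t : ℝ => t⁻¹ • (f t - f 0)) (𝓝[>] 0) (𝓝 f') := by
  simpa using hf.tendsto_slope_zero_right

set_option maxHeartbeats 1000000 in
/-- A differentiable curve of tensors inside an orbit is tangent to the orbit. -/
theorem exists_infAct_eq_of_hasDerivAt {T : ℝ → F →L[ℝ] F →L[ℝ] F × ℝ}
    {T' : F →L[ℝ] F →L[ℝ] F × ℝ} (hT : HasDerivAt T T' 0) (hpos : PosOn D (T 0))
    (hgen : GenBy D (T 0)) (horb : ∀ᶠ t in 𝓝 0, ∃ h, IsIntertwiner D h (T 0) (T t)) :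
    ∃ A, Commute A D ∧ infAct (T 0) A = T' := by
  let τ : (F →L[ℝ] F) ≃L[ℝ] EuclideanSpace ℝ (Fin (Module.finrank ℝ (F →L[ℝ] F))) := toEuclidean
  -- Along an ultrafilter refining t → 0⁺ every bounded family converges, so no subsequences have to
  -- be extracted.
  let l : Ultrafilter ℝ := Ultrafilter.of (𝓝[>] 0)
  have hl : (l : Filter ℝ) ≤ 𝓝[>] 0 := Ultrafilter.of_le _
  have hl' : (l : Filter ℝ) ≤ 𝓝 0 := hl.trans nhdsWithin_le_nhds
  have hTl : Tendsto T l (𝓝 (T 0)) :=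
    (HasDerivAt.continuousAt (F := F →L[ℝ] F →L[ℝ] F × ℝ) hT).tendsto.mono_left hl'
  -- Intertwiners are only determined up to the stabilizer of `T 0`. Taking one closest to the
  -- identity in a Euclidean norm removes this freedom; it exists because the set of intertwiners is
  -- closed.
  have hmin : ∀ᶠ t in (l : Filter ℝ), ∃ h, IsIntertwiner D h (T 0) (T t) ∧
      ∀ k, IsIntertwiner D k (T 0) (T t) → ‖τ (h - 1)‖ ≤ ‖τ (k - 1)‖ := by
    filter_upwards [hl' horb] with t ht
    obtain ⟨h₁, hh₁⟩ := ht
    have hcl : IsClosed (τ '' {h : F →L[ℝ] F | IsIntertwiner D h (T 0) (T t)}) :=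
      τ.toHomeomorph.isClosedMap _ (isClosed_isIntertwiner _ _)
    obtain ⟨-, ⟨h, hh, rfl⟩, hd⟩ := hcl.exists_infDist_eq_dist ⟨_, mem_image_of_mem _ hh₁⟩ (τ 1)
    refine ⟨h, hh, fun k hk => ?_⟩
    have := infDist_le_dist_of_mem (x := τ 1) (mem_image_of_mem τ
      (show k ∈ {h : F →L[ℝ] F | IsIntertwiner D h (T 0) (T t)} from hk))
    rw [hd, dist_comm, dist_eq_norm, dist_comm, dist_eq_norm, ← map_sub, ← map_sub] at this
    exact this
  choose! h hh hclose using fun t (ht : ∃ h, IsIntertwiner D h (T 0) (T t) ∧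
      ∀ k, IsIntertwiner D k (T 0) (T t) → ‖τ (h - 1)‖ ≤ ‖τ (k - 1)‖) => ht
  replace hh := hmin.mono hh
  replace hclose := hmin.mono hclose
  obtain ⟨C, hC⟩ := exists_bound_intertwiner hTl hpos hgen
  -- the closest intertwiners tend to the identity
  have hlim : Tendsto h l (𝓝 1) := by
    obtain ⟨h₀, hh₀⟩ := exists_tendsto_ultrafilter l (f := h) (C := C) (by
      filter_upwards [hC, hh] with t h1 h2 using h1 _ h2)
    have hi := isIntertwiner_of_tendsto hTl hh₀ hh
    -- The limit `h₀` is an automorphism of `T 0`, so `h t * h₀⁻¹` is a competitor that tends to 1,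
    -- and minimality squeezes `h t`.
    obtain ⟨k, hkh, hhk⟩ := hi.exists_inverse hpos hgen
    have hk := hi.inverse hkh hhk
    have h1 : Tendsto (fun t => ‖τ (h t * k - 1)‖) l (𝓝 0) := by
      have h2 : Tendsto (fun t => h t * k - 1) l (𝓝 0) := by
        simpa [hhk] using (hh₀.mul_const k).sub_const 1
      simpa using ((τ.continuous.tendsto 0).comp h2).norm
    have h3 : Tendsto (fun t => τ (h t - 1)) l (𝓝 0) := by
      refine squeeze_zero_norm' ?_ h1
      filter_upwards [hclose, hh] with t h4 h5 using h4 _ (h5.mul hk)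
    have h6 := (τ.symm.continuous.tendsto 0).comp h3
    simpa [Function.comp_def] using h6.add_const 1
  have hslope : Tendsto (fun t : ℝ => t⁻¹ • (T t - T 0)) l (𝓝 T') := by
    exact (tendsto_slope_zero (E := F →L[ℝ] F →L[ℝ] F × ℝ) hT).mono_left hl
  -- If `h t = 1` along the ultrafilter, the tensor does not move and its derivative is zero.
  -- Otherwise the displacement `h t - 1` can be normalized to a unit direction `u t` with limit
  -- `ξ`.
  rcases l.eventually_or.1 (Eventually.of_forall fun t => em (h t = 1)) with h1 | h1
  · refine ⟨0, Commute.zero_left _, ?_⟩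
    rw [← infActₗ_apply, map_zero]
    refine tendsto_nhds_unique_of_eventuallyEq tendsto_const_nhds hslope ?_
    filter_upwards [h1, hh] with t h2 h3
    have : T t = T 0 := by
      ext a b <;> simpa [h2] using congrArg _ (h3.map a b)
    rw [this]
    ext <;> simp
  · let ε : ℝ → ℝ := fun t => ‖τ (h t - 1)‖
    let u : ℝ → F →L[ℝ] F := fun t => (ε t)⁻¹ • (h t - 1)
    have hε : ∀ᶠ t in (l : Filter ℝ), 0 < ε t := by
      filter_upwards [h1] with t ht
      simpa [ε, sub_eq_zero] using ht
    have hε0 : Tendsto ε l (𝓝 0) := by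
      have h2 : Tendsto (fun t => h t - 1) l (𝓝 0) := by simpa using hlim.sub_const 1
      simpa [ε] using ((τ.continuous.tendsto 0).comp h2).norm
    have hτu : ∀ᶠ t in (l : Filter ℝ), ‖τ (u t)‖ = 1 := by
      filter_upwards [hε] with t ht
      simp only [u, map_smul, norm_smul, norm_inv, Real.norm_eq_abs, abs_of_pos ht]
      exact inv_mul_cancel₀ ht.ne'
    obtain ⟨z, hz⟩ := exists_tendsto_ultrafilter l (f := fun t => τ (u t)) (C := 1)
      (hτu.mono fun t ht => ht.le)
    obtain ⟨ξ, rfl⟩ := τ.surjective z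
    have hu : Tendsto u l (𝓝 ξ) := by
      simpa [Function.comp_def] using (τ.symm.continuous.tendsto _).comp hz
    have hξ1 : ‖τ ξ‖ = 1 :=
      tendsto_nhds_unique_of_eventuallyEq hz.norm tendsto_const_nhds hτu
    have hhu : ∀ᶠ t in (l : Filter ℝ), h t = 1 + ε t • u t := by
      filter_upwards [hε] with t ht
      simp [u, smul_smul, mul_inv_cancel₀ ht.ne']
    have hξD : Commute ξ D := by
      refine tendsto_nhds_unique_of_eventuallyEq (hu.mul_const D) (hu.const_mul D) ?_
      filter_upwards [hh] with t ht
      exact ((ht.commute.sub_left (Commute.one_left D)).smul_left _).eq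
    -- If `ξ` were an infinitesimal automorphism, `u t` would be orthogonal to `h t * ξ` by
    -- minimality, and the limit would give ⟨ξ, ξ⟩ = 0 for a unit vector.
    have hne : infAct (T 0) ξ ≠ 0 := by
      intro h0
      have hin : Tendsto (fun t => inner ℝ (τ (u t)) (τ (h t * ξ))) l
          (𝓝 (inner ℝ (τ ξ) (τ ξ))) := by
        have h2 : Tendsto (fun t => h t * ξ) l (𝓝 ξ) := by simpa using hlim.mul_const ξ
        exact hz.inner ((τ.continuous.tendsto ξ).comp h2)
      have hz0 : inner ℝ (τ ξ) (τ ξ) = (0 : ℝ) := by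
        refine tendsto_nhds_unique_of_eventuallyEq hin tendsto_const_nhds ?_
        filter_upwards [hh, hclose] with t h2 h3
        have := inner_eq_zero_of_closest τ h2 h3 hξD h0
        simp only [u, map_smul, inner_smul_left]
        rw [this, mul_zero]
      rw [inner_self_eq_zero] at hz0
      simp [hz0] at hξ1
    -- the difference quotients are multiples of the infinitesimal action of `u t`
    have hlimw : ∀ a b, Tendsto (fun t => infAct (T 0) (u t) a b + ε t • T 0 (u t a) (u t b)) l
        (𝓝 (infAct (T 0) ξ a b)) := by
      intro a b
      have h2 : Tendsto (fun t => infAct (T 0) (u t) a b) l (𝓝 (infAct (T 0) ξ a b)) := by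
        simp only [infAct_apply]
        exact ((tendsto_clm_apply₂ tendsto_const_nhds (tendsto_clm_apply hu a)
          tendsto_const_nhds).add (tendsto_clm_apply₂ tendsto_const_nhds tendsto_const_nhds
          (tendsto_clm_apply hu b))).sub
          ((tendsto_clm_apply hu _).prodMk_nhds tendsto_const_nhds)
      have h3 := hε0.smul (tendsto_clm_apply₂ (tendsto_const_nhds (x := T 0))
        (tendsto_clm_apply hu a) (tendsto_clm_apply hu b))
      simpa using h2.add h3
    have hlimT : ∀ a b, Tendsto (fun t => (t⁻¹ • (T t - T 0)) (h t a) (h t b)) l (𝓝 (T' a b)) := by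
      intro a b
      exact tendsto_clm_apply₂ hslope (tendsto_clm_apply hlim a) (tendsto_clm_apply hlim b)
    have hkey : ∀ a b, ∀ᶠ t in (l : Filter ℝ), (t⁻¹ • (T t - T 0)) (h t a) (h t b) =
        (-(t⁻¹ * ε t)) • (infAct (T 0) (u t) a b + ε t • T 0 (u t a) (u t b)) := by
      intro a b
      filter_upwards [hh, hhu] with t h2 h3
      have h4 := h2.map a b
      have h5 (x : F) : h t x = x + ε t • u t x := by rw [h3]; simp
      have h6 : (T t - T 0) (h t a) (h t b) =
          -(ε t • (infAct (T 0) (u t) a b + ε t • T 0 (u t a) (u t b))) := by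
        rw [sub_apply, sub_apply, h4, h5, h5, h5]
        ext
        · simp [smul_add, smul_sub]
          abel
        · simp
          ring
      rw [smul_apply, smul_apply, h6, smul_neg, smul_smul, neg_smul]
    obtain ⟨a₀, b₀, hab⟩ : ∃ a₀ b₀, infAct (T 0) ξ a₀ b₀ ≠ 0 := by
      by_contra! hcon
      exact hne (by ext a b <;> simp only [hcon a b] <;> simp)
    -- Nothing so far bounds ε t / t. Comparing both sides of `hkey` at one pair where the action of
    -- `ξ` is nonzero shows that the ratio converges.
    have hratio : Tendsto (fun t => t⁻¹ * ε t) l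
        (𝓝 (‖T' a₀ b₀‖ / ‖infAct (T 0) ξ a₀ b₀‖)) := by
      refine ((hlimT a₀ b₀).norm.div (hlimw a₀ b₀).norm (norm_ne_zero_iff.2 hab)).congr' ?_
      filter_upwards [hkey a₀ b₀, hε, hl self_mem_nhdsWithin,
        (hlimw a₀ b₀).eventually_ne hab] with t h2 h3 (h4 : 0 < t) h5
      change ‖_‖ / ‖_‖ = _
      rw [h2, norm_smul, norm_neg, mul_div_cancel_right₀ _ (norm_ne_zero_iff.2 h5),
        Real.norm_of_nonneg (by positivity)]
    refine ⟨-(‖T' a₀ b₀‖ / ‖infAct (T 0) ξ a₀ b₀‖) • ξ, hξD.smul_left _, ?_⟩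
    have hfin : ∀ a b, T' a b = (-(‖T' a₀ b₀‖ / ‖infAct (T 0) ξ a₀ b₀‖)) • infAct (T 0) ξ a b :=
      fun a b => tendsto_nhds_unique_of_eventuallyEq (hlimT a b)
        (hratio.neg.smul (hlimw a b)) (hkey a b)
    rw [← infActₗ_apply, map_smul, infActₗ_apply]
    ext a b <;> rw [hfin a b] <;> rfl

end Tangency

end SubRiemannian
end

noncomputable section

namespace SubRiemannian

open Set Filter Metric

/-! ### Stabilizers along an orbit are conjugate -/

section ConstantRank

variable {F : Type*} [NormedAddCommGroup F] [NormedSpace ℝ F]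

/-- The endomorphisms that commute with `D`. -/
def commutant (D : F →L[ℝ] F) : Submodule ℝ (F →L[ℝ] F) where
  carrier := {A | Commute A D}
  add_mem' ha hb := ha.add_left hb
  zero_mem' := Commute.zero_left D
  smul_mem' c _ ha := ha.smul_left c

/-- The infinitesimal action of the endomorphisms that commute with `D`. -/
def infActOn (D : F →L[ℝ] F) (T : F →L[ℝ] F →L[ℝ] F × ℝ) :
    commutant D →ₗ[ℝ] (F →L[ℝ] F →L[ℝ] F × ℝ) :=
  (infActₗ T).domRestrict (commutant D)

variable {D h k : F →L[ℝ] F} {T T' : F →L[ℝ] F →L[ℝ] F × ℝ}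

/-- The infinitesimal action is natural under intertwiners: conjugating the endomorphism by `h`
transports its action on `T` to its action on `T'`. Hence conjugation maps stabilizer to stabilizer.
-/
theorem infAct_conj (hh : IsIntertwiner D h T T') (hkh : k * h = 1) {A : F →L[ℝ] F} (a b : F) :
    infAct T' (h * A * k) (h a) (h b) = (h (infAct T A a b).1, (infAct T A a b).2) := by
  have e' (x : F) : k (h x) = x := DFunLike.congr_fun hkh x
  ext <;> simp [e', hh.map]

variable [FiniteDimensional ℝ F]

/-- Conjugation by an intertwiner identifies the stabilizers. -/
theorem IsIntertwiner.exists_commutant_equiv (hh : IsIntertwiner D h T T') (hpos : PosOn D T)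
    (hgen : GenBy D T') : ∃ c : commutant D ≃ₗ[ℝ] commutant D,
      ∀ A, infActOn D T' (c A) = 0 ↔ infActOn D T A = 0 := by
  obtain ⟨k, hkh, hhk⟩ := hh.exists_inverse hpos hgen
  have hk := hh.inverse hkh hhk
  have e (x : F) : h (k x) = x := DFunLike.congr_fun hhk x
  let c (h k : F →L[ℝ] F) : (F →L[ℝ] F) →ₗ[ℝ] (F →L[ℝ] F) :=
    { toFun := fun A => h * A * k
      map_add' := fun A B => by rw [mul_add, add_mul]
      map_smul' := fun r A => by simp }
  have hc {h k : F →L[ℝ] F} (h1 : Commute h D) (h2 : Commute k D) :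
      ∀ A ∈ commutant D, c h k A ∈ commutant D := fun A hA => (h1.mul_left hA).mul_left h2
  have hcc {h k : F →L[ℝ] F} (hhk : h * k = 1) (A : F →L[ℝ] F) : h * (k * A * h) * k = A := by
    rw [← mul_assoc, ← mul_assoc, hhk, one_mul, mul_assoc, hhk, mul_one]
  refine ⟨LinearEquiv.ofLinearMap ((c h k).restrict (hc hh.commute hk.commute))
    ((c k h).restrict (hc hk.commute hh.commute))
    (LinearMap.ext fun A => Subtype.ext (hcc hhk A.1))
    (LinearMap.ext fun A => Subtype.ext (hcc hkh A.1)), fun A => ?_⟩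
  change infAct T' (h * A.1 * k) = 0 ↔ infAct T A.1 = 0
  refine ⟨fun h0 => ?_, fun h0 => ?_⟩
  · have hkA := infAct_conj hk hhk (A := h * A.1 * k)
    rw [hcc hkh, h0] at hkA
    have e' (x : F) : k (h x) = x := DFunLike.congr_fun hkh x
    ext a b <;> rw [← e' a, ← e' b, hkA] <;> simp
  · ext a b <;> rw [← e a, ← e b, infAct_conj hh hkh, h0] <;> simp

end ConstantRank

/-! ### Smooth generalized inverses for families of constant rank -/

section GeneralizedInverse

variable {n : ℕ} {M : Type*} [TopologicalSpace M] [ChartedSpace (EuclideanSpace ℝ (Fin n)) M]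
  {P Q : Type*} [NormedAddCommGroup P] [NormedSpace ℝ P] [FiniteDimensional ℝ P]
  [NormedAddCommGroup Q] [NormedSpace ℝ Q] [FiniteDimensional ℝ Q]

/-- A smooth family of linear maps of constant rank has a smooth family of generalized inverses. -/
theorem exists_smooth_generalized_inverse {L : M → P →L[ℝ] Q} {x₀ : M}
    (hL : ∀ᶠ x in 𝓝 x₀, ContMDiffAt (𝓡 n) 𝓘(ℝ, P →L[ℝ] Q) ∞ L x)
    (hrank : ∀ᶠ x in 𝓝 x₀, Module.finrank ℝ (LinearMap.range (L x : P →ₗ[ℝ] Q)) =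
      Module.finrank ℝ (LinearMap.range (L x₀ : P →ₗ[ℝ] Q))) :
    ∃ S : M → Q →L[ℝ] P, ∀ᶠ x in 𝓝 x₀, ContMDiffAt (𝓡 n) 𝓘(ℝ, Q →L[ℝ] P) ∞ S x ∧
      ∀ p, L x (S x (L x p)) = L x p := by
  let R := LinearMap.range (L x₀ : P →ₗ[ℝ] Q)
  obtain ⟨π', hπ'⟩ := LinearMap.exists_leftInverse_of_injective R.subtype R.ker_subtype
  obtain ⟨ι', hι'⟩ := LinearMap.exists_rightInverse_of_surjective
    (L x₀ : P →ₗ[ℝ] Q).rangeRestrict (L x₀ : P →ₗ[ℝ] Q).range_rangeRestrict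
  let π : Q →L[ℝ] R := LinearMap.toContinuousLinearMap π'
  let ι : R →L[ℝ] P := LinearMap.toContinuousLinearMap ι'
  -- Compressed to the range `R` of `L x₀`, the family is the identity at `x₀`, hence invertible
  -- nearby. The generalized inverse is ι N⁻¹ π.
  let N : M → R →L[ℝ] R := fun x => π ∘L (L x ∘L ι)
  have hN0 : N x₀ = (ContinuousLinearEquiv.refl ℝ R : R →L[ℝ] R) := by
    ext r
    have h1 : L x₀ (ι' r) = r := congrArg Subtype.val (DFunLike.congr_fun hι' r)
    have h2 : π' (r : Q) = r := DFunLike.congr_fun hπ' r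
    simp [N, π, ι, h1, h2]
  have hNs : ∀ᶠ x in 𝓝 x₀, ContMDiffAt (𝓡 n) 𝓘(ℝ, R →L[ℝ] R) ∞ N x := by
    filter_upwards [hL] with x hx
    exact contMDiffAt_const.clm_comp (hx.clm_comp contMDiffAt_const)
  have hNinv : ∀ᶠ x in 𝓝 x₀, N x ∈ range ((↑) : (R ≃L[ℝ] R) → R →L[ℝ] R) :=
    hNs.self_of_nhds.continuousAt.preimage_mem_nhds
      (hN0 ▸ ContinuousLinearEquiv.nhds (ContinuousLinearEquiv.refl ℝ R))
  refine ⟨fun x => ι ∘L (N x).inverse ∘L π, ?_⟩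
  filter_upwards [hNs, hNinv, hrank] with x hx hinv hr
  obtain ⟨e, he⟩ := hinv
  refine ⟨?_, fun p => ?_⟩
  · have h1 : ContMDiffAt (𝓡 n) 𝓘(ℝ, R →L[ℝ] R) ∞ (fun x => (N x).inverse) x := by
      have h2 : ContDiffAt ℝ ∞ (ContinuousLinearMap.inverse : (R →L[ℝ] R) → R →L[ℝ] R) (N x) :=
        he ▸ contDiffAt_map_inverse e
      exact h2.contMDiffAt.comp x hx
    exact contMDiffAt_const.clm_comp (h1.clm_comp contMDiffAt_const)
  · have hsurj : Function.Surjective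
        ((π : Q →ₗ[ℝ] R).domRestrict (LinearMap.range (L x : P →ₗ[ℝ] Q))) := by
      intro r
      refine ⟨⟨L x (ι (e.symm r)), ⟨_, rfl⟩⟩, ?_⟩
      have : N x (e.symm r) = r := by rw [← he]; simp
      exact this
    have hinj := (LinearMap.injective_iff_surjective_of_finrank_eq_finrank hr).2 hsurj
    have h1 : N x ((N x).inverse (π (L x p))) = π (L x p) := by
      rw [← he, ContinuousLinearMap.inverse_equiv]
      simp
    have h2 := @hinj ⟨L x (ι ((N x).inverse (π (L x p)))), ⟨_, rfl⟩⟩ ⟨L x p, ⟨_, rfl⟩⟩ h1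
    exact congrArg Subtype.val h2

end GeneralizedInverse

end SubRiemannian
end

noncomputable section

namespace SubRiemannian

open Set Filter

/-! ### Smooth vector fields, brackets and coefficients in frames -/

section SmoothFields

variable {n : ℕ} {M : Type*} [TopologicalSpace M] [ChartedSpace (EuclideanSpace ℝ (Fin n)) M]
  [IsManifold (𝓡 n) ∞ M]

instance (x : M) : FiniteDimensional ℝ (TangentSpace (𝓡 n) x) :=
  inferInstanceAs (FiniteDimensional ℝ (EuclideanSpace ℝ (Fin n)))

theorem IsSmooth.mdifferentiableAt {X : VField n M} (hX : IsSmooth X) (x : M) :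
    MDifferentiableAt (𝓡 n) (𝓡 n).tangent (fun x => (⟨x, X x⟩ : TangentBundle (𝓡 n) M)) x :=
  (hX x).mdifferentiableAt (by simp)

theorem IsSmooth.zero : IsSmooth (fun _ => 0 : VField n M) :=
  Bundle.contMDiff_zeroSection ℝ (TangentSpace (𝓡 n) : M → Type _)

theorem IsSmooth.add {X Y : VField n M} (hX : IsSmooth X) (hY : IsSmooth Y) :
    IsSmooth (fun x => X x + Y x) :=
  ContMDiff.add_section (V := (TangentSpace (𝓡 n) : M → Type _)) hX hY

theorem IsSmooth.smul {f : M → ℝ} {X : VField n M} (hf : ContMDiff (𝓡 n) 𝓘(ℝ, ℝ) ∞ f)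
    (hX : IsSmooth X) : IsSmooth (fun x => f x • X x) :=
  ContMDiff.smul_section (V := (TangentSpace (𝓡 n) : M → Type _)) hf hX

theorem IsSmooth.const_smul (c : ℝ) {X : VField n M} (hX : IsSmooth X) :
    IsSmooth (fun x => c • X x) :=
  hX.smul contMDiff_const

theorem IsSmooth.sum {ι : Type*} (s : Finset ι) {X : ι → VField n M}
    (hX : ∀ i ∈ s, IsSmooth (X i)) : IsSmooth (fun x => ∑ i ∈ s, X i x) :=
  ContMDiff.sum_section (V := (TangentSpace (𝓡 n) : M → Type _)) hX

theorem two_le_infty : (2 : WithTop ℕ∞) ≤ ∞ := ENat.LEInfty.out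

theorem three_le_infty : (3 : WithTop ℕ∞) ≤ ∞ := ENat.LEInfty.out

theorem IsSmooth.mlieBracket {X Y : VField n M} (hX : IsSmooth X) (hY : IsSmooth Y) :
    IsSmooth (VectorField.mlieBracket (𝓡 n) X Y) := by
  have : IsManifold (𝓡 n) (minSmoothness ℝ 2) M := by
    simp only [minSmoothness_of_isRCLikeNormedField]
    exact IsManifold.of_le (n := ∞) two_le_infty
  have : IsManifold (𝓡 n) ((⊤ : ℕ∞) + 1) M := by
    simpa using! (inferInstance : IsManifold (𝓡 n) ∞ M)
  exact ContDiff.mlieBracket_vectorField (m := ⊤) (n := ⊤) hX hY (by simp)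

/-- The terms that differentiate the coefficients point in the directions of the `W i`. This lets
statements about brackets modulo a flag space be checked on generators. -/
theorem mlieBracket_sum_smul_left {ι : Type*} (s : Finset ι) {f : ι → M → ℝ} {W : ι → VField n M}
    {Y : VField n M} (hf : ∀ i, ContMDiff (𝓡 n) 𝓘(ℝ, ℝ) ∞ (f i)) (hW : ∀ i, IsSmooth (W i))
    (x : M) :
    VectorField.mlieBracket (𝓡 n) (fun x => ∑ i ∈ s, f i x • W i x) Y x =
      ∑ i ∈ s, (-(mvfderiv (𝓡 n) (f i) x (Y x)) • W i x +
        f i x • VectorField.mlieBracket (𝓡 n) (W i) Y x) := by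
  classical
  induction s using Finset.induction_on with
  | empty =>
    have : (fun x => ∑ i ∈ (∅ : Finset ι), f i x • W i x : VField n M) = 0 := by
      ext; simp
    rw [this]
    simp
  | insert a s ha ih =>
    have h1 : (fun x => ∑ i ∈ insert a s, f i x • W i x : VField n M) =
        (f a • W a) + fun x => ∑ i ∈ s, f i x • W i x := by
      ext x
      simp [Finset.sum_insert ha]
    rw [h1, VectorField.mlieBracket_add_left (V := f a • W a)
      (((hW a).smul (hf a)).mdifferentiableAt x)
      ((IsSmooth.sum s fun i _ => (hW i).smul (hf i)).mdifferentiableAt x), ih,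
      VectorField.mlieBracket_smul_left ((hf a x).mdifferentiableAt (by simp))
        ((hW a).mdifferentiableAt x), Finset.sum_insert ha]

theorem mlieBracket_jacobi {X Y Z : VField n M} (hX : IsSmooth X) (hY : IsSmooth Y)
    (hZ : IsSmooth Z) : VectorField.mlieBracket (𝓡 n) X (VectorField.mlieBracket (𝓡 n) Y Z) =
      VectorField.mlieBracket (𝓡 n) (VectorField.mlieBracket (𝓡 n) X Y) Z +
        VectorField.mlieBracket (𝓡 n) Y (VectorField.mlieBracket (𝓡 n) X Z) := by
  have : IsManifold (𝓡 n) (minSmoothness ℝ 3) M := by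
    simp only [minSmoothness_of_isRCLikeNormedField]
    exact IsManifold.of_le (n := ∞) three_le_infty
  refine VectorField.leibniz_identity_mlieBracket (hX.of_le ?_) (hY.of_le ?_) (hZ.of_le ?_) <;>
    simp only [minSmoothness_of_isRCLikeNormedField] <;> exact two_le_infty

/-- A function that is smooth near a point agrees near it with a globally smooth function. -/
theorem exists_contMDiff_eventuallyEq [T2Space M] {E : Type*} [NormedAddCommGroup E]
    [NormedSpace ℝ E] {f : M → E} {x₀ : M}
    (hf : ∀ᶠ x in 𝓝 x₀, ContMDiffAt (𝓡 n) 𝓘(ℝ, E) ∞ f x) :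
    ∃ g : M → E, ContMDiff (𝓡 n) 𝓘(ℝ, E) ∞ g ∧ g =ᶠ[𝓝 x₀] f := by
  obtain ⟨ρ, -, hρ⟩ :=
    (SmoothBumpFunction.nhds_basis_tsupport (I := 𝓡 n) x₀).mem_iff.1 hf
  refine ⟨fun x => ρ x • f x, contMDiff_of_tsupport fun x hx => ?_, ?_⟩
  · have hx' : x ∈ tsupport ρ := closure_mono (Function.support_smul_subset_left _ _) hx
    exact (ρ.contMDiff x).smul (hρ hx')
  · filter_upwards [ρ.eventuallyEq_one] with x hx
    simp [hx]

/-- The representation of a vector field in the trivialization at `x₀`. -/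
def localRep (x₀ : M) (X : VField n M) (x : M) : EuclideanSpace ℝ (Fin n) :=
  (trivializationAt (EuclideanSpace ℝ (Fin n)) (TangentSpace (𝓡 n) : M → Type _) x₀
    ⟨x, X x⟩).2

/-- The linear equivalence of the trivialization at `x₀`. -/
def localEquiv (x₀ : M) {x : M} (hx : x ∈ (trivializationAt (EuclideanSpace ℝ (Fin n))
      (TangentSpace (𝓡 n) : M → Type _) x₀).baseSet) :
    TangentSpace (𝓡 n) x ≃ₗ[ℝ] EuclideanSpace ℝ (Fin n) :=
  (trivializationAt (EuclideanSpace ℝ (Fin n)) (TangentSpace (𝓡 n) : M → Type _) x₀).linearEquivAt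
    ℝ x hx

theorem localEquiv_apply (x₀ : M) {x : M} (hx : x ∈ (trivializationAt (EuclideanSpace ℝ (Fin n))
      (TangentSpace (𝓡 n) : M → Type _) x₀).baseSet) (X : VField n M) :
    localEquiv x₀ hx (X x) = localRep x₀ X x := rfl

theorem eventually_mem_baseSet (x₀ : M) :
    ∀ᶠ x in 𝓝 x₀, x ∈ (trivializationAt (EuclideanSpace ℝ (Fin n))
      (TangentSpace (𝓡 n) : M → Type _) x₀).baseSet :=
  (trivializationAt (EuclideanSpace ℝ (Fin n))
    (TangentSpace (𝓡 n) : M → Type _) x₀).open_baseSet.mem_nhds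
    (FiberBundle.mem_baseSet_trivializationAt' x₀)

theorem contMDiffAt_localRep_iff (x₀ : M) {x : M}
    (hx : x ∈ (trivializationAt (EuclideanSpace ℝ (Fin n))
      (TangentSpace (𝓡 n) : M → Type _) x₀).baseSet) (X : VField n M) :
    ContMDiffAt (𝓡 n) 𝓘(ℝ, EuclideanSpace ℝ (Fin n)) ∞ (localRep x₀ X) x ↔
    ContMDiffAt (𝓡 n) (𝓡 n).tangent ∞ (fun x => (⟨x, X x⟩ : TangentBundle (𝓡 n) M)) x :=
  (Bundle.Trivialization.contMDiffAt_section_iff (IB := 𝓡 n) (n := ∞) _ hx).symm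

theorem eventually_linearIndependent {ι : Type*} [Finite ι] {Z : ι → VField n M}
    (hZ : ∀ i, IsSmooth (Z i))
    {x₀ : M} (hli : LinearIndependent ℝ fun i => Z i x₀) :
    ∀ᶠ x in 𝓝 x₀, LinearIndependent ℝ fun i => Z i x := by
  have hb := eventually_mem_baseSet (n := n) x₀
  have hc : ContinuousAt (fun x => fun i => localRep x₀ (Z i) x) x₀ :=
    continuousAt_pi.2 fun i =>
      ((contMDiffAt_localRep_iff x₀ hb.self_of_nhds (Z i)).2 (hZ i x₀)).continuousAt
  have hli' : LinearIndependent ℝ fun i => localRep x₀ (Z i) x₀ :=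
    hli.map' (localEquiv x₀ hb.self_of_nhds).toLinearMap (LinearEquiv.ker _)
  have ho := hc.preimage_mem_nhds (isOpen_setOfPred_linearIndependent.mem_nhds hli')
  filter_upwards [hb, ho] with x hx hx'
  exact LinearIndependent.of_comp (localEquiv x₀ hx).toLinearMap hx'

/-- The linear map with prescribed values on the standard basis. -/
def combMap {ι E : Type*} [Fintype ι] [NormedAddCommGroup E] [NormedSpace ℝ E] (v : ι → E) :
    (ι → ℝ) →L[ℝ] E :=
  ∑ i, ContinuousLinearMap.smulRightL ℝ (ι → ℝ) E (ContinuousLinearMap.proj i) (v i)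

theorem combMap_apply {ι E : Type*} [Fintype ι] [NormedAddCommGroup E] [NormedSpace ℝ E]
    (v : ι → E) (c : ι → ℝ) : combMap v c = ∑ i, c i • v i := by
  simp [combMap]

omit [IsManifold (𝓡 n) ∞ M] in
theorem contMDiffAt_combMap {ι E : Type*} [Fintype ι] [NormedAddCommGroup E] [NormedSpace ℝ E]
    {v : M → ι → E} {x : M}
    (hv : ∀ i, ContMDiffAt (𝓡 n) 𝓘(ℝ, E) ∞ (fun x => v x i) x) :
    ContMDiffAt (𝓡 n) 𝓘(ℝ, (ι → ℝ) →L[ℝ] E) ∞ (fun x => combMap (v x)) x :=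
  ContMDiffAt.sum fun i _ => ((ContinuousLinearMap.smulRightL ℝ (ι → ℝ) E
    (ContinuousLinearMap.proj i)).contDiff.contMDiff.contMDiffAt).comp x (hv i)

/-- A smooth vector field with values in the span of linearly independent smooth vector fields has
smooth coefficients. -/
theorem exists_smooth_coeff [T2Space M] {ι : Type*} [Fintype ι] {Z : ι → VField n M}
    (hZ : ∀ i, IsSmooth (Z i)) {x₀ : M} (hli : LinearIndependent ℝ fun i => Z i x₀)
    {X : VField n M} (hX : IsSmooth X)
    (hspan : ∀ᶠ x in 𝓝 x₀, X x ∈ Submodule.span ℝ (range fun i => Z i x)) :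
    ∃ f : ι → M → ℝ, (∀ i, ContMDiff (𝓡 n) 𝓘(ℝ, ℝ) ∞ (f i)) ∧
      ∀ᶠ x in 𝓝 x₀, X x = ∑ i, f i x • Z i x := by
  have hb := eventually_mem_baseSet (n := n) x₀
  let L : M → (ι → ℝ) →L[ℝ] EuclideanSpace ℝ (Fin n) := fun x =>
    combMap fun i => localRep x₀ (Z i) x
  have hLapp : ∀ x c, L x c = ∑ i, c i • localRep x₀ (Z i) x := fun x c => combMap_apply _ _
  have hL : ∀ᶠ x in 𝓝 x₀,
      ContMDiffAt (𝓡 n) 𝓘(ℝ, (ι → ℝ) →L[ℝ] EuclideanSpace ℝ (Fin n)) ∞ L x := by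
    filter_upwards [hb] with x hx
    exact contMDiffAt_combMap fun i => (contMDiffAt_localRep_iff x₀ hx (Z i)).2 (hZ i x)
  have hinj : ∀ᶠ x in 𝓝 x₀, LinearMap.ker (L x : (ι → ℝ) →ₗ[ℝ] EuclideanSpace ℝ (Fin n)) = ⊥ := by
    filter_upwards [hb, eventually_linearIndependent hZ hli] with x hx hx'
    rw [LinearMap.ker_eq_bot']
    intro c hc
    rw [ContinuousLinearMap.coe_coe, hLapp] at hc
    have h1 : LinearIndependent ℝ fun i => localRep x₀ (Z i) x :=
      hx'.map' (localEquiv x₀ hx).toLinearMap (LinearEquiv.ker _)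
    exact funext (Fintype.linearIndependent_iff.1 h1 c hc)
  obtain ⟨S, hS⟩ := exists_smooth_generalized_inverse hL (by
    filter_upwards [hinj] with x hx
    rw [LinearMap.finrank_range_of_inj (LinearMap.ker_eq_bot.1 hx),
      LinearMap.finrank_range_of_inj (LinearMap.ker_eq_bot.1 hinj.self_of_nhds)])
  have hc : ∀ᶠ x in 𝓝 x₀, ContMDiffAt (𝓡 n) 𝓘(ℝ, ι → ℝ) ∞
      (fun x => S x (localRep x₀ X x)) x := by
    filter_upwards [hb, hS] with x hx hx'
    exact hx'.1.clm_apply ((contMDiffAt_localRep_iff x₀ hx X).2 (hX x))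
  obtain ⟨g, hg, hgeq⟩ := exists_contMDiff_eventuallyEq hc
  refine ⟨fun i x => g x i, fun i => contMDiff_pi_space.1 hg i, ?_⟩
  filter_upwards [hb, hS, hgeq, hspan] with x hx hx' hxg hxs
  apply (localEquiv x₀ hx).injective
  obtain ⟨c, hc⟩ := Submodule.mem_span_range_iff_exists_fun ℝ |>.1 hxs
  have h1 : localRep x₀ X x = L x c := by
    rw [← localEquiv_apply x₀ hx, ← hc, map_sum, hLapp]
    simp [localEquiv_apply]
  rw [localEquiv_apply, hxg, map_sum]
  simp only [map_smul, localEquiv_apply]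
  rw [← hLapp, h1, hx'.2]

theorem IsSubbundle.eventually_finrank_eq {D : Distribution n M} (hD : IsSubbundle D) (x₀ : M) :
    ∀ᶠ x in 𝓝 x₀, Module.finrank ℝ (D x) = Module.finrank ℝ (D x₀) := by
  obtain ⟨U, hU, hx₀, r, X, -, h⟩ := hD x₀
  have hr : ∀ x ∈ U, Module.finrank ℝ (D x) = r := fun x hx => by
    rw [← (h x hx).2, finrank_span_eq_card (h x hx).1, Fintype.card_fin]
  filter_upwards [hU.mem_nhds hx₀] with x hx
  rw [hr x hx, hr x₀ hx₀]

/-- Linearly independent sections of a subbundle that span it at a point span it nearby. -/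
theorem IsSubbundle.eventually_span_eq {D : Distribution n M} (hD : IsSubbundle D) {ι : Type*}
    [Fintype ι] {Z : ι → VField n M} (hZ : ∀ i, IsSection D (Z i)) {x₀ : M}
    (hli : LinearIndependent ℝ fun i => Z i x₀)
    (hspan : Submodule.span ℝ (range fun i => Z i x₀) = D x₀) :
    ∀ᶠ x in 𝓝 x₀, Submodule.span ℝ (range fun i => Z i x) = D x := by
  filter_upwards [hD.eventually_finrank_eq x₀,
    eventually_linearIndependent (fun i => (hZ i).smooth) hli] with x hx hx'
  refine Submodule.eq_of_le_of_finrank_eq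
    (Submodule.span_le.2 (range_subset_iff.2 fun i => (hZ i).mem x)) ?_
  rw [hx, ← hspan, finrank_span_eq_card hli, finrank_span_eq_card hx']

end SmoothFields

/-! ### The filtration generated by a distribution and its brackets -/

section Flag

variable {n : ℕ} {M : Type*} [TopologicalSpace M] [ChartedSpace (EuclideanSpace ℝ (Fin n)) M]
  [IsManifold (𝓡 n) ∞ M] {D : Distribution n M}

theorem IsIteratedBracket.isSmooth {j : ℕ} {Z : VField n M} (h : IsIteratedBracket D j Z) :
    IsSmooth Z := by
  induction h with
  | one hX => exact hX.smooth
  | succ hX _ ih => exact hX.smooth.mlieBracket ih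

theorem flag_mono (D : Distribution n M) {i j : ℕ} (h : i ≤ j) (x : M) : flag D i x ≤ flag D j x :=
  Submodule.span_mono fun _ ⟨k, hk, Z, hZ, e⟩ => ⟨k, hk.trans h, Z, hZ, e⟩

theorem IsIteratedBracket.isSection_flag {j k : ℕ} {Z : VField n M} (h : IsIteratedBracket D j Z)
    (hjk : j ≤ k) : IsSection (flag D k) Z :=
  ⟨h.isSmooth, fun _ => Submodule.subset_span ⟨j, hjk, Z, h, rfl⟩⟩

theorem IsSection.mono {i j : ℕ} {X : VField n M} (hX : IsSection (flag D i) X) (h : i ≤ j) :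
    IsSection (flag D j) X :=
  ⟨hX.smooth, fun x => flag_mono D h x (hX.mem x)⟩

theorem IsSection.add {X Y : VField n M} (hX : IsSection D X) (hY : IsSection D Y) :
    IsSection D (fun x => X x + Y x) :=
  ⟨hX.smooth.add hY.smooth, fun x => Submodule.add_mem _ (hX.mem x) (hY.mem x)⟩

theorem IsSection.smul {f : M → ℝ} {X : VField n M} (hX : IsSection D X)
    (hf : ContMDiff (𝓡 n) 𝓘(ℝ, ℝ) ∞ f) : IsSection D (fun x => f x • X x) :=
  ⟨hX.smooth.smul hf, fun x => Submodule.smul_mem _ _ (hX.mem x)⟩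

theorem IsSection.sum {ι : Type*} (s : Finset ι) {X : ι → VField n M}
    (hX : ∀ i ∈ s, IsSection D (X i)) : IsSection D (fun x => ∑ i ∈ s, X i x) :=
  ⟨IsSmooth.sum s fun i hi => (hX i hi).smooth, fun x => Submodule.sum_mem _ fun i hi =>
    (hX i hi).mem x⟩

variable [T2Space M]

/-- Sections of `D^{-k}` are locally combinations of iterated brackets with smooth coefficients. -/
theorem IsSection.exists_eq_sum (hreg : IsEquiregular D) {k : ℕ} {X : VField n M}
    (hX : IsSection (flag D k) X) (x₀ : M) :
    ∃ (r : ℕ) (W : Fin r → VField n M) (f : Fin r → M → ℝ),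
      (∀ i, ∃ j ≤ k, IsIteratedBracket D j (W i)) ∧
      (∀ i, ContMDiff (𝓡 n) 𝓘(ℝ, ℝ) ∞ (f i)) ∧ LinearIndependent ℝ (fun i => W i x₀) ∧
      ∀ᶠ x in 𝓝 x₀, X x = ∑ i, f i x • W i x := by
  -- Among the iterated brackets spanning the flag space at `x₀` choose a basis. By equiregularity
  -- the dimension is locally constant, so the same brackets are a frame nearby.
  obtain ⟨b, hb, hspan, hli⟩ := exists_linearIndependent ℝ
    {v | ∃ j ≤ k, ∃ Z : VField n M, IsIteratedBracket D j Z ∧ Z x₀ = v}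
  have hfin : Finite b := hli.finite
  obtain ⟨r, ⟨e⟩⟩ := Finite.exists_equiv_fin b
  choose j hj W hW hWx using fun i : Fin r => hb (e.symm i).2
  have hWx' : (fun i => W i x₀) = Subtype.val ∘ e.symm := funext hWx
  have hli' : LinearIndependent ℝ (fun i => W i x₀) := by
    rw [hWx']
    exact hli.comp _ e.symm.injective
  have hspan' : Submodule.span ℝ (range fun i => W i x₀) = flag D k x₀ := by
    rw [hWx', e.symm.surjective.range_comp, Subtype.range_coe, hspan]
    rfl
  have hs := (hreg k).eventually_span_eq (fun i => (hW i).isSection_flag (hj i)) hli' hspan'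
  obtain ⟨f, hf, hXf⟩ := exists_smooth_coeff (fun i => (hW i).isSmooth) hli' hX.smooth
    (by filter_upwards [hs] with x hx using hx ▸ hX.mem x)
  exact ⟨r, W, f, fun i => ⟨j i, hj i, hW i⟩, hf, hli', hXf⟩

/-- Expand `X` locally in iterated brackets: the derivative terms stay in the level `i ≤ m`, and the
remaining terms are the brackets controlled by `hW`. -/
theorem mlieBracket_mem_of_bracket_mem (hreg : IsEquiregular D) {i m : ℕ} {X Y : VField n M}
    (hX : IsSection (flag D i) X) (x : M) (him : i ≤ m)
    (hW : ∀ j ≤ i, ∀ W, IsIteratedBracket D j W →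
      VectorField.mlieBracket (𝓡 n) W Y x ∈ flag D m x) :
    VectorField.mlieBracket (𝓡 n) X Y x ∈ flag D m x := by
  obtain ⟨r, W, f, hit, hf, -, heq⟩ := hX.exists_eq_sum hreg x
  choose j hj hit using hit
  rw [Filter.EventuallyEq.mlieBracket_vectorField_eq (W₁ := Y) (W := Y) heq EventuallyEq.rfl,
    mlieBracket_sum_smul_left _ hf fun a => (hit a).isSmooth]
  refine Submodule.sum_mem _ fun a _ => Submodule.add_mem _ (Submodule.smul_mem _ _ ?_)
    (Submodule.smul_mem _ _ (hW _ (hj a) _ (hit a)))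
  exact ((hit a).isSection_flag ((hj a).trans him)).mem x

/-- Induction on the length of `W` with the Jacobi identity [[X, Z], Y] = [X, [Z, Y]] - [Z, [X, Y]].
The length-one case expands `Y` in iterated brackets, each of which is lengthened by one. -/
theorem mlieBracket_iterated_mem (hreg : IsEquiregular D) {i : ℕ} {W : VField n M}
    (hW : IsIteratedBracket D i W) : ∀ {j : ℕ} {Y : VField n M}, IsSection (flag D j) Y → ∀ x,
      VectorField.mlieBracket (𝓡 n) W Y x ∈ flag D (i + j) x := by
  have hone : ∀ {X : VField n M}, IsSection D X → ∀ {j : ℕ} {Y : VField n M},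
      IsSection (flag D j) Y → ∀ x,
      VectorField.mlieBracket (𝓡 n) X Y x ∈ flag D (j + 1) x := by
    intro X hX j Y hY x
    rw [VectorField.mlieBracket_swap_apply]
    refine Submodule.neg_mem _ (mlieBracket_mem_of_bracket_mem hreg hY x (by omega) ?_)
    intro k hk W hW
    rw [VectorField.mlieBracket_swap_apply]
    exact Submodule.neg_mem _
      ((IsIteratedBracket.succ hX hW).isSection_flag (by omega : k + 1 ≤ j + 1) |>.mem x)
  induction hW with
  | one hX =>
    intro j Y hY x
    rw [add_comm]
    exact hone hX hY x
  | @succ i X Z hX hZ ih =>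
    intro j Y hY x
    have hZY : IsSection (flag D (i + j)) (VectorField.mlieBracket (𝓡 n) Z Y) :=
      ⟨hZ.isSmooth.mlieBracket hY.smooth, ih hY⟩
    have hXY : IsSection (flag D (j + 1)) (VectorField.mlieBracket (𝓡 n) X Y) :=
      ⟨hX.smooth.mlieBracket hY.smooth, hone hX hY⟩
    have h1 := hone hX hZY x
    have h2 := ih hXY x
    have e := congrFun (mlieBracket_jacobi hX.smooth hZ.isSmooth hY.smooth) x
    rw [Pi.add_apply, ← sub_eq_iff_eq_add] at e
    rw [← e]
    rw [show i + 1 + j = i + j + 1 by omega]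
    exact Submodule.sub_mem _ h1 (by rwa [show i + j + 1 = i + (j + 1) by omega])

/-- `[Γ(D^{-i}), Γ(D^{-j})] ⊆ Γ(D^{-i-j})`. -/
theorem IsSection.mlieBracket (hreg : IsEquiregular D) {i j : ℕ} {X Y : VField n M}
    (hX : IsSection (flag D i) X) (hY : IsSection (flag D j) Y) :
    IsSection (flag D (i + j)) (VectorField.mlieBracket (𝓡 n) X Y) :=
  ⟨hX.smooth.mlieBracket hY.smooth, fun x => mlieBracket_mem_of_bracket_mem hreg hX x (by omega)
    fun _ hk _ hW => flag_mono D (by omega) x (mlieBracket_iterated_mem hreg hW hY x)⟩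

/-- The bracket with a section that vanishes at `x` involves no new directions at `x`. -/
theorem mlieBracket_mem_of_eq_zero (hreg : IsEquiregular D) {i : ℕ} {X Y : VField n M}
    (hX : IsSection (flag D i) X) {x : M} (h0 : X x = 0) :
    VectorField.mlieBracket (𝓡 n) X Y x ∈ flag D i x := by
  obtain ⟨r, W, f, hit, hf, hli, heq⟩ := hX.exists_eq_sum hreg x
  choose j hj hit using hit
  -- Since the generators are independent at `x`, vanishing of `X` there kills all coefficients.
  -- Only their derivatives, multiplying the generators, survive in the bracket.
  have hfx : ∀ a, f a x = 0 := Fintype.linearIndependent_iff.1 hli _ (heq.self_of_nhds ▸ h0)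
  rw [Filter.EventuallyEq.mlieBracket_vectorField_eq (W₁ := Y) (W := Y) heq EventuallyEq.rfl,
    mlieBracket_sum_smul_left _ hf fun a => (hit a).isSmooth]
  refine Submodule.sum_mem _ fun a _ => ?_
  rw [hfx, zero_smul, add_zero]
  exact Submodule.smul_mem _ _ (((hit a).isSection_flag (hj a)).mem x)

end Flag

end SubRiemannian
end

/-! ### The Levi bracket on gr: well-definedness, Lie identities, generation -/

noncomputable section

namespace SubRiemannian

open Set Filter

section Linear

variable {n : ℕ} {M : Type*} [TopologicalSpace M] [ChartedSpace (EuclideanSpace ℝ (Fin n)) M]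
  [IsManifold (𝓡 n) ∞ M]

theorem mlieBracket_add_smul_left {X X' Y : VField n M} (hX : IsSmooth X) (hX' : IsSmooth X')
    (c : ℝ) (x : M) : VectorField.mlieBracket (𝓡 n) (fun x => X x + c • X' x) Y x =
      VectorField.mlieBracket (𝓡 n) X Y x + c • VectorField.mlieBracket (𝓡 n) X' Y x := by
  have := VectorField.mlieBracket_add_left (I := 𝓡 n) (V := X) (V₁ := c • X') (W := Y)
    (hX.mdifferentiableAt x) ((hX'.const_smul c).mdifferentiableAt x)
  rw [VectorField.mlieBracket_const_smul_left (hX'.mdifferentiableAt x)] at this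
  exact this

theorem mlieBracket_add_smul_right {X X' Y : VField n M} (hX : IsSmooth X) (hX' : IsSmooth X')
    (c : ℝ) (x : M) : VectorField.mlieBracket (𝓡 n) Y (fun x => X x + c • X' x) x =
      VectorField.mlieBracket (𝓡 n) Y X x + c • VectorField.mlieBracket (𝓡 n) Y X' x := by
  rw [VectorField.mlieBracket_swap_apply, mlieBracket_add_smul_left hX hX',
    VectorField.mlieBracket_swap_apply (V := Y), VectorField.mlieBracket_swap_apply (V := Y)]
  module

theorem IsSection.add_smul {D : Distribution n M} {X Y : VField n M} (hX : IsSection D X)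
    (hY : IsSection D Y) (c : ℝ) : IsSection D (fun x => X x + c • Y x) :=
  hX.add (hY.smul contMDiff_const)

end Linear

namespace Structure

variable {n : ℕ} {M : Type*} [TopologicalSpace M] [ChartedSpace (EuclideanSpace ℝ (Fin n)) M]
  [IsManifold (𝓡 n) ∞ M] (S : Structure n M)

theorem grMk_eq_iff {x : M} {k : ℕ} {v w : TangentSpace (𝓡 n) x} (hv : v ∈ flag S.E k x)
    (hw : w ∈ flag S.E k x) : S.grMk x k v hv = S.grMk x k w hw ↔ v - w ∈ flag S.E (k - 1) x := by
  rw [grMk, grMk, Submodule.Quotient.eq]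
  rfl

theorem grMk_eq_zero_iff {x : M} {k : ℕ} {v : TangentSpace (𝓡 n) x} (hv : v ∈ flag S.E k x) :
    S.grMk x k v hv = 0 ↔ v ∈ flag S.E (k - 1) x := by
  rw [grMk, Submodule.Quotient.mk_eq_zero]
  rfl

theorem grMk_add_smul {x : M} {k : ℕ} {v w : TangentSpace (𝓡 n) x} (hv : v ∈ flag S.E k x)
    (hw : w ∈ flag S.E k x) (c : ℝ) : S.grMk x k (v + c • w)
      (Submodule.add_mem _ hv (Submodule.smul_mem _ _ hw)) =
        S.grMk x k v hv + c • S.grMk x k w hw := rfl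

theorem of_grMk_congr {x : M} {i j : ℕ} (h : i = j) {v w : TangentSpace (𝓡 n) x} (hvw : v = w)
    (hv : v ∈ flag S.E i x) (hw : w ∈ flag S.E j x) :
    DirectSum.of (S.GrPiece x) i (S.grMk x i v hv) =
      DirectSum.of (S.GrPiece x) j (S.grMk x j w hw) := by
  subst h hvw
  rfl

variable [T2Space M] {S} (hreg : IsEquiregular S.E)

include hreg

theorem exists_isSection_grMk_eq {x : M} {k : ℕ} (a : S.GrPiece x k) :
    ∃ (X : VField n M) (hX : IsSection (flag S.E k) X), S.grMk x k (X x) (hX.mem x) = a := by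
  obtain ⟨⟨v, hv⟩, rfl⟩ := Submodule.Quotient.mk_surjective _ a
  obtain ⟨X, hX, rfl⟩ := (hreg k).exists_isSection hv
  exact ⟨X, hX, rfl⟩

/-- Subtract from `X` a section of the previous level with the same value at `x`. The difference
vanishes at `x`, so its bracket stays in level i ≤ i + j - 1. The degree-zero cases are split off
because the subtraction is truncated; there one of the fields is zero. -/
theorem mlieBracket_mem_pred {i j : ℕ} {X Y : VField n M} (hX : IsSection (flag S.E i) X)
    (hY : IsSection (flag S.E j) Y) {x : M} (hx : X x ∈ flag S.E (i - 1) x) :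
    VectorField.mlieBracket (𝓡 n) X Y x ∈ flag S.E (i + j - 1) x := by
  rcases Nat.eq_zero_or_pos i with rfl | hi
  · have : X = 0 := funext fun y => by simpa [flag_zero] using hX.mem y
    simp [this]
  rcases Nat.eq_zero_or_pos j with rfl | hj
  · have : Y = 0 := funext fun y => by simpa [flag_zero] using hY.mem y
    simp [this]
  obtain ⟨X', hX', he⟩ := (hreg (i - 1)).exists_isSection hx
  have h1 : VectorField.mlieBracket (𝓡 n) (fun y => X y + (-1 : ℝ) • X' y) Y x ∈
      flag S.E i x :=
    mlieBracket_mem_of_eq_zero hreg (hX.add_smul (hX'.mono (by omega)) (-1)) (by simp [he])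
  rw [mlieBracket_add_smul_left hX.smooth hX'.smooth] at h1
  have h2 := Submodule.smul_mem _ (-1 : ℝ) ((hX'.mlieBracket hreg hY).mem x)
  have h3 := Submodule.sub_mem _ (flag_mono S.E (by omega : i ≤ i + j - 1) x h1)
    (flag_mono S.E (by omega : i - 1 + j ≤ i + j - 1) x h2)
  rwa [add_sub_cancel_right] at h3

theorem mlieBracket_sub_mem_pred {i j : ℕ} {X X' Y Y' : VField n M}
    (hX : IsSection (flag S.E i) X) (hX' : IsSection (flag S.E i) X')
    (hY : IsSection (flag S.E j) Y) (hY' : IsSection (flag S.E j) Y') {x : M}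
    (hx : X x - X' x ∈ flag S.E (i - 1) x) (hy : Y x - Y' x ∈ flag S.E (j - 1) x) :
    VectorField.mlieBracket (𝓡 n) X Y x - VectorField.mlieBracket (𝓡 n) X' Y' x ∈
      flag S.E (i + j - 1) x := by
  have h1 := mlieBracket_mem_pred hreg (hX.add_smul hX' (-1)) hY (x := x)
    (by simpa [sub_eq_add_neg] using hx)
  have h2 := mlieBracket_mem_pred hreg (hY.add_smul hY' (-1)) hX' (x := x)
    (by simpa [sub_eq_add_neg] using hy)
  rw [mlieBracket_add_smul_left hX.smooth hX'.smooth] at h1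
  rw [VectorField.mlieBracket_swap_apply,
    mlieBracket_add_smul_right hY.smooth hY'.smooth, add_comm j i] at h2
  have h3 := Submodule.sub_mem _ h1 h2
  convert h3 using 1
  module

/-- Independence of extensions, from `mlieBracket_sub_mem_pred`: the arbitrary choice in
`leviBracket` can be replaced by any given pair of sections. All later identities for the bracket
reduce through this to identities for vector fields. -/
theorem leviBracket_mk {i j : ℕ} {X Y : VField n M} (hX : IsSection (flag S.E i) X)
    (hY : IsSection (flag S.E j) Y) (x : M) :
    S.leviBracket x (S.grMk x i (X x) (hX.mem x)) (S.grMk x j (Y x) (hY.mem x)) =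
      S.grMk x (i + j) (VectorField.mlieBracket (𝓡 n) X Y x) ((hX.mlieBracket hreg hY).mem x) := by
  have hex : ∃ c, S.IsLeviBracket x (S.grMk x i (X x) (hX.mem x))
      (S.grMk x j (Y x) (hY.mem x)) c :=
    ⟨_, X, Y, hX, hY, (hX.mlieBracket hreg hY).mem x, rfl, rfl, rfl⟩
  rw [leviBracket, dif_pos hex]
  obtain ⟨X', Y', hX', hY', hXY', h1, h2, h3⟩ := hex.choose_spec
  rw [← h3, grMk_eq_iff]
  exact mlieBracket_sub_mem_pred hreg hX' hX hY' hY ((S.grMk_eq_iff _ _).1 h1)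
    ((S.grMk_eq_iff _ _).1 h2)

theorem leviBracket_add_smul_left {x : M} {i j : ℕ} (a a' : S.GrPiece x i) (b : S.GrPiece x j)
    (c : ℝ) : S.leviBracket x (a + c • a') b = S.leviBracket x a b + c • S.leviBracket x a' b := by
  obtain ⟨X, hX, rfl⟩ := exists_isSection_grMk_eq hreg a
  obtain ⟨X', hX', rfl⟩ := exists_isSection_grMk_eq hreg a'
  obtain ⟨Y, hY, rfl⟩ := exists_isSection_grMk_eq hreg b
  rw [← grMk_add_smul, leviBracket_mk hreg hX hY, leviBracket_mk hreg hX' hY, ← grMk_add_smul,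
    leviBracket_mk hreg (hX.add_smul hX' c) hY]
  congr 1
  exact mlieBracket_add_smul_left hX.smooth hX'.smooth c x

theorem leviBracket_add_smul_right {x : M} {i j : ℕ} (a : S.GrPiece x i) (b b' : S.GrPiece x j)
    (c : ℝ) : S.leviBracket x a (b + c • b') = S.leviBracket x a b + c • S.leviBracket x a b' := by
  obtain ⟨X, hX, rfl⟩ := exists_isSection_grMk_eq hreg a
  obtain ⟨Y, hY, rfl⟩ := exists_isSection_grMk_eq hreg b
  obtain ⟨Y', hY', rfl⟩ := exists_isSection_grMk_eq hreg b'
  rw [← grMk_add_smul, leviBracket_mk hreg hX hY, leviBracket_mk hreg hX hY', ← grMk_add_smul,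
    leviBracket_mk hreg hX (hY.add_smul hY' c)]
  congr 1
  exact mlieBracket_add_smul_right hY.smooth hY'.smooth c x

theorem leviBracket_zero_left {x : M} {i j : ℕ} (b : S.GrPiece x j) :
    S.leviBracket x (0 : S.GrPiece x i) b = 0 := by
  have := leviBracket_add_smul_left hreg (0 : S.GrPiece x i) 0 b (1 : ℝ)
  rw [smul_zero, add_zero, one_smul] at this
  exact left_eq_add.1 this

theorem leviBracket_zero_right {x : M} {i j : ℕ} (a : S.GrPiece x i) :
    S.leviBracket x a (0 : S.GrPiece x j) = 0 := by
  have := leviBracket_add_smul_right hreg a (0 : S.GrPiece x j) 0 (1 : ℝ)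
  rw [smul_zero, add_zero, one_smul] at this
  exact left_eq_add.1 this

/-- The Levi bracket as a bilinear map. -/
def leviₗ (x : M) (i j : ℕ) :
    S.GrPiece x i →ₗ[ℝ] S.GrPiece x j →ₗ[ℝ] S.GrPiece x (i + j) :=
  LinearMap.mk₂ ℝ (S.leviBracket x)
    (fun a a' b => by simpa using leviBracket_add_smul_left hreg a a' b 1)
    (fun c a b => by
      simpa [leviBracket_zero_left hreg] using leviBracket_add_smul_left hreg 0 a b c)
    (fun a b b' => by simpa using leviBracket_add_smul_right hreg a b b' 1)
    (fun c a b => by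
      simpa [leviBracket_zero_right hreg] using leviBracket_add_smul_right hreg a 0 b c)

/-- The bracket of `gr_x` as a bilinear map. -/
def grBracketₗ (x : M) :
    S.Gr x →ₗ[ℝ] S.Gr x →ₗ[ℝ] S.Gr x :=
  DirectSum.toModule ℝ ℕ _ fun i => LinearMap.flip <| DirectSum.toModule ℝ ℕ _ fun j =>
    ((leviₗ hreg x i j).compr₂ (DirectSum.lof ℝ ℕ (S.GrPiece x) (i + j))).flip

theorem grBracketₗ_of_of (x : M) {i j : ℕ} (a : S.GrPiece x i) (b : S.GrPiece x j) :
    grBracketₗ hreg x (DirectSum.of _ i a) (DirectSum.of _ j b) =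
      DirectSum.of (S.GrPiece x) (i + j) (S.leviBracket x a b) := by
  rw [← DirectSum.lof_eq_of ℝ, ← DirectSum.lof_eq_of ℝ, grBracketₗ, DirectSum.toModule_lof,
    LinearMap.flip_apply, DirectSum.toModule_lof]
  rfl

theorem grBracket_eq (x : M) (a b : S.Gr x) : S.grBracket x a b = grBracketₗ hreg x a b := by
  classical
  have : grBracketₗ hreg x a b =
      grBracketₗ hreg x (∑ i ∈ DFinsupp.support a, DirectSum.of (S.GrPiece x) i (a i))
        (∑ j ∈ DFinsupp.support b, DirectSum.of (S.GrPiece x) j (b j)) := by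
    rw [DirectSum.sum_support_of, DirectSum.sum_support_of]
  rw [this, grBracket]
  simp only [map_sum, LinearMap.sum_apply, grBracketₗ_of_of]
  rw [Finset.sum_comm]

theorem grBracket_mk_mk {i j : ℕ} {X Y : VField n M} (hX : IsSection (flag S.E i) X)
    (hY : IsSection (flag S.E j) Y) (x : M) :
    S.grBracket x (DirectSum.of _ i (S.grMk x i (X x) (hX.mem x)))
      (DirectSum.of _ j (S.grMk x j (Y x) (hY.mem x))) =
      DirectSum.of (S.GrPiece x) (i + j) (S.grMk x (i + j) (VectorField.mlieBracket (𝓡 n) X Y x)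
        ((hX.mlieBracket hreg hY).mem x)) := by
  rw [grBracket_eq hreg, grBracketₗ_of_of, leviBracket_mk hreg hX hY]

theorem grBracket_add_left (x : M) (a a' b : S.Gr x) :
    S.grBracket x (a + a') b = S.grBracket x a b + S.grBracket x a' b := by
  simp only [grBracket_eq hreg, map_add]
  rfl

theorem grBracket_add_right (x : M) (a b b' : S.Gr x) :
    S.grBracket x a (b + b') = S.grBracket x a b + S.grBracket x a b' := by
  simp only [grBracket_eq hreg, map_add]

theorem grBracket_smul_right (x : M) (c : ℝ) (a b : S.Gr x) :
    S.grBracket x a (c • b) = c • S.grBracket x a b := by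
  simp only [grBracket_eq hreg, map_smul]

theorem grBracket_zero_left (x : M) (b : S.Gr x) : S.grBracket x 0 b = 0 := by
  simp only [grBracket_eq hreg, map_zero]
  rfl

theorem grBracket_zero_right (x : M) (a : S.Gr x) : S.grBracket x a 0 = 0 := by
  simp only [grBracket_eq hreg, map_zero]

theorem gr_induction {x : M} {p : S.Gr x → Prop} (a : S.Gr x)
    (mk : ∀ (i : ℕ) (X : VField n M) (hX : IsSection (flag S.E i) X),
      p (DirectSum.of _ i (S.grMk x i (X x) (hX.mem x))))
    (zero : p 0) (add : ∀ a b, p a → p b → p (a + b)) : p a := by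
  induction a using DirectSum.induction_on with
  | zero => exact zero
  | of i a =>
    obtain ⟨X, hX, rfl⟩ := exists_isSection_grMk_eq hreg a
    exact mk i X hX
  | add a b ha hb => exact add a b ha hb

theorem grBracket_swap (x : M) (a b : S.Gr x) : S.grBracket x a b = -S.grBracket x b a := by
  induction a using gr_induction hreg with
  | zero => rw [grBracket_zero_left hreg, grBracket_zero_right hreg, neg_zero]
  | add a a' ha ha' =>
    rw [grBracket_add_left hreg, grBracket_add_right hreg, ha, ha']
    exact (neg_add _ _).symm
  | mk i X hX =>
    induction b using gr_induction hreg with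
    | zero => rw [grBracket_zero_left hreg, grBracket_zero_right hreg, neg_zero]
    | add b b' hb hb' =>
      rw [grBracket_add_left hreg, grBracket_add_right hreg, hb, hb']
      exact (neg_add _ _).symm
    | mk j Y hY =>
      rw [grBracket_mk_mk hreg hX hY, grBracket_mk_mk hreg hY hX, ← map_neg]
      exact S.of_grMk_congr (add_comm i j) VectorField.mlieBracket_swap_apply _
        (Submodule.neg_mem _ ((hY.mlieBracket hreg hX).mem x))

theorem grBracket_jacobi (x : M) (a b c : S.Gr x) :
    S.grBracket x a (S.grBracket x b c) =
      S.grBracket x (S.grBracket x a b) c + S.grBracket x b (S.grBracket x a c) := by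
  induction a using gr_induction hreg with
  | zero => simp only [grBracket_zero_left hreg, grBracket_zero_right hreg, add_zero]
  | add a a' ha ha' =>
    simp only [grBracket_add_left hreg, grBracket_add_right hreg, ha, ha']
    exact add_add_add_comm _ _ _ _
  | mk i X hX =>
    induction b using gr_induction hreg with
    | zero => simp only [grBracket_zero_left hreg, grBracket_zero_right hreg, add_zero]
    | add b b' hb hb' =>
      simp only [grBracket_add_left hreg, grBracket_add_right hreg, hb, hb']
      exact add_add_add_comm _ _ _ _
    | mk j Y hY =>
      induction c using gr_induction hreg with
      | zero => simp only [grBracket_zero_right hreg, add_zero]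
      | add c c' hc hc' =>
        simp only [grBracket_add_right hreg, hc, hc']
        exact add_add_add_comm _ _ _ _
      | mk k Z hZ =>
        have hXY := hX.mlieBracket hreg hY
        have hYZ := hY.mlieBracket hreg hZ
        have hXZ := hX.mlieBracket hreg hZ
        rw [grBracket_mk_mk hreg hX hY, grBracket_mk_mk hreg hY hZ, grBracket_mk_mk hreg hX hZ,
          grBracket_mk_mk hreg hX hYZ, grBracket_mk_mk hreg hXY hZ, grBracket_mk_mk hreg hY hXZ]
        have e := congrFun (mlieBracket_jacobi hX.smooth hY.smooth hZ.smooth) x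
        rw [Pi.add_apply] at e
        have h1 : VectorField.mlieBracket (𝓡 n) (VectorField.mlieBracket (𝓡 n) X Y) Z x ∈
            flag S.E (i + (j + k)) x := by
          rw [← add_assoc]
          exact (hXY.mlieBracket hreg hZ).mem x
        have h2 : VectorField.mlieBracket (𝓡 n) Y (VectorField.mlieBracket (𝓡 n) X Z) x ∈
            flag S.E (i + (j + k)) x := by
          rw [← add_left_comm]
          exact (hY.mlieBracket hreg hXZ).mem x
        rw [S.of_grMk_congr (add_assoc i j k) rfl _ h1,
          S.of_grMk_congr (add_left_comm j i k) rfl _ h2, ← map_add]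
        exact S.of_grMk_congr rfl e _ (Submodule.add_mem _ h1 h2)

/-- `gr_{-1}` generates: `⟦gr_{-1}, gr_{-k}⟧` spans `gr_{-k-1}`. -/
theorem of_succ_mem_span (x : M) {k : ℕ} (hk : 1 ≤ k) (a : S.GrPiece x (k + 1)) :
    DirectSum.of (S.GrPiece x) (k + 1) a ∈ Submodule.span ℝ
      {c | ∃ (u : S.GrPiece x 1) (v : S.GrPiece x k),
        S.grBracket x (DirectSum.of _ 1 u) (DirectSum.of _ k v) = c} := by
  obtain ⟨⟨v, hv⟩, rfl⟩ := Submodule.Quotient.mk_surjective _ a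
  change DirectSum.of (S.GrPiece x) (k + 1) (S.grMk x (k + 1) v hv) ∈ _
  have hv' := hv
  rw [flag] at hv'
  induction hv' using Submodule.span_induction with
  | zero =>
    have : S.grMk x (k + 1) 0 hv = 0 := rfl
    rw [this, map_zero]
    exact Submodule.zero_mem _
  | add u w hu hw ihu ihw =>
    have : S.grMk x (k + 1) (u + w) hv = S.grMk x (k + 1) u hu + S.grMk x (k + 1) w hw := rfl
    rw [this, map_add]
    exact Submodule.add_mem _ (ihu hu) (ihw hw)
  | smul c u hu ih =>
    have : S.grMk x (k + 1) (c • u) hv = c • S.grMk x (k + 1) u hu := rfl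
    rw [this, ← DirectSum.lof_eq_of ℝ, map_smul, DirectSum.lof_eq_of]
    exact Submodule.smul_mem _ _ (ih hu)
  | mem u hu =>
    obtain ⟨j, hj, Z, hZ, rfl⟩ := hu
    rcases Nat.lt_or_ge k j with hkj | hjk
    -- A bracket of full length is [X, Z] with `X` horizontal and `Z` of length `k`; shorter
    -- brackets have class zero in the quotient.
    · obtain rfl : j = k + 1 := by omega
      cases hZ with
      | one hX => omega
      | succ hX hZ =>
        have hX1 : IsSection (flag S.E 1) _ :=
          ⟨hX.smooth, fun y => (S.isSubbundle.flag_one y).symm ▸ hX.mem y⟩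
        have hZk := hZ.isSection_flag le_rfl
        refine Submodule.subset_span ⟨_, _, (grBracket_mk_mk hreg hX1 hZk x).trans ?_⟩
        exact S.of_grMk_congr (add_comm 1 k) rfl _ _
    · have : S.grMk x (k + 1) (Z x) hv = 0 :=
        (S.grMk_eq_zero_iff hv).2 ((hZ.isSection_flag (by omega : j ≤ k + 1 - 1)).mem x)
      rw [this, map_zero]
      exact Submodule.zero_mem _

end Structure

end SubRiemannian
end

/-! ### Bases and local frames adapted to the filtration -/

noncomputable section

namespace SubRiemannian

open Set Filter

/-- A finite-dimensional space with a filtration has a basis adapted to it. -/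
theorem exists_adapted_basis {V : Type*} [AddCommGroup V] [Module ℝ V] [FiniteDimensional ℝ V]
    {f : ℕ → Submodule ℝ V} (hf : Monotone f) (h0 : f 0 = ⊥) {s : ℕ} (hs : f s = ⊤) {n : ℕ}
    (hn : Module.finrank ℝ V = n) :
    ∃ (deg : Fin n → ℕ) (b : Fin n → V), LinearIndependent ℝ b ∧ (∀ a, deg a ≤ s) ∧
      ∀ k, Submodule.span ℝ (b '' {a | deg a ≤ k}) = f k := by
  classical
  have hstep : ∀ k (B : {B : Set V // LinearIndepOn ℝ id B ∧ Submodule.span ℝ B = f k}),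
      ∃ B' : {B : Set V // LinearIndepOn ℝ id B ∧ Submodule.span ℝ B = f (k + 1)},
        B.1 ⊆ B'.1 := by
    rintro k ⟨B, hB, hBs⟩
    have hsub : B ⊆ f (k + 1) := fun v hv =>
      hf (Nat.le_succ k) (hBs ▸ Submodule.subset_span hv)
    refine ⟨⟨hB.extend hsub, hB.linearIndepOn_extend hsub, le_antisymm ?_ ?_⟩,
      hB.subset_extend hsub⟩
    · exact Submodule.span_le.2 (hB.extend_subset hsub)
    · exact fun v hv => hB.subset_span_extend hsub hv
  choose next hnext using hstep
  -- Nested bases, each extending the one before. The degree of a basis vector is the first level at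
  -- which it appears.
  let B : ∀ k, {B : Set V // LinearIndepOn ℝ id B ∧ Submodule.span ℝ B = f k} := fun k =>
    Nat.rec ⟨∅, linearIndepOn_empty ℝ id, by simp [h0]⟩ next k
  have hmono : Monotone fun k => (B k).1 := monotone_nat_of_le_succ fun k => hnext k (B k)
  let bas : Module.Basis (B s).1 ℝ V := Module.Basis.mk (v := ((↑) : (B s).1 → V))
    (B s).2.1 (by rw [Subtype.range_coe, (B s).2.2, hs])
  have hfin : Finite (B s).1 := Module.Finite.finite_basis bas
  have : Fintype (B s).1 := Fintype.ofFinite _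
  have hcard : Fintype.card (B s).1 = n := by rw [← hn, Module.finrank_eq_card_basis bas]
  let e : Fin n ≃ (B s).1 := (Fintype.equivFinOfCardEq hcard).symm
  have hex : ∀ a, ∃ k, (e a : V) ∈ (B k).1 := fun a => ⟨s, (e a).2⟩
  have hdeg : ∀ a k, Nat.find (hex a) ≤ k ↔ (e a : V) ∈ (B k).1 := fun a k =>
    ⟨fun h => hmono h (Nat.find_spec (hex a)), fun h => Nat.find_le h⟩
  refine ⟨fun a => Nat.find (hex a), fun a => e a, ?_, fun a => (hdeg a s).2 (e a).2, fun k => ?_⟩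
  · exact LinearIndependent.comp (v := ((↑) : (B s).1 → V)) (B s).2.1 e e.injective
  · have h1 : (fun a => (e a : V)) '' {a | Nat.find (hex a) ≤ k} = (B s).1 ∩ (B k).1 := by
      ext v
      simp only [mem_image, mem_ofPred_eq, hdeg]
      constructor
      · rintro ⟨a, ha, rfl⟩
        exact ⟨(e a).2, ha⟩
      · rintro ⟨hv, hv'⟩
        exact ⟨e.symm ⟨v, hv⟩, by simpa using hv', by simp⟩
    rw [h1]
    rcases le_total s k with h | h
    · rw [inter_eq_left.2 (hmono h), (B s).2.2]
      exact le_antisymm (hf h) (hs ▸ le_top)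
    · rw [inter_eq_right.2 (hmono h), (B k).2.2]

section Frame

variable {n : ℕ} {M : Type*} [TopologicalSpace M] [ChartedSpace (EuclideanSpace ℝ (Fin n)) M]
  [IsManifold (𝓡 n) ∞ M]

/-- `Z` is a frame on `U` that is adapted to the filtration of `TM`. -/
structure IsAdaptedFrame (S : Structure n M) (deg : Fin n → ℕ) (Z : Fin n → VField n M)
    (U : Set M) : Prop where
  isOpen : IsOpen U
  isSection : ∀ a, IsSection (flag S.E (deg a)) (Z a)
  linearIndependent : ∀ x ∈ U, LinearIndependent ℝ fun a => Z a x
  span_eq : ∀ x ∈ U, ∀ k,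
    Submodule.span ℝ ((fun a => Z a x) '' {a | deg a ≤ k}) = flag S.E k x

theorem exists_flag_eq_top {D : Distribution n M} (hgen : IsBracketGenerating D) (x : M) :
    ∃ s, flag D s x = ⊤ := by
  let f : ℕ →o Submodule ℝ (TangentSpace (𝓡 n) x) := ⟨fun k => flag D k x, fun _ _ h =>
    flag_mono D h x⟩
  refine ⟨monotonicSequenceLimitIndex f, ?_⟩
  rw [← hgen x]
  exact (WellFoundedGT.iSup_eq_monotonicSequenceLimit f).symm

omit [IsManifold (𝓡 n) ∞ M] in
theorem finrank_tangentSpace (x : M) : Module.finrank ℝ (TangentSpace (𝓡 n) x) = n :=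
  finrank_euclideanSpace_fin (𝕜 := ℝ) (n := n)

/-- Extend an adapted basis at `x₀` to sections of the matching levels. Each level stays spanned
near `x₀` by constancy of the rank, and only the levels up to `s` need shrinking of the
neighborhood. -/
theorem exists_isAdaptedFrame [T2Space M] (S : Structure n M) (hgen : IsBracketGenerating S.E)
    (hreg : IsEquiregular S.E) (x₀ : M) :
    ∃ (deg : Fin n → ℕ) (Z : Fin n → VField n M) (U : Set M),
      x₀ ∈ U ∧ IsAdaptedFrame S deg Z U := by
  obtain ⟨s, hs⟩ := exists_flag_eq_top hgen x₀
  obtain ⟨deg, b, hb, hdeg, hspan⟩ := exists_adapted_basis (f := fun k => flag S.E k x₀)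
    (fun _ _ h => flag_mono S.E h x₀) (flag_zero S.E x₀) hs (finrank_tangentSpace x₀)
  have hmem : ∀ a, b a ∈ flag S.E (deg a) x₀ := fun a =>
    hspan (deg a) ▸ Submodule.subset_span ⟨a, le_refl (deg a), rfl⟩
  choose Z hZ hZx using fun a => (hreg (deg a)).exists_isSection (hmem a)
  have hli : LinearIndependent ℝ fun a => Z a x₀ := by simpa only [hZx] using hb
  have hk : ∀ k, ∀ᶠ x in 𝓝 x₀,
      Submodule.span ℝ ((fun a => Z a x) '' {a | deg a ≤ k}) = flag S.E k x := by
    intro k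
    have h1 := (hreg k).eventually_span_eq (Z := fun a : {a | deg a ≤ k} => Z a)
      (fun a => (hZ a).mono a.2) (x₀ := x₀) (hli.comp _ Subtype.val_injective)
      (by
        rw [← hspan k, image_eq_range]
        simp only [hZx])
    filter_upwards [h1] with x hx
    rw [← hx, image_eq_range]
  have hall : ∀ᶠ x in 𝓝 x₀, LinearIndependent ℝ (fun a => Z a x) ∧
      ∀ k ≤ s, Submodule.span ℝ ((fun a => Z a x) '' {a | deg a ≤ k}) = flag S.E k x :=
    (eventually_linearIndependent (fun a => (hZ a).smooth) hli).and
      ((finite_Iic s).eventually_all.2 fun k _ => hk k)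
  obtain ⟨U, hU, hUo, hxU⟩ := eventually_nhds_iff.1 hall
  refine ⟨deg, Z, U, hxU, hUo, hZ, fun x hx => (hU x hx).1, fun x hx k => ?_⟩
  rcases le_total k s with h | h
  · exact (hU x hx).2 k h
  -- Above `s` no new fields occur: the fields of degree at most `s` are all `n` fields, which
  -- already span the tangent space.
  · have huniv : ∀ k, s ≤ k → {a | deg a ≤ k} = univ := fun k hk =>
      eq_univ_of_forall fun a => (hdeg a).trans hk
    have htop : Submodule.span ℝ (range fun a => Z a x) = ⊤ := by
      have := (hU x hx).1.span_eq_top_of_card_eq_finrank'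
        (by rw [Fintype.card_fin, finrank_tangentSpace])
      exact this
    have h2 := (hU x hx).2 s le_rfl
    rw [huniv s le_rfl, image_univ, htop] at h2
    rw [huniv k h, image_univ, htop]
    exact le_antisymm (h2 ▸ flag_mono S.E h x) le_top

end Frame

end SubRiemannian
end

/-! ### Coordinates on gr in an adapted frame -/

noncomputable section

namespace SubRiemannian

open Set Filter

namespace Structure

variable {n : ℕ} {M : Type*} [TopologicalSpace M] [ChartedSpace (EuclideanSpace ℝ (Fin n)) M]
  [IsManifold (𝓡 n) ∞ M] {S : Structure n M}

theorem of_smul {x : M} (k : ℕ) (c : ℝ) (a : S.GrPiece x k) :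
    DirectSum.of (S.GrPiece x) k (c • a) = c • DirectSum.of (S.GrPiece x) k a :=
  (DirectSum.lof ℝ ℕ (S.GrPiece x) k).map_smul c a

/-- The section `A` of `gr` is smooth near `x₀`. -/
def SmoothGrAt (A : ∀ x, S.Gr x) (x₀ : M) : Prop :=
  ∀ k : ℕ, ∃ (X : VField n M) (hX : IsSection (flag S.E k) X),
    ∀ᶠ x in 𝓝 x₀, A x k = S.grMk x k (X x) (hX.mem x)

theorem isSmoothGr_iff {A : ∀ x, S.Gr x} : S.IsSmoothGr A ↔ ∀ x₀, SmoothGrAt A x₀ :=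
  ⟨fun h x₀ k => h k x₀, fun h k x₀ => h x₀ k⟩

theorem SmoothGrAt.congr {A B : ∀ x, S.Gr x} {x₀ : M} (hA : SmoothGrAt A x₀)
    (h : ∀ᶠ x in 𝓝 x₀, B x = A x) : SmoothGrAt B x₀ := fun k => by
  obtain ⟨X, hX, e⟩ := hA k
  refine ⟨X, hX, ?_⟩
  filter_upwards [e, h] with x h1 h2
  rw [h2, h1]

end Structure

namespace IsAdaptedFrame

variable {n : ℕ} {M : Type*} [TopologicalSpace M] [ChartedSpace (EuclideanSpace ℝ (Fin n)) M]
  [IsManifold (𝓡 n) ∞ M] {S : Structure n M} {deg : Fin n → ℕ} {Z : Fin n → VField n M}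
  {U : Set M} (hF : IsAdaptedFrame S deg Z U)

include hF

/-- The basis of the tangent space given by the frame. -/
def basisAt {x : M} (hx : x ∈ U) : Module.Basis (Fin n) ℝ (TangentSpace (𝓡 n) x) :=
  Module.Basis.mk (hF.linearIndependent x hx) (by
    have := (hF.linearIndependent x hx).span_eq_top_of_card_eq_finrank'
      (by rw [Fintype.card_fin, finrank_tangentSpace])
    exact this.ge)

theorem basisAt_apply {x : M} (hx : x ∈ U) (a : Fin n) : hF.basisAt hx a = Z a x := by
  simp [basisAt]

open Classical in
/-- The coefficients of a tangent vector in the frame. -/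
def coeff (x : M) (a : Fin n) : TangentSpace (𝓡 n) x →ₗ[ℝ] ℝ :=
  if hx : x ∈ U then (hF.basisAt hx).coord a else 0

theorem coeff_frame {x : M} (hx : x ∈ U) (a b : Fin n) :
    hF.coeff x a (Z b x) = if a = b then 1 else 0 := by
  rw [coeff, dif_pos hx, ← hF.basisAt_apply hx, Module.Basis.coord_apply,
    Module.Basis.repr_self, Finsupp.single_apply]
  simp only [eq_comm]

/-- Level `k` is spanned by frame fields of degree at most `k`. For this reason a coefficient of
degree `deg a` descends to the quotient by the preceding level. -/
theorem coeff_eq_zero (x : M) {a : Fin n} {k : ℕ} (h : k < deg a)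
    {v : TangentSpace (𝓡 n) x} (hv : v ∈ flag S.E k x) : hF.coeff x a v = 0 := by
  by_cases hx : x ∈ U
  · rw [← hF.span_eq x hx k] at hv
    refine Submodule.span_induction (p := fun v _ => hF.coeff x a v = 0) ?_ (map_zero _)
      (fun v w _ _ hv hw => by rw [map_add, hv, hw, add_zero])
      (fun c v _ hv => by rw [map_smul, hv, smul_zero]) hv
    rintro _ ⟨b, hb, rfl⟩
    rw [hF.coeff_frame hx, if_neg]
    rintro rfl
    exact absurd h (not_lt.2 hb)
  · simp [coeff, hx]

theorem deg_pos {x : M} (hx : x ∈ U) (a : Fin n) : 0 < deg a := by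
  rw [Nat.pos_iff_ne_zero]
  intro h
  have h1 := (hF.isSection a).mem x
  rw [h, flag_zero, Submodule.mem_bot] at h1
  exact (hF.linearIndependent x hx).ne_zero a h1

/-- The section of `gr` given by the class of a frame field. -/
def grFrame (a : Fin n) (x : M) : S.Gr x :=
  DirectSum.of (S.GrPiece x) (deg a) (S.grMk x (deg a) (Z a x) ((hF.isSection a).mem x))

/-- The linear map to `gr_x` given by the frame. -/
def toGr (x : M) : (Fin n → ℝ) →ₗ[ℝ] S.Gr x :=
  Fintype.linearCombination ℝ fun a => hF.grFrame a x

theorem toGr_apply (x : M) (v : Fin n → ℝ) : hF.toGr x v = ∑ a, v a • hF.grFrame a x := rfl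

theorem toGr_single (x : M) (a : Fin n) : hF.toGr x (Pi.single a 1) = hF.grFrame a x := by
  simp [toGr]

/-- The coefficient of a homogeneous element. -/
def coeffPiece (x : M) (a : Fin n) : S.GrPiece x (deg a) →ₗ[ℝ] ℝ :=
  Submodule.liftQ _ ((hF.coeff x a).domRestrict (flag S.E (deg a) x)) (by
    rintro ⟨v, hv⟩ (hv' : v ∈ flag S.E (deg a - 1) x)
    rw [LinearMap.mem_ker, LinearMap.domRestrict_apply]
    by_cases hx : x ∈ U
    · exact hF.coeff_eq_zero x (Nat.sub_lt (hF.deg_pos hx a) one_pos) hv'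
    · simp [coeff, hx])

theorem coeffPiece_mk (x : M) (a : Fin n) {v : TangentSpace (𝓡 n) x}
    (hv : v ∈ flag S.E (deg a) x) :
    hF.coeffPiece x a (S.grMk x (deg a) v hv) = hF.coeff x a v := rfl

/-- The coefficients of an element of `gr_x` in the frame. -/
def ofGr (x : M) : S.Gr x →ₗ[ℝ] (Fin n → ℝ) :=
  LinearMap.pi fun a => hF.coeffPiece x a ∘ₗ DirectSum.component ℝ ℕ (S.GrPiece x) (deg a)

theorem ofGr_apply (x : M) (A : S.Gr x) (a : Fin n) :
    hF.ofGr x A a = hF.coeffPiece x a (A (deg a)) := rfl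

theorem ofGr_of (x : M) {k : ℕ} {v : TangentSpace (𝓡 n) x} (hv : v ∈ flag S.E k x) (a : Fin n) :
    hF.ofGr x (DirectSum.of _ k (S.grMk x k v hv)) a =
      if deg a = k then hF.coeff x a v else 0 := by
  rw [ofGr_apply]
  split_ifs with h
  · subst h
    rw [DirectSum.of_eq_same, coeffPiece_mk]
  · rw [DirectSum.of_eq_of_ne _ _ _ h, map_zero]

theorem ofGr_toGr {x : M} (hx : x ∈ U) (v : Fin n → ℝ) : hF.ofGr x (hF.toGr x v) = v := by
  have : hF.ofGr x ∘ₗ hF.toGr x = LinearMap.id := by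
    refine LinearMap.pi_ext' fun a => LinearMap.ext_ring ?_
    ext b
    simp only [LinearMap.comp_apply, LinearMap.single_apply, toGr_single, LinearMap.id_apply]
    rw [grFrame, hF.ofGr_of, hF.coeff_frame hx, Pi.single_apply]
    split_ifs with h1 h2 h2
    · rfl
    · rfl
    · subst h2; exact absurd rfl h1
    · rfl
  exact LinearMap.congr_fun this v

/-- By `span_eq` only frame fields of degree at most `k` are needed; those of smaller degree have
class zero in gr_{-k}, and those of degree `k` give basis classes. -/
theorem mem_range_toGr {x : M} (hx : x ∈ U) {k : ℕ} {v : TangentSpace (𝓡 n) x}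
    (hv : v ∈ flag S.E k x) :
    DirectSum.of (S.GrPiece x) k (S.grMk x k v hv) ∈ LinearMap.range (hF.toGr x) := by
  have hv' := hv
  rw [← hF.span_eq x hx k] at hv'
  induction hv' using Submodule.span_induction with
  | zero =>
    have : S.grMk x k 0 hv = 0 := rfl
    rw [this, map_zero]
    exact Submodule.zero_mem _
  | add u w hu hw ihu ihw =>
    rw [hF.span_eq x hx k] at hu hw
    have : S.grMk x k (u + w) hv = S.grMk x k u hu + S.grMk x k w hw := rfl
    rw [this, map_add]
    exact Submodule.add_mem _ (ihu hu) (ihw hw)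
  | smul c u hu ih =>
    rw [hF.span_eq x hx k] at hu
    have : S.grMk x k (c • u) hv = c • S.grMk x k u hu := rfl
    rw [this, Structure.of_smul]
    exact Submodule.smul_mem _ _ (ih hu)
  | mem u hu =>
    obtain ⟨a, ha, rfl⟩ := hu
    rcases (show deg a ≤ k from ha).lt_or_eq with h | h
    · have : S.grMk x k (Z a x) hv = 0 :=
        (S.grMk_eq_zero_iff hv).2 (((hF.isSection a).mono (by omega : deg a ≤ k - 1)).mem x)
      rw [this, map_zero]
      exact Submodule.zero_mem _
    · exact ⟨Pi.single a 1, (hF.toGr_single x a).trans (S.of_grMk_congr h rfl _ _)⟩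

theorem toGr_ofGr {x : M} (hx : x ∈ U) (A : S.Gr x) :
    hF.toGr x (hF.ofGr x A) = A := by
  have hr : A ∈ LinearMap.range (hF.toGr x) := by
    induction A using DirectSum.induction_on with
    | zero => exact Submodule.zero_mem _
    | add A B hA hB => exact Submodule.add_mem _ hA hB
    | of k a =>
      obtain ⟨⟨v, hv⟩, rfl⟩ := Submodule.Quotient.mk_surjective _ a
      exact hF.mem_range_toGr hx hv
  obtain ⟨v, rfl⟩ := hr
  rw [hF.ofGr_toGr hx]

/-- The linear equivalence with `gr_x` given by the frame. -/
def equivGr {x : M} (hx : x ∈ U) : (Fin n → ℝ) ≃ₗ[ℝ] S.Gr x :=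
  LinearEquiv.ofLinearMap (hF.toGr x) (hF.ofGr x) (LinearMap.ext (hF.toGr_ofGr hx))
    (LinearMap.ext (hF.ofGr_toGr hx))

theorem toGr_apply_eq (x : M) (v : Fin n → ℝ) (k : ℕ) :
    hF.toGr x v k = ∑ a, if h : deg a = k then
      v a • S.grMk x k (Z a x) (h ▸ (hF.isSection a).mem x) else 0 := by
  rw [toGr_apply, DFinsupp.finsetSum_apply]
  refine Finset.sum_congr rfl fun a _ => ?_
  change v a • (hF.grFrame a x k) = _
  split_ifs with h
  · subst h
    rw [grFrame, DirectSum.of_eq_same]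
  · rw [grFrame, DirectSum.of_eq_of_ne _ _ _ (Ne.symm h), smul_zero]

variable [T2Space M]

theorem eventually_coeff_eq {X : VField n M} (hX : IsSmooth X) {x₀ : M} (hx₀ : x₀ ∈ U) :
    ∃ f : Fin n → M → ℝ, (∀ a, ContMDiff (𝓡 n) 𝓘(ℝ, ℝ) ∞ (f a)) ∧
      ∀ᶠ x in 𝓝 x₀, ∀ a, hF.coeff x a (X x) = f a x := by
  obtain ⟨f, hf, he⟩ := exists_smooth_coeff (fun a => (hF.isSection a).smooth)
    (hF.linearIndependent x₀ hx₀) hX (by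
      filter_upwards [hF.isOpen.mem_nhds hx₀] with x hx
      have := (hF.linearIndependent x hx).span_eq_top_of_card_eq_finrank'
        (by rw [Fintype.card_fin, finrank_tangentSpace])
      rw [this]
      exact Submodule.mem_top)
  refine ⟨f, hf, ?_⟩
  filter_upwards [he, hF.isOpen.mem_nhds hx₀] with x h hx a
  rw [h, map_sum]
  simp [hF.coeff_frame hx]

theorem contMDiffAt_coeff {X : VField n M} (hX : IsSmooth X) {x₀ : M} (hx₀ : x₀ ∈ U)
    (a : Fin n) : ContMDiffAt (𝓡 n) 𝓘(ℝ, ℝ) ∞ (fun x => hF.coeff x a (X x)) x₀ := by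
  obtain ⟨f, hf, he⟩ := hF.eventually_coeff_eq hX hx₀
  exact (hf a x₀).congr_of_eventuallyEq (he.mono fun x hx => hx a)

theorem contMDiffAt_ofGr {A : ∀ x, S.Gr x} {x₀ : M} (hx₀ : x₀ ∈ U)
    (hA : Structure.SmoothGrAt A x₀) :
    ContMDiffAt (𝓡 n) 𝓘(ℝ, Fin n → ℝ) ∞ (fun x => hF.ofGr x (A x)) x₀ := by
  refine contMDiffAt_pi_space.2 fun a => ?_
  obtain ⟨X, hX, he⟩ := hA (deg a)
  refine (hF.contMDiffAt_coeff hX.smooth hx₀ a).congr_of_eventuallyEq ?_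
  filter_upwards [he] with x hx
  rw [ofGr_apply, hx, coeffPiece_mk]

theorem smoothGrAt_toGr {v : M → Fin n → ℝ} {x₀ : M}
    (hv : ∀ᶠ x in 𝓝 x₀, ContMDiffAt (𝓡 n) 𝓘(ℝ, Fin n → ℝ) ∞ v x) :
    Structure.SmoothGrAt (fun x => hF.toGr x (v x)) x₀ := by
  obtain ⟨g, hg, he⟩ := exists_contMDiff_eventuallyEq hv
  intro k
  have hsec : IsSection (flag S.E k) (fun x => ∑ a ∈ Finset.univ.filter (fun a => deg a = k),
      g x a • Z a x) :=
    IsSection.sum _ fun a ha => by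
      obtain rfl := (Finset.mem_filter.1 ha).2
      exact (hF.isSection a).smul (contMDiff_pi_space.1 hg a)
  refine ⟨_, hsec, ?_⟩
  filter_upwards [he] with x hx
  rw [toGr_apply_eq, ← hx, Structure.grMk]
  have h1 : (⟨∑ a ∈ Finset.univ.filter (fun a => deg a = k), g x a • Z a x, hsec.mem x⟩ :
      flag S.E k x) = ∑ a, if h : deg a = k then
        g x a • (⟨Z a x, h ▸ (hF.isSection a).mem x⟩ : flag S.E k x) else 0 := by
    ext1
    rw [Submodule.coe_sum]
    change (∑ a ∈ Finset.univ.filter (fun a => deg a = k), g x a • Z a x) = _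
    rw [Finset.sum_filter]
    refine Finset.sum_congr rfl fun a _ => ?_
    split_ifs <;> rfl
  rw [h1, ← Submodule.mkQ_apply, map_sum]
  refine Finset.sum_congr rfl fun a _ => ?_
  split_ifs
  · rw [map_smul]; rfl
  · rw [map_zero]

end IsAdaptedFrame

end SubRiemannian
end

/-! ### The structure tensor in a frame and graded isometries of fibers -/

noncomputable section

namespace SubRiemannian

open Set Filter

namespace Structure

variable {n : ℕ} {M : Type*} [TopologicalSpace M] [ChartedSpace (EuclideanSpace ℝ (Fin n)) M]
  [IsManifold (𝓡 n) ∞ M] [T2Space M] {S : Structure n M}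

/-- The inner product of `gr_{x,-1}` as a bilinear map. -/
def grInnerₗ (S : Structure n M) (x : M) : S.GrPiece x 1 →ₗ[ℝ] S.GrPiece x 1 →ₗ[ℝ] ℝ :=
  (S.g x).compl₁₂ (S.horizontalEquiv x).symm.toLinearMap (S.horizontalEquiv x).symm.toLinearMap

theorem grInnerₗ_apply (x : M) (a b : S.GrPiece x 1) :
    grInnerₗ S x a b = S.grInner x a b := rfl

theorem grInner_pos (x : M) {a : S.GrPiece x 1} (ha : a ≠ 0) : 0 < S.grInner x a a :=
  S.g_pos x _ (by simpa using ha)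

theorem grInner_symm (x : M) (a b : S.GrPiece x 1) : S.grInner x a b = S.grInner x b a :=
  S.g_symm x _ _

theorem isSection_of_flag_one {X : VField n M} (hX : IsSection (flag S.E 1) X) :
    IsSection S.E X :=
  ⟨hX.smooth, fun x => S.isSubbundle.flag_one x ▸ hX.mem x⟩

theorem horizontalEquiv_symm_mk {x : M} {v : TangentSpace (𝓡 n) x} (hv : v ∈ flag S.E 1 x) :
    (S.horizontalEquiv x).symm (S.grMk x 1 v hv) = ⟨v, S.isSubbundle.flag_one x ▸ hv⟩ := by
  rw [LinearEquiv.symm_apply_eq]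
  rfl

theorem contMDiffAt_grInner {A B : ∀ x, S.Gr x} {x₀ : M} (hA : SmoothGrAt A x₀)
    (hB : SmoothGrAt B x₀) :
    ContMDiffAt (𝓡 n) 𝓘(ℝ, ℝ) ∞ (fun x => S.grInner x (A x 1) (B x 1)) x₀ := by
  obtain ⟨X, hX, hAX⟩ := hA 1
  obtain ⟨Y, hY, hBY⟩ := hB 1
  refine (S.g_smooth X Y (isSection_of_flag_one hX)
    (isSection_of_flag_one hY) x₀).congr_of_eventuallyEq ?_
  filter_upwards [hAX, hBY] with x h1 h2
  rw [h1, h2, grInner, horizontalEquiv_symm_mk, horizontalEquiv_symm_mk]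

omit [T2Space M] in
theorem smoothGrAt_of_isSection {k : ℕ} {X : VField n M} (hX : IsSection (flag S.E k) X) (x₀ : M) :
    SmoothGrAt (fun x => DirectSum.of (S.GrPiece x) k (S.grMk x k (X x) (hX.mem x))) x₀ := by
  intro m
  by_cases h : m = k
  · subst h
    exact ⟨X, hX, Eventually.of_forall fun x => DirectSum.of_eq_same _ _⟩
  · refine ⟨fun _ => 0, ⟨IsSmooth.zero, fun x => Submodule.zero_mem _⟩,
      Eventually.of_forall fun x => ?_⟩
    rw [DirectSum.of_eq_of_ne _ _ _ h]
    rfl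

omit [T2Space M] in
theorem eq_of_of_forall_ne {x : M} {A : S.Gr x} {k : ℕ} (h : ∀ m, m ≠ k → A m = 0) :
    A = DirectSum.of (S.GrPiece x) k (A k) := by
  refine DFinsupp.ext fun m => ?_
  by_cases hm : m = k
  · subst hm
    exact (DirectSum.of_eq_same _ _).symm
  · rw [h m hm]
    exact (DirectSum.of_eq_of_ne _ _ _ hm).symm

/-- A graded isometry between the fibers of `gr` at two points. -/
structure GrIso (S : Structure n M) (x y : M) where
  toEquiv : S.Gr x ≃ₗ[ℝ] S.Gr y
  map_bracket : ∀ a b, toEquiv (S.grBracket x a b) = S.grBracket y (toEquiv a) (toEquiv b)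
  map_of : ∀ k a, ∃ b, toEquiv (DirectSum.of _ k a) = DirectSum.of (S.GrPiece y) k b
  map_inner : ∀ a b, S.grInner y (toEquiv a 1) (toEquiv b 1) = S.grInner x (a 1) (b 1)

/-- The composition of graded isometries. -/
def GrIso.trans {x y z : M} (φ : GrIso S x y) (ψ : GrIso S y z) : GrIso S x z where
  toEquiv := φ.toEquiv.trans ψ.toEquiv
  map_bracket a b := by simp [φ.map_bracket, ψ.map_bracket]
  map_of k a := by
    obtain ⟨b, hb⟩ := φ.map_of k a
    obtain ⟨c, hc⟩ := ψ.map_of k b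
    exact ⟨c, by simp [hb, hc]⟩
  map_inner a b := by simp [φ.map_inner, ψ.map_inner]

end Structure

namespace IsAdaptedFrame

variable {n : ℕ} {M : Type*} [TopologicalSpace M] [ChartedSpace (EuclideanSpace ℝ (Fin n)) M]
  [IsManifold (𝓡 n) ∞ M] [T2Space M] {S : Structure n M} {deg : Fin n → ℕ}
  {Z : Fin n → VField n M} {U : Set M} (hF : IsAdaptedFrame S deg Z U)

/-- The bracket and the inner product of `gr` in the frame. -/
def tensor (x : M) : (Fin n → ℝ) →L[ℝ] (Fin n → ℝ) →L[ℝ] (Fin n → ℝ) × ℝ :=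
  combMap fun a => combMap fun b =>
    (hF.ofGr x (S.grBracket x (hF.grFrame a x) (hF.grFrame b x)),
      S.grInner x (hF.grFrame a x 1) (hF.grFrame b x 1))

/-- The degree operator in the frame. -/
def degOp (deg : Fin n → ℕ) : (Fin n → ℝ) →L[ℝ] (Fin n → ℝ) :=
  ContinuousLinearMap.pi fun a => (deg a : ℝ) • ContinuousLinearMap.proj a

theorem degOp_apply (deg : Fin n → ℕ) (v : Fin n → ℝ) (a : Fin n) :
    degOp deg v a = deg a * v a := rfl

variable (hreg : IsEquiregular S.E)
include hreg

/-- `tensor` is defined by its matrix entries so that smoothness in the point can be checked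
entrywise; bilinearity recovers its invariant meaning. -/
theorem tensor_apply (x : M) (v w : Fin n → ℝ) :
    hF.tensor x v w = (hF.ofGr x (S.grBracket x (hF.toGr x v) (hF.toGr x w)),
      S.grInner x (hF.toGr x v 1) (hF.toGr x w 1)) := by
  have hB : S.grBracket x (hF.toGr x v) (hF.toGr x w) =
      ∑ a, v a • ∑ b, w b • S.grBracket x (hF.grFrame a x) (hF.grFrame b x) := by
    simp only [Structure.grBracket_eq hreg, toGr_apply, map_sum, map_smul, LinearMap.sum_apply,
      LinearMap.smul_apply, Finset.smul_sum]
    rw [Finset.sum_comm]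
    exact Finset.sum_congr rfl fun a _ => Finset.sum_congr rfl fun b _ => smul_comm _ _ _
  have hG : S.grInner x (hF.toGr x v 1) (hF.toGr x w 1) =
      ∑ a, v a * ∑ b, w b * S.grInner x (hF.grFrame a x 1) (hF.grFrame b x 1) := by
    have h1 : ∀ v, hF.toGr x v 1 = ∑ a, v a • (hF.grFrame a x 1) := fun v => by
      rw [toGr_apply, DFinsupp.finsetSum_apply]
      rfl
    simp only [← Structure.grInnerₗ_apply, h1, map_sum, map_smul, LinearMap.sum_apply,
      LinearMap.smul_apply, smul_eq_mul, Finset.mul_sum]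
    rw [Finset.sum_comm]
    exact Finset.sum_congr rfl fun a _ => Finset.sum_congr rfl fun b _ => mul_left_comm _ _ _
  rw [tensor, combMap_apply, hB, hG]
  simp only [sum_apply, smul_apply, combMap_apply, map_sum, map_smul]
  ext
  · simp [Prod.fst_sum]
  · simp [Prod.snd_sum]

theorem smoothGrAt_grBracket_frame (a b : Fin n) (x₀ : M) : Structure.SmoothGrAt
    (fun x => S.grBracket x (hF.grFrame a x) (hF.grFrame b x)) x₀ := by
  refine (Structure.smoothGrAt_of_isSection
    ((hF.isSection a).mlieBracket hreg (hF.isSection b)) x₀).congr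
    (Eventually.of_forall fun x => ?_)
  exact Structure.grBracket_mk_mk hreg (hF.isSection a) (hF.isSection b) x

omit [T2Space M] hreg in
theorem smoothGrAt_grFrame (a : Fin n) (x₀ : M) : Structure.SmoothGrAt (hF.grFrame a) x₀ :=
  Structure.smoothGrAt_of_isSection (hF.isSection a) x₀

theorem contMDiffAt_tensor {x : M} (hx : x ∈ U) : ContMDiffAt (𝓡 n)
    𝓘(ℝ, (Fin n → ℝ) →L[ℝ] (Fin n → ℝ) →L[ℝ] (Fin n → ℝ) × ℝ) ∞ hF.tensor x :=
  contMDiffAt_combMap fun a => contMDiffAt_combMap fun b =>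
    (hF.contMDiffAt_ofGr hx (hF.smoothGrAt_grBracket_frame hreg a b x)).prodMk_space
      (Structure.contMDiffAt_grInner (hF.smoothGrAt_grFrame a x) (hF.smoothGrAt_grFrame b x))

omit [T2Space M] hreg in
theorem toGr_degOp (x : M) (v : Fin n → ℝ) (k : ℕ) :
    hF.toGr x (degOp deg v) k = (k : ℝ) • hF.toGr x v k := by
  rw [toGr_apply_eq, toGr_apply_eq, Finset.smul_sum]
  refine Finset.sum_congr rfl fun a _ => ?_
  split_ifs with h
  · rw [degOp_apply, smul_smul, show (deg a : ℝ) = k from congrArg _ h]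
  · rw [smul_zero]

omit [T2Space M] hreg in
theorem degOp_ofGr_of (x : M) {k : ℕ} (a : S.GrPiece x k) :
    degOp deg (hF.ofGr x (DirectSum.of _ k a)) = (k : ℝ) • hF.ofGr x (DirectSum.of _ k a) := by
  ext b
  rw [degOp_apply, Pi.smul_apply, smul_eq_mul, ofGr_apply]
  by_cases h : deg b = k
  · rw [show (deg b : ℝ) = k from congrArg _ h]
  · rw [DirectSum.of_eq_of_ne _ _ _ h, map_zero, mul_zero, mul_zero]

omit [T2Space M] hreg in
theorem toGr_eq_of (x : M) {v : Fin n → ℝ} {k : ℕ} (hv : degOp deg v = (k : ℝ) • v) :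
    hF.toGr x v = DirectSum.of (S.GrPiece x) k (hF.toGr x v k) := by
  refine Structure.eq_of_of_forall_ne fun m hm => ?_
  have h1 := hF.toGr_degOp x v m
  rw [hv, map_smul] at h1
  have h2 : ((k : ℝ) - m) • hF.toGr x v m = 0 := by
    rw [sub_smul, sub_eq_zero]
    exact h1
  refine (smul_eq_zero.1 h2).resolve_left ?_
  exact sub_ne_zero.2 (Nat.cast_injective.ne hm.symm)

omit hreg in
theorem degOp_eq_self_iff {v : Fin n → ℝ} :
    degOp deg v = v ↔ degOp deg v = ((1 : ℕ) : ℝ) • v := by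
  rw [Nat.cast_one, one_smul]

/-- The eigenvalue-one vectors of the degree operator represent gr_{-1}, where the form is the
sub-Riemannian inner product. -/
theorem posOn {x : M} (hx : x ∈ U) : PosOn (degOp deg) (hF.tensor x) := by
  intro v hv hv0
  rw [hF.tensor_apply hreg]
  refine Structure.grInner_pos x fun h => hv0 ?_
  have h1 := hF.toGr_eq_of x (degOp_eq_self_iff.1 hv)
  rw [h, map_zero] at h1
  rw [← hF.ofGr_toGr hx v, h1, map_zero]

/-- Induction on the degree: gr_{-k-1} is spanned by brackets of gr_{-1} with gr_{-k}. -/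
theorem genBy {x : M} (hx : x ∈ U) : GenBy (degOp deg) (hF.tensor x) := by
  intro V h1 h2
  have hk : ∀ k, ∀ a : S.GrPiece x k, hF.ofGr x (DirectSum.of _ k a) ∈ V := by
    intro k
    induction k with
    | zero =>
      intro a
      obtain ⟨⟨v, hv⟩, rfl⟩ := Submodule.Quotient.mk_surjective _ a
      have h0 : S.grMk x 0 v hv = 0 := (S.grMk_eq_zero_iff hv).2 hv
      change hF.ofGr x (DirectSum.of _ 0 (S.grMk x 0 v hv)) ∈ V
      rw [h0, map_zero, map_zero]
      exact V.zero_mem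
    | succ k ih =>
      have hone : ∀ u : S.GrPiece x 1, degOp deg (hF.ofGr x (DirectSum.of _ 1 u)) =
          hF.ofGr x (DirectSum.of _ 1 u) := fun u =>
        degOp_eq_self_iff.2 (hF.degOp_ofGr_of x u)
      intro a
      rcases Nat.eq_zero_or_pos k with rfl | hk
      · exact h1 _ (hone a)
      · have hle : Submodule.span ℝ {c | ∃ (u : S.GrPiece x 1) (v : S.GrPiece x k),
            S.grBracket x (DirectSum.of _ 1 u) (DirectSum.of _ k v) = c} ≤
            V.comap (hF.ofGr x) := by
          rw [Submodule.span_le]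
          rintro _ ⟨u, v, rfl⟩
          have h3 := h2 _ (hone u) _ (ih v)
          rw [hF.tensor_apply hreg, hF.toGr_ofGr hx, hF.toGr_ofGr hx] at h3
          exact h3
        exact hle (Structure.of_succ_mem_span hreg x hk a)
  rw [eq_top_iff]
  rintro v -
  rw [← hF.ofGr_toGr hx v]
  generalize hF.toGr x v = A
  induction A using DirectSum.induction_on with
  | zero => rw [map_zero]; exact V.zero_mem
  | of k a => exact hk k a
  | add A B hA hB => rw [map_add]; exact V.add_mem hA hB

theorem exists_isIntertwiner_of_grIso {x y : M} (hx : x ∈ U) (hy : y ∈ U)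
    (φ : Structure.GrIso S x y) :
    ∃ h, IsIntertwiner (degOp deg) h (hF.tensor x) (hF.tensor y) := by
  let h₀ : (Fin n → ℝ) →ₗ[ℝ] (Fin n → ℝ) :=
    hF.ofGr y ∘ₗ φ.toEquiv.toLinearMap ∘ₗ hF.toGr x
  have hh₀ : ∀ v, LinearMap.toContinuousLinearMap h₀ v =
    hF.ofGr y (φ.toEquiv (hF.toGr x v)) := fun v => rfl
  refine ⟨LinearMap.toContinuousLinearMap h₀, ?_, fun v w => ?_⟩
  · refine ContinuousLinearMap.ext fun v => ?_
    change LinearMap.toContinuousLinearMap h₀ (degOp deg v) =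
      degOp deg (LinearMap.toContinuousLinearMap h₀ v)
    rw [hh₀, hh₀, ← hF.ofGr_toGr hx v]
    generalize hF.toGr x v = A
    induction A using DirectSum.induction_on with
    | zero => simp only [map_zero]
    | add A B hA hB => simp only [map_add, hA, hB]
    | of k a =>
      obtain ⟨b, hb⟩ := φ.map_of k a
      rw [hF.degOp_ofGr_of, map_smul, map_smul, hF.toGr_ofGr hx, hb, hF.degOp_ofGr_of, map_smul]
  · rw [hF.tensor_apply hreg, hh₀, hh₀, hF.tensor_apply hreg, hh₀, hF.toGr_ofGr hy,
      hF.toGr_ofGr hy, hF.toGr_ofGr hx, φ.map_bracket, φ.map_inner]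

/-- Commuting with the degree operator preserves its eigenspaces, which are the graded pieces; the
map property then gives bracket and inner product together. -/
theorem nonempty_grIso_of_isIntertwiner {x y : M} (hx : x ∈ U) (hy : y ∈ U)
    {h k : (Fin n → ℝ) →L[ℝ] (Fin n → ℝ)}
    (hh : IsIntertwiner (degOp deg) h (hF.tensor x) (hF.tensor y)) (hkh : k * h = 1)
    (hhk : h * k = 1) : Nonempty (Structure.GrIso S x y) := by
  let e : (Fin n → ℝ) ≃ₗ[ℝ] (Fin n → ℝ) := LinearEquiv.ofLinearMap (h : _ →ₗ[ℝ] _) (k : _ →ₗ[ℝ] _)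
    (LinearMap.ext fun v => DFunLike.congr_fun hhk v)
    (LinearMap.ext fun v => DFunLike.congr_fun hkh v)
  let ψ : S.Gr x ≃ₗ[ℝ] S.Gr y := (hF.equivGr hx).symm.trans (e.trans (hF.equivGr hy))
  have hψ : ∀ A, ψ A = hF.toGr y (h (hF.ofGr x A)) := fun A => rfl
  have hT : ∀ A B, hF.tensor x (hF.ofGr x A) (hF.ofGr x B) =
      (hF.ofGr x (S.grBracket x A B), S.grInner x (A 1) (B 1)) := fun A B => by
    rw [hF.tensor_apply hreg, hF.toGr_ofGr hx, hF.toGr_ofGr hx]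
  have hm : ∀ A B, (hF.ofGr y (S.grBracket y (ψ A) (ψ B)), S.grInner y (ψ A 1) (ψ B 1)) =
      (h (hF.ofGr x (S.grBracket x A B)), S.grInner x (A 1) (B 1)) := fun A B => by
    have := hh.map (hF.ofGr x A) (hF.ofGr x B)
    rw [hT, hF.tensor_apply hreg] at this
    exact this
  refine ⟨⟨ψ, fun A B => ?_, fun k a => ?_, fun A B => congrArg Prod.snd (hm A B)⟩⟩
  · have h1 : hF.ofGr y (S.grBracket y (ψ A) (ψ B)) = h (hF.ofGr x (S.grBracket x A B)) :=
      congrArg Prod.fst (hm A B)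
    rw [hψ, ← h1, hF.toGr_ofGr hy]
  · refine ⟨_, hF.toGr_eq_of (v := h (hF.ofGr x (DirectSum.of _ k a))) y ?_⟩
    rw [hh.apply_comm, hF.degOp_ofGr_of, map_smul]

end IsAdaptedFrame

end SubRiemannian
end

/-! ### Derivatives on the manifold computed in a chart -/

noncomputable section

namespace SubRiemannian

open Set Filter

section Calculus

variable {n : ℕ} {M : Type*} [TopologicalSpace M] [ChartedSpace (EuclideanSpace ℝ (Fin n)) M]
  [IsManifold (𝓡 n) ∞ M] {E F : Type*} [NormedAddCommGroup E] [NormedSpace ℝ E]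
  [NormedAddCommGroup F] [NormedSpace ℝ F]

omit [IsManifold (𝓡 n) ∞ M] in
theorem mvfderiv_congr {f g : M → E} {x : M} (h : f =ᶠ[𝓝 x] g) :
    mvfderiv (𝓡 n) f x = mvfderiv (𝓡 n) g x := by
  ext v
  exact DFunLike.congr_fun h.mfderiv_eq v

omit [IsManifold (𝓡 n) ∞ M] in
theorem mvfderiv_clm_comp (L : E →L[ℝ] F) {f : M → E} {x : M}
    (hf : MDifferentiableAt (𝓡 n) 𝓘(ℝ, E) f x) (v : TangentSpace (𝓡 n) x) :
    mvfderiv (𝓡 n) (fun z => L (f z)) x v = L (mvfderiv (𝓡 n) f x v) := by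
  have h1 : MDifferentiableAt 𝓘(ℝ, E) 𝓘(ℝ, F) L (f x) := L.differentiableAt.mdifferentiableAt
  have h2 := mfderiv_comp_apply x h1 hf v
  rw [mfderiv_eq_fderiv, L.fderiv] at h2
  exact h2

/-- The tangent vector at `x` with coordinates `w` in the chart at `x₀`. -/
def coordVec (x₀ x : M) : EuclideanSpace ℝ (Fin n) →L[ℝ] TangentSpace (𝓡 n) x :=
  (trivializationAt (EuclideanSpace ℝ (Fin n)) (TangentSpace (𝓡 n) : M → Type _) x₀).symmL ℝ x

/-- The bridge between manifold derivatives and ordinary ones: the derivative of the chart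
representation is the manifold derivative applied to vectors given in chart coordinates. -/
theorem hasFDerivAt_comp_chart_symm {f : M → E} {x₀ x : M}
    (hx : x ∈ (chartAt (EuclideanSpace ℝ (Fin n)) x₀).source)
    (hf : MDifferentiableAt (𝓡 n) 𝓘(ℝ, E) f x) :
    HasFDerivAt (f ∘ (extChartAt (𝓡 n) x₀).symm)
      ((mvfderiv (𝓡 n) f x).comp (coordVec x₀ x)) (extChartAt (𝓡 n) x₀ x) := by
  have : IsManifold (𝓡 n) 1 M := IsManifold.of_le (n := ∞) ENat.LEInfty.out
  have hxs : x ∈ (extChartAt (𝓡 n) x₀).source := by rwa [extChartAt_source]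
  have e1 := mdifferentiableWithinAt_extChartAt_symm (I := 𝓡 n)
    ((extChartAt (𝓡 n) x₀).map_source hxs)
  have e2 : (extChartAt (𝓡 n) x₀).symm (extChartAt (𝓡 n) x₀ x) = x :=
    (extChartAt (𝓡 n) x₀).left_inv hxs
  have e3 := e1.hasMFDerivWithinAt
  rw [← TangentBundle.symmL_trivializationAt hx] at e3
  have e4 : HasMFDerivAt 𝓘(ℝ, EuclideanSpace ℝ (Fin n)) (𝓡 n) (extChartAt (𝓡 n) x₀).symm
      (extChartAt (𝓡 n) x₀ x) (coordVec x₀ x) := by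
    exact hasMFDerivWithinAt_univ.1 (ModelWithCorners.range_eq_univ (𝓡 n) ▸ e3)
  have hf' : HasMFDerivAt (𝓡 n) 𝓘(ℝ, E) f
      ((extChartAt (𝓡 n) x₀).symm (extChartAt (𝓡 n) x₀ x)) (mvfderiv (𝓡 n) f x) := by
    rw [e2]
    exact hf.hasMFDerivAt
  exact hasMFDerivAt_iff_hasFDerivAt.1 (HasMFDerivAt.comp _ hf' e4)

theorem coordVec_localRep (x₀ : M) {x : M} (hx : x ∈ (trivializationAt (EuclideanSpace ℝ (Fin n))
    (TangentSpace (𝓡 n) : M → Type _) x₀).baseSet) (X : VField n M) :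
    coordVec x₀ x (localRep x₀ X x) = X x :=
  (congrArg _ (Bundle.Trivialization.continuousLinearMapAt_apply_of_mem ℝ _ hx (X x)).symm).trans
    (Bundle.Trivialization.symmL_continuousLinearMapAt _ hx (X x))

theorem localRep_coordVec (x₀ : M) {x : M} (hx : x ∈ (trivializationAt (EuclideanSpace ℝ (Fin n))
    (TangentSpace (𝓡 n) : M → Type _) x₀).baseSet) (w : EuclideanSpace ℝ (Fin n)) :
    localRep x₀ (fun x => coordVec x₀ x w) x = w :=
  (Bundle.Trivialization.continuousLinearMapAt_apply_of_mem ℝ _ hx _).symm.trans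
    (Bundle.Trivialization.continuousLinearMapAt_symmL _ hx w)

theorem exists_coordinate_fields [T2Space M] (x₀ : M) : ∃ X : Fin n → VField n M,
    (∀ j, IsSmooth (X j)) ∧ ∀ᶠ x in 𝓝 x₀, ∀ w : EuclideanSpace ℝ (Fin n),
      coordVec x₀ x w = ∑ j, w j • X j x := by
  let e := trivializationAt (EuclideanSpace ℝ (Fin n)) (TangentSpace (𝓡 n) : M → Type _) x₀
  obtain ⟨ρ, -, hρ⟩ := (SmoothBumpFunction.nhds_basis_tsupport (I := 𝓡 n) x₀).mem_iff.1
    (eventually_mem_baseSet (n := n) x₀)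
  refine ⟨fun j x => ρ x • coordVec x₀ x (EuclideanSpace.single j 1), fun j => ?_, ?_⟩
  · have h : ContMDiffOn (𝓡 n) ((𝓡 n).prod 𝓘(ℝ, EuclideanSpace ℝ (Fin n))) ∞
        (fun y => (⟨y, coordVec x₀ y (EuclideanSpace.single j 1)⟩ : TangentBundle (𝓡 n) M))
        e.baseSet := fun x hx => by
      refine ContMDiffAt.contMDiffWithinAt ((contMDiffAt_localRep_iff x₀ hx
        (fun y => coordVec x₀ y (EuclideanSpace.single j 1))).1 ?_)
      refine (contMDiffAt_const (c := EuclideanSpace.single j (1 : ℝ))).congr_of_eventuallyEq ?_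
      filter_upwards [e.open_baseSet.mem_nhds hx] with y hy
      exact localRep_coordVec x₀ hy _
    exact ContMDiffOn.smul_section_of_tsupport (ρ.contMDiff.contMDiffOn) e.open_baseSet hρ h
  · filter_upwards [ρ.eventuallyEq_one] with x hx w
    have hw : w = ∑ j, w j • EuclideanSpace.single j (1 : ℝ) := by
      ext i
      simp [Finset.sum_apply, Pi.single_apply]
    conv_lhs => rw [hw]
    simp only [map_sum, map_smul, hx, Pi.one_apply, one_smul]

theorem contMDiffAt_mvfderiv_apply {f : M → E} {X : VField n M} {x₀ : M}
    (hf : ContMDiffAt (𝓡 n) 𝓘(ℝ, E) ∞ f x₀) (hX : IsSmooth X) :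
    ContMDiffAt (𝓡 n) 𝓘(ℝ, E) ∞ (fun x => mvfderiv (𝓡 n) f x (X x)) x₀ := by
  have hb := eventually_mem_baseSet (n := n) x₀
  have hL := (contMDiffAt_localRep_iff x₀ hb.self_of_nhds X).2 (hX x₀)
  have hφ : ContMDiffAt (𝓡 n) 𝓘(ℝ, EuclideanSpace ℝ (Fin n)) ∞ (extChartAt (𝓡 n) x₀) x₀ :=
    contMDiffAt_extChartAt
  have hg : ContDiffAt ℝ ∞ (f ∘ (extChartAt (𝓡 n) x₀).symm) (extChartAt (𝓡 n) x₀ x₀) := by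
    have h1 : ContMDiffAt 𝓘(ℝ, EuclideanSpace ℝ (Fin n)) (𝓡 n) ∞ (extChartAt (𝓡 n) x₀).symm
        (extChartAt (𝓡 n) x₀ x₀) :=
      (contMDiffOn_extChartAt_symm x₀).contMDiffAt (extChartAt_target_mem_nhds x₀)
    refine (ContMDiffAt.comp _ ?_ h1).contDiffAt
    rwa [extChartAt_to_inv]
  have hg' : ContMDiffAt (𝓡 n) 𝓘(ℝ, EuclideanSpace ℝ (Fin n) →L[ℝ] E) ∞
      (fun x => fderiv ℝ (f ∘ (extChartAt (𝓡 n) x₀).symm) (extChartAt (𝓡 n) x₀ x)) x₀ :=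
    (hg.fderiv_right (m := ∞) (by simp)).contMDiffAt.comp x₀ hφ
  have hmd : ∀ᶠ x in 𝓝 x₀, MDifferentiableAt (𝓡 n) 𝓘(ℝ, E) f x := by
    have h1 : ContMDiffAt (𝓡 n) 𝓘(ℝ, E) 1 f x₀ := hf.of_le ENat.LEInfty.out
    filter_upwards [(contMDiffAt_iff_contMDiffAt_nhds (by simp)).1 h1] with x hx
    exact ContMDiffAt.mdifferentiableAt hx (by simp)
  refine (hg'.clm_apply hL).congr_of_eventuallyEq ?_
  filter_upwards [hmd, hb, (chartAt (EuclideanSpace ℝ (Fin n)) x₀).open_source.mem_nhds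
    (mem_chart_source _ x₀)] with x h1 h2 h3
  rw [(hasFDerivAt_comp_chart_symm h3 h1).fderiv, ContinuousLinearMap.comp_apply,
    coordVec_localRep x₀ h2]

end Calculus

end SubRiemannian
end

/-! ### Connections on gr in a frame -/

noncomputable section

namespace SubRiemannian

open Set Filter

namespace Structure

variable {n : ℕ} {M : Type*} [TopologicalSpace M] [ChartedSpace (EuclideanSpace ℝ (Fin n)) M]
  [IsManifold (𝓡 n) ∞ M] {S : Structure n M}

theorem SmoothGrAt.zero (x₀ : M) : SmoothGrAt (S := S) (fun _ => 0) x₀ := fun _ =>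
  ⟨fun _ => 0, ⟨IsSmooth.zero, fun _ => Submodule.zero_mem _⟩, Eventually.of_forall fun _ => rfl⟩

theorem SmoothGrAt.add {A B : ∀ x, S.Gr x} {x₀ : M} (hA : SmoothGrAt A x₀)
    (hB : SmoothGrAt B x₀) : SmoothGrAt (fun x => A x + B x) x₀ := fun k => by
  obtain ⟨X, hX, h1⟩ := hA k
  obtain ⟨Y, hY, h2⟩ := hB k
  refine ⟨_, hX.add hY, ?_⟩
  filter_upwards [h1, h2] with x e1 e2
  rw [DirectSum.add_apply, e1, e2]
  rfl

theorem SmoothGrAt.smul {f : M → ℝ} {A : ∀ x, S.Gr x} {x₀ : M} (hA : SmoothGrAt A x₀)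
    (hf : ContMDiff (𝓡 n) 𝓘(ℝ, ℝ) ∞ f) : SmoothGrAt (fun x => f x • A x) x₀ := fun k => by
  obtain ⟨X, hX, h1⟩ := hA k
  refine ⟨_, hX.smul hf, ?_⟩
  filter_upwards [h1] with x e1
  rw [DirectSum.smul_apply, e1]
  rfl

theorem SmoothGrAt.sum {ι : Type*} (s : Finset ι) {A : ι → ∀ x, S.Gr x} {x₀ : M}
    (hA : ∀ i ∈ s, SmoothGrAt (A i) x₀) : SmoothGrAt (fun x => ∑ i ∈ s, A i x) x₀ := by
  classical
  induction s using Finset.induction_on with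
  | empty => simpa using SmoothGrAt.zero x₀
  | insert i s hi ih =>
    simp only [Finset.sum_insert hi]
    exact (hA i (Finset.mem_insert_self i s)).add
      (ih fun j hj => hA j (Finset.mem_insert_of_mem hj))

namespace GrConnection

variable (D : S.GrConnection) {Y : VField n M}

theorem nabla_zero (hY : IsSmooth Y) (x : M) : D.nabla Y (fun _ => 0) x = 0 := by
  have h := D.leibniz (fun _ => 0) Y (fun _ => 0) contMDiff_const hY
    (isSmoothGr_iff.2 fun x₀ => SmoothGrAt.zero x₀) x
  simpa using h

theorem nabla_sum_smul {ι : Type*} (s : Finset ι) {f : ι → M → ℝ} {A : ι → ∀ x, S.Gr x}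
    (hY : IsSmooth Y) (hf : ∀ i, ContMDiff (𝓡 n) 𝓘(ℝ, ℝ) ∞ (f i)) (hA : ∀ i, S.IsSmoothGr (A i))
    (x : M) : D.nabla Y (fun z => ∑ i ∈ s, f i z • A i z) x =
      ∑ i ∈ s, (mvfderiv (𝓡 n) (f i) x (Y x) • A i x + f i x • D.nabla Y (A i) x) := by
  classical
  have hfA : ∀ i, S.IsSmoothGr fun z => f i z • A i z := fun i =>
    isSmoothGr_iff.2 fun x₀ => SmoothGrAt.smul (isSmoothGr_iff.1 (hA i) x₀) (hf i)
  induction s using Finset.induction_on with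
  | empty => simpa using D.nabla_zero hY x
  | insert i s hi ih =>
    simp only [Finset.sum_insert hi]
    rw [D.add_right Y (fun z => f i z • A i z) (fun z => ∑ j ∈ s, f j z • A j z) hY (hfA i)
      (isSmoothGr_iff.2 fun x₀ => SmoothGrAt.sum s fun j _ => isSmoothGr_iff.1 (hfA j) x₀), ih,
      D.leibniz (f i) Y (A i) (hf i) hY (hA i)]

/-- A connection is a local operator. -/
theorem nabla_congr [T2Space M] {A B : ∀ x, S.Gr x} (hY : IsSmooth Y) (hA : S.IsSmoothGr A)
    (hB : S.IsSmoothGr B) {x : M} (h : ∀ᶠ z in 𝓝 x, A z = B z) :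
    D.nabla Y A x = D.nabla Y B x := by
  obtain ⟨ρ, -, hρ⟩ := (SmoothBumpFunction.nhds_basis_tsupport (I := 𝓡 n) x).mem_iff.1 h
  have he : (fun z => ρ z • A z) = fun z => ρ z • B z := by
    funext z
    by_cases hz : z ∈ tsupport ρ
    · rw [show A z = B z from hρ hz]
    · rw [image_eq_zero_of_notMem_tsupport hz, zero_smul, zero_smul]
  -- The sections agree after multiplication by the bump function. In the two Leibniz formulas the
  -- derivative terms coincide because `A x = B x`, and `ρ x = 1` leaves the covariant derivatives.
  have h1 := D.leibniz ρ Y A ρ.contMDiff hY hA x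
  have h2 := D.leibniz ρ Y B ρ.contMDiff hY hB x
  rw [he, h2, ρ.eq_one, one_smul, one_smul, h.self_of_nhds] at h1
  have key : ∀ {G : Type} [AddCommGroup G] (a b c : G), a + b = a + c → b = c :=
    fun _ _ _ => add_left_cancel
  exact (key _ _ _ h1).symm

end GrConnection

end Structure

theorem clm_pi_ext {n : ℕ} {E : Type*} [NormedAddCommGroup E] [NormedSpace ℝ E]
    {f g : (Fin n → ℝ) →L[ℝ] E} (h : ∀ a, f (Pi.single a 1) = g (Pi.single a 1)) : f = g := by
  refine ContinuousLinearMap.coe_injective (LinearMap.pi_ext' fun a => ?_)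
  ext
  exact h a

namespace IsAdaptedFrame

variable {n : ℕ} {M : Type*} [TopologicalSpace M] [ChartedSpace (EuclideanSpace ℝ (Fin n)) M]
  [IsManifold (𝓡 n) ∞ M] [T2Space M] {S : Structure n M} {deg : Fin n → ℕ}
  {Z : Fin n → VField n M} {U : Set M} (hF : IsAdaptedFrame S deg Z U)

omit [T2Space M] in
theorem isSmoothGr_grFrame (a : Fin n) : S.IsSmoothGr (hF.grFrame a) :=
  Structure.isSmoothGr_iff.2 fun x₀ => hF.smoothGrAt_grFrame a x₀

omit [T2Space M] in
theorem isInDegree_grFrame (a : Fin n) : Structure.IsInDegree (deg a) (hF.grFrame a) :=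
  fun _ _ hm => DirectSum.of_eq_of_ne _ _ _ hm

omit [T2Space M] in
theorem eventually_mem (hF : IsAdaptedFrame S deg Z U) {x : M} (hx : x ∈ U) :
    ∀ᶠ z in 𝓝 x, z ∈ U := hF.isOpen.mem_nhds hx

/-- The connection matrix in the frame. -/
def connMat (D : S.GrConnection) (Y : VField n M) (x : M) : (Fin n → ℝ) →L[ℝ] (Fin n → ℝ) :=
  combMap fun a => hF.ofGr x (D.nabla Y (hF.grFrame a) x)

variable (D : S.GrConnection) {Y : VField n M} (hY : IsSmooth Y)

omit [T2Space M] in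
theorem connMat_single (x : M) (a : Fin n) :
    hF.connMat D Y x (Pi.single a 1) = hF.ofGr x (D.nabla Y (hF.grFrame a) x) := by
  simp [connMat, combMap_apply, Pi.single_apply]

include hY

theorem contMDiffAt_connMat {x : M} (hx : x ∈ U) : ContMDiffAt (𝓡 n)
    𝓘(ℝ, (Fin n → ℝ) →L[ℝ] (Fin n → ℝ)) ∞ (hF.connMat D Y) x :=
  contMDiffAt_combMap fun a => hF.contMDiffAt_ofGr hx (Structure.isSmoothGr_iff.1
    (D.smooth Y _ hY (hF.isSmoothGr_grFrame a)) x)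

theorem ofGr_nabla {A : ∀ x, S.Gr x} (hA : S.IsSmoothGr A) {x : M} (hx : x ∈ U) :
    hF.ofGr x (D.nabla Y A x) = mvfderiv (𝓡 n) (fun z => hF.ofGr z (A z)) x (Y x) +
      hF.connMat D Y x (hF.ofGr x (A x)) := by
  obtain ⟨g, hg, he⟩ := exists_contMDiff_eventuallyEq (x₀ := x)
    ((hF.eventually_mem hx).mono fun z hz =>
      hF.contMDiffAt_ofGr hz (Structure.isSmoothGr_iff.1 hA z))
  have hga := contMDiff_pi_space.1 hg
  have hsum : S.IsSmoothGr fun z => ∑ a, g z a • hF.grFrame a z :=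
    Structure.isSmoothGr_iff.2 fun x₀ => Structure.SmoothGrAt.sum _ fun a _ =>
      Structure.SmoothGrAt.smul (hF.smoothGrAt_grFrame a x₀) (hga a)
  have hAg : ∀ᶠ z in 𝓝 x, A z = ∑ a, g z a • hF.grFrame a z := by
    filter_upwards [he, hF.eventually_mem hx] with z h1 h2
    rw [← toGr_apply, h1, hF.toGr_ofGr h2]
  have hd : ∀ a, mvfderiv (𝓡 n) (fun z => g z a) x (Y x) = mvfderiv (𝓡 n) g x (Y x) a := fun a =>
    mvfderiv_clm_comp (ContinuousLinearMap.proj (R := ℝ) (φ := fun _ : Fin n => ℝ) a)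
      ((hg x).mdifferentiableAt (by simp)) (Y x)
  rw [D.nabla_congr hY hA hsum hAg,
    D.nabla_sum_smul Finset.univ hY hga hF.isSmoothGr_grFrame, ← mvfderiv_congr he,
    Finset.sum_add_distrib, map_add]
  congr 1
  · simp only [hd]
    rw [← toGr_apply, hF.ofGr_toGr hx]
  · rw [connMat, combMap_apply, map_sum, show hF.ofGr x (A x) = g x from he.self_of_nhds.symm]
    simp only [map_smul]

/-- Parallelism of the graded pieces means that the matrix maps each frame class to a combination of
classes of the same degree. -/
theorem commute_connMat (hD : D.IsCompatible) (x : M) :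
    Commute (hF.connMat D Y x) (degOp deg) := by
  refine clm_pi_ext fun a => ?_
  have h1 : D.nabla Y (hF.grFrame a) x =
      DirectSum.of _ (deg a) (D.nabla Y (hF.grFrame a) x (deg a)) :=
    Structure.eq_of_of_forall_ne (hD.parallel (deg a) Y _ hY (hF.isSmoothGr_grFrame a)
      (hF.isInDegree_grFrame a) x)
  have h2 : degOp deg (Pi.single a (1 : ℝ)) = (deg a : ℝ) • Pi.single a (1 : ℝ) := by
    ext b
    by_cases h : b = a
    · subst h; simp [degOp_apply]
    · simp [degOp_apply, h]
  change hF.connMat D Y x (degOp deg (Pi.single a 1)) = degOp deg (hF.connMat D Y x (Pi.single a 1))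
  rw [h2, map_smul, hF.connMat_single, h1, hF.degOp_ofGr_of]

/-- Differentiate the entries of the tensor: bracket compatibility gives the first component and
metric compatibility the second. This equation is the whole content of strong compatibility used
afterwards, besides commutation with the degree. -/
theorem mvfderiv_tensor (hreg : IsEquiregular S.E) (hD : D.IsStronglyCompatible) {x : M}
    (hx : x ∈ U) :
    mvfderiv (𝓡 n) hF.tensor x (Y x) = infAct (hF.tensor x) (hF.connMat D Y x) := by
  have hT : MDifferentiableAt (𝓡 n)
      𝓘(ℝ, (Fin n → ℝ) →L[ℝ] (Fin n → ℝ) →L[ℝ] (Fin n → ℝ) × ℝ) hF.tensor x :=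
    (hF.contMDiffAt_tensor hreg hx).mdifferentiableAt (by simp)
  refine clm_pi_ext fun a => clm_pi_ext fun b => ?_
  let ev : ((Fin n → ℝ) →L[ℝ] (Fin n → ℝ) →L[ℝ] (Fin n → ℝ) × ℝ) →L[ℝ] (Fin n → ℝ) × ℝ :=
    (ContinuousLinearMap.apply ℝ _ (Pi.single b 1)).comp
      (ContinuousLinearMap.apply ℝ _ (Pi.single a 1))
  have hev : ∀ T, ev T = T (Pi.single a 1) (Pi.single b 1) := fun T => rfl
  have hTab : ∀ z, hF.tensor z (Pi.single a 1) (Pi.single b 1) =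
      (hF.ofGr z (S.grBracket z (hF.grFrame a z) (hF.grFrame b z)),
        S.grInner z (hF.grFrame a z 1) (hF.grFrame b z 1)) := fun z => by
    rw [hF.tensor_apply hreg, hF.toGr_single, hF.toGr_single]
  have e1 := mvfderiv_clm_comp ((ContinuousLinearMap.fst ℝ (Fin n → ℝ) ℝ).comp ev) hT (Y x)
  have e2 := mvfderiv_clm_comp ((ContinuousLinearMap.snd ℝ (Fin n → ℝ) ℝ).comp ev) hT (Y x)
  simp only [ContinuousLinearMap.comp_apply, hev, hTab, ContinuousLinearMap.coe_fst',
    ContinuousLinearMap.coe_snd'] at e1 e2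
  have hab : S.IsSmoothGr fun z => S.grBracket z (hF.grFrame a z) (hF.grFrame b z) :=
    Structure.isSmoothGr_iff.2 fun x₀ => hF.smoothGrAt_grBracket_frame hreg a b x₀
  have h1 := hF.ofGr_nabla D hY hab hx
  rw [hD.bracket Y _ _ hY (hF.isSmoothGr_grFrame a) (hF.isSmoothGr_grFrame b), map_add, e1] at h1
  have h2 : mvfderiv (𝓡 n) (fun z => S.grInner z (hF.grFrame a z 1) (hF.grFrame b z 1)) x (Y x) =
      S.grInner x (D.nabla Y (hF.grFrame a) x 1) (hF.grFrame b x 1) +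
        S.grInner x (hF.grFrame a x 1) (D.nabla Y (hF.grFrame b) x 1) := by
    -- Metric compatibility is assumed in degree one only. If either frame section has another
    -- degree, its component in gr_{-1} and that of its derivative vanish, and both sides are zero.
    have hz : ∀ c, deg c ≠ 1 → (∀ z, hF.grFrame c z 1 = 0) ∧
        D.nabla Y (hF.grFrame c) x 1 = 0 := fun c hc =>
      ⟨fun z => hF.isInDegree_grFrame c z 1 hc.symm, hD.parallel (deg c) Y _ hY
        (hF.isSmoothGr_grFrame c) (hF.isInDegree_grFrame c) x 1 hc.symm⟩
    by_cases ha : deg a = 1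
    · by_cases hb : deg b = 1
      · exact hD.metric Y _ _ hY (hF.isSmoothGr_grFrame a) (hF.isSmoothGr_grFrame b)
          (ha ▸ hF.isInDegree_grFrame a) (hb ▸ hF.isInDegree_grFrame b) x
      · simp only [(hz b hb).1, (hz b hb).2, ← Structure.grInnerₗ_apply, map_zero, add_zero]
        rw [mvfderiv_const]
        rfl
    · simp only [(hz a ha).1, (hz a ha).2, ← Structure.grInnerₗ_apply, map_zero, add_zero,
        LinearMap.zero_apply]
      rw [mvfderiv_const]
      rfl
  rw [infAct_apply, hF.tensor_apply hreg x (hF.connMat D Y x _),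
    hF.tensor_apply hreg x _ (hF.connMat D Y x _), hTab, hF.connMat_single, hF.connMat_single,
    hF.toGr_single, hF.toGr_single, hF.toGr_ofGr hx, hF.toGr_ofGr hx]
  refine Prod.ext ?_ ?_
  · exact eq_sub_of_add_eq h1.symm
  · rw [← e2, h2]
    exact (sub_zero _).symm

end IsAdaptedFrame

end SubRiemannian
end

/-! ### Parallel transport and isometry of all fibers -/

noncomputable section

namespace SubRiemannian

open Set Filter

namespace IsAdaptedFrame

variable {n : ℕ} {M : Type*} [TopologicalSpace M] [ChartedSpace (EuclideanSpace ℝ (Fin n)) M]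
  [IsManifold (𝓡 n) ∞ M] [T2Space M] {S : Structure n M} {deg : Fin n → ℕ}
  {Z : Fin n → VField n M} {U : Set M} (hF : IsAdaptedFrame S deg Z U)

/-- Parallel transport along radial segments in a chart. -/
theorem eventually_exists_isIntertwiner (hreg : IsEquiregular S.E) {D : S.GrConnection}
    (hD : D.IsStronglyCompatible) {x₀ : M} (hx₀ : x₀ ∈ U) :
    ∀ᶠ y in 𝓝 x₀, ∃ h, IsIntertwiner (degOp deg) h (hF.tensor x₀) (hF.tensor y) := by
  -- Globally smooth fields that are the coordinate fields near `x₀`. The connection is then only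
  -- evaluated on these fields, and the matrix along a segment with velocity `v` is the combination
  -- Σ v_j G_j.
  obtain ⟨X, hX, hXw⟩ := exists_coordinate_fields (n := n) x₀
  let φ := extChartAt (𝓡 n) x₀
  let G : Fin n → M → (Fin n → ℝ) →L[ℝ] (Fin n → ℝ) := fun j => hF.connMat D (X j)
  have hGc : ∀ j, ∀ x ∈ U, ContinuousAt (G j) x := fun j x hx =>
    (hF.contMDiffAt_connMat D (hX j) hx).continuousAt
  let C : ℝ := ∑ j, ‖G j x₀‖ + 1
  have hC0 : 0 < C := by positivity
  have hGb : ∀ᶠ x in 𝓝 x₀, ∀ j, ‖G j x‖ ≤ C := by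
    refine eventually_all.2 fun j => ?_
    have hlt : ‖G j x₀‖ < C := lt_of_le_of_lt
      (Finset.single_le_sum (f := fun j => ‖G j x₀‖) (fun i _ => norm_nonneg _) (Finset.mem_univ j))
      (lt_add_one _)
    exact ((hGc j x₀ hx₀).norm.eventually (gt_mem_nhds hlt)).mono fun x hx => hx.le
  have hW : ∀ᶠ x in 𝓝 x₀, (x ∈ U ∧ x ∈ (chartAt (EuclideanSpace ℝ (Fin n)) x₀).source) ∧
      (∀ j, ‖G j x‖ ≤ C) ∧ ∀ w, coordVec x₀ x w = ∑ j, w j • X j x :=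
    ((hF.eventually_mem hx₀).and ((chartAt (EuclideanSpace ℝ (Fin n)) x₀).open_source.mem_nhds
      (mem_chart_source _ x₀))).and (hGb.and hXw)
  have hφ0 : φ.symm (φ x₀) = x₀ := extChartAt_to_inv x₀
  have hφs : Tendsto φ.symm (𝓝 (φ x₀)) (𝓝 x₀) := by
    have h : ContinuousAt φ.symm (φ x₀) := continuousAt_extChartAt_symm x₀
    rwa [ContinuousAt, hφ0] at h
  have hW' := (hφs.eventually hW).and (extChartAt_target_mem_nhds (I := 𝓡 n) x₀)
  obtain ⟨r, hr, hball⟩ := Metric.eventually_nhds_iff_ball.1 hW'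
  -- The radius makes the connection matrix along each segment have norm at most 1/2, as needed for
  -- transport up to time one. Using n + 1 instead of n keeps the denominator nonzero when n = 0.
  let r' := min r (1 / (2 * (n + 1) * C))
  have hr' : 0 < r' := by positivity
  have hcont : ContinuousAt φ x₀ := continuousAt_extChartAt x₀
  filter_upwards [hcont.eventually (Metric.ball_mem_nhds (φ x₀) hr'),
    extChartAt_source_mem_nhds (I := 𝓡 n) x₀] with y hy hys
  let v := φ y - φ x₀
  have hv : ‖v‖ < r' := by rwa [← dist_eq_norm]
  let p : ℝ → EuclideanSpace ℝ (Fin n) := fun t => φ x₀ + t • v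
  have hp : ∀ t ∈ Icc (0 : ℝ) 1, p t ∈ Metric.ball (φ x₀) r := fun t ht => by
    rw [mem_ball_iff_norm, add_sub_cancel_left, norm_smul, Real.norm_of_nonneg ht.1]
    calc t * ‖v‖ ≤ 1 * ‖v‖ := by gcongr; exact ht.2
      _ < r := by rw [one_mul]; exact hv.trans_le (min_le_left _ _)
  have hpd : ∀ t, HasDerivAt p v t := fun t => by
    have h := ((hasDerivAt_id t).smul_const v).const_add (φ x₀)
    rwa [one_smul] at h
  let γ : ℝ → M := fun t => φ.symm (p t)
  have hγ : ∀ t ∈ Icc (0 : ℝ) 1, φ (γ t) = p t := fun t ht => φ.right_inv (hball _ (hp t ht)).2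
  have hγc : ContinuousOn γ (Icc 0 1) := fun t ht =>
    ((continuousAt_extChartAt_symm'' (hball _ (hp t ht)).2).comp
      (hpd t).continuousAt).continuousWithinAt
  let A : ℝ → (Fin n → ℝ) →L[ℝ] (Fin n → ℝ) := fun t => ∑ j, v j • G j (γ t)
  have hAc : ContinuousOn A (Icc 0 1) := by
    refine continuousOn_finsetSum _ fun j _ => ContinuousOn.fun_const_smul (fun t ht => ?_) _
    exact ContinuousAt.comp_continuousWithinAt (f := γ) (hGc j (γ t) (hball _ (hp t ht)).1.1.1)
      (hγc t ht)
  have hAn : ∀ t ∈ Icc (0 : ℝ) 1, ‖A t‖ ≤ 1 / 2 := fun t ht => by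
    have hle : ∀ j, ‖v j • G j (γ t)‖ ≤ r' * C := fun j => by
      rw [norm_smul]
      exact mul_le_mul ((PiLp.norm_apply_le v j).trans hv.le) ((hball _ (hp t ht)).1.2.1 j)
        (norm_nonneg _) hr'.le
    calc ‖A t‖ ≤ ∑ j, ‖v j • G j (γ t)‖ := norm_sum_le _ _
      _ ≤ ∑ _j : Fin n, r' * C := Finset.sum_le_sum fun j _ => hle j
      _ = n * (r' * C) := by simp
      _ ≤ (n + 1) * (1 / (2 * (n + 1) * C) * C) := by
        gcongr
        · linarith
        · exact min_le_right _ _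
      _ = 1 / 2 := by field_simp
  have hAD : ∀ t ∈ Icc (0 : ℝ) 1, Commute (A t) (degOp deg) := fun t _ =>
    Commute.sum_left _ _ _ fun j _ =>
      (hF.commute_connMat D (hX j) hD.toIsCompatible (γ t)).smul_left (v j)
  have hT : ∀ t ∈ Icc (0 : ℝ) 1, HasDerivWithinAt (fun t => hF.tensor (γ t))
      (infAct (hF.tensor (γ t)) (A t)) (Icc 0 1) t := fun t ht => by
    obtain ⟨⟨⟨hU, hs⟩, -, hc⟩, -⟩ := hball _ (hp t ht)
    have h1 := hasFDerivAt_comp_chart_symm hs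
      ((hF.contMDiffAt_tensor hreg hU).mdifferentiableAt (by simp))
    change HasFDerivAt _ _ (φ (γ t)) at h1
    rw [hγ t ht] at h1
    have h2 := h1.comp_hasDerivAt t (hpd t)
    have h3 : ((mvfderiv (𝓡 n) hF.tensor (γ t)).comp (coordVec x₀ (γ t))) v =
        infAct (hF.tensor (γ t)) (A t) := by
      rw [ContinuousLinearMap.comp_apply, hc v, map_sum, ← infActₗ_apply, map_sum]
      refine Finset.sum_congr rfl fun j _ => ?_
      rw [map_smul, map_smul, hF.mvfderiv_tensor D (hX j) hreg hD hU, infActₗ_apply]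
    exact (h3 ▸ h2).hasDerivWithinAt
  obtain ⟨h, h0, hh⟩ := exists_transport hAc hAn
  have hfin := isIntertwiner_of_transport hAc hAD hT hh h0
  have e0 : γ 0 = x₀ := by simp only [γ, p, zero_smul, add_zero, hφ0]
  have e1 : γ 1 = y := by
    simp only [γ, p, one_smul, v, add_sub_cancel]
    exact φ.left_inv hys
  simp only [e0, e1] at hfin
  exact ⟨h 1, hfin⟩

theorem eventually_nonempty_grIso (hF : IsAdaptedFrame S deg Z U) (hreg : IsEquiregular S.E)
    {D : S.GrConnection} (hD : D.IsStronglyCompatible) {x₀ : M} (hx₀ : x₀ ∈ U) :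
    ∀ᶠ y in 𝓝 x₀, Nonempty (Structure.GrIso S x₀ y) ∧ Nonempty (Structure.GrIso S y x₀) := by
  filter_upwards [hF.eventually_exists_isIntertwiner hreg hD hx₀, hF.eventually_mem hx₀]
    with y ⟨h, hh⟩ hy
  obtain ⟨k, hkh, hhk⟩ := hh.exists_inverse (hF.posOn hreg hx₀) (hF.genBy hreg hy)
  exact ⟨hF.nonempty_grIso_of_isIntertwiner hreg hx₀ hy hh hkh hhk,
    hF.nonempty_grIso_of_isIntertwiner hreg hy hx₀ (hh.inverse hkh hhk) hhk hkh⟩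

end IsAdaptedFrame

namespace Structure

variable {n : ℕ} {M : Type*} [TopologicalSpace M] [ChartedSpace (EuclideanSpace ℝ (Fin n)) M]
  [IsManifold (𝓡 n) ∞ M] [T2Space M] {S : Structure n M}

/-- Being isometric is transitive and holds, in both directions, between each point and its
neighbors; on a connected space it then holds for all pairs. Short radial segments suffice. -/
theorem nonempty_grIso_of_isStronglyCompatible [PreconnectedSpace M]
    (hgen : IsBracketGenerating S.E) (hreg : IsEquiregular S.E) {D : S.GrConnection}
    (hD : D.IsStronglyCompatible) (x y : M) : Nonempty (GrIso S x y) := by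
  refine PreconnectedSpace.induction₂' (fun x y => Nonempty (GrIso S x y)) (fun x => ?_)
    ⟨fun _ _ _ ⟨φ⟩ ⟨ψ⟩ => ⟨φ.trans ψ⟩⟩ x y
  obtain ⟨deg, Z, U, hx, hF⟩ := exists_isAdaptedFrame S hgen hreg x
  exact hF.eventually_nonempty_grIso hreg hD hx

end Structure

end SubRiemannian
end

/-! ### Fibers of gr as Carnot algebras; reformulation of constant symbol -/

noncomputable section

namespace SubRiemannian

open Set Filter

namespace Structure

variable {n : ℕ} {M : Type*} [TopologicalSpace M] [ChartedSpace (EuclideanSpace ℝ (Fin n)) M]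
  [IsManifold (𝓡 n) ∞ M] [T2Space M] {S : Structure n M}

omit [T2Space M] in
theorem subsingleton_grPiece {x : M} {k : ℕ} (h : flag S.E k x ≤ flag S.E (k - 1) x) :
    Subsingleton (S.GrPiece x k) := by
  refine subsingleton_of_forall_eq 0 fun a => ?_
  obtain ⟨⟨v, hv⟩, rfl⟩ := Submodule.Quotient.mk_surjective _ a
  exact (S.grMk_eq_zero_iff hv).2 (h hv)

instance (x : M) : Subsingleton (S.GrPiece x 0) := subsingleton_grPiece le_rfl

/-- The subspace `gr_{x,-k}` of `gr_x`. -/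
def grLayer (S : Structure n M) (x : M) (k : ℕ) : Submodule ℝ (S.Gr x) :=
  LinearMap.range (DirectSum.lof ℝ ℕ (S.GrPiece x) k)

omit [T2Space M] in
theorem mem_grLayer {x : M} {k : ℕ} {a : S.Gr x} :
    a ∈ grLayer S x k ↔ ∃ u, DirectSum.of (S.GrPiece x) k u = a := Iff.rfl

omit [T2Space M] in
theorem grLayer_eq_bot {x : M} {k : ℕ} [Subsingleton (S.GrPiece x k)] : grLayer S x k = ⊥ := by
  rw [eq_bot_iff]
  rintro _ ⟨u, rfl⟩
  rw [Subsingleton.elim u 0, map_zero]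
  exact Submodule.zero_mem _

theorem grBracket_mem_grLayer (hreg : IsEquiregular S.E) {x : M} {i j : ℕ} {a b : S.Gr x}
    (ha : a ∈ grLayer S x i) (hb : b ∈ grLayer S x j) :
    S.grBracket x a b ∈ grLayer S x (i + j) := by
  obtain ⟨u, rfl⟩ := mem_grLayer.1 ha
  obtain ⟨v, rfl⟩ := mem_grLayer.1 hb
  rw [grBracket_eq hreg, grBracketₗ_of_of]
  exact ⟨_, rfl⟩

omit [T2Space M] in
theorem isInternal_grLayer (x : M) : DirectSum.IsInternal (grLayer S x) := by
  let e : S.Gr x ≃ₗ[ℝ] ⨁ k, grLayer S x k := DFinsupp.mapRange.linearEquiv fun k =>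
    LinearEquiv.ofInjective (DirectSum.lof ℝ ℕ (S.GrPiece x) k) (DirectSum.of_injective k)
  have he : ∀ a, DirectSum.coeLinearMap (grLayer S x) (e a) = a := fun a => by
    induction a using DirectSum.induction_on with
    | zero => rw [map_zero, map_zero]
    | add a b ha hb => rw [map_add, map_add, ha, hb]
    | of k a =>
      have h1 : e (DirectSum.of (S.GrPiece x) k a) =
          DirectSum.of (fun k => grLayer S x k) k ⟨DirectSum.lof ℝ ℕ (S.GrPiece x) k a, a, rfl⟩ :=
        DFinsupp.mapRange_single (hf := fun _ => map_zero _)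
      rw [h1]
      exact DirectSum.coeLinearMap_of _ _ _
  have h2 : ⇑(DirectSum.coeAddMonoidHom (grLayer S x)) = e.symm := by
    funext b
    rw [← e.symm_apply_apply (DirectSum.coeAddMonoidHom (grLayer S x) b)]
    congr 1
    obtain ⟨a, rfl⟩ := e.surjective b
    exact congrArg e (he a)
  rw [DirectSum.IsInternal, h2]
  exact e.symm.bijective

theorem span_grBracket (hreg : IsEquiregular S.E) (x : M) {k : ℕ} (hk : 1 ≤ k) :
    Submodule.span ℝ {c | ∃ a ∈ grLayer S x 1, ∃ b ∈ grLayer S x k, S.grBracket x a b = c} =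
      grLayer S x (k + 1) := by
  refine le_antisymm (Submodule.span_le.2 ?_) ?_
  · rintro _ ⟨a, ha, b, hb, rfl⟩
    exact add_comm 1 k ▸ grBracket_mem_grLayer hreg ha hb
  · rintro _ ⟨a, rfl⟩
    refine Submodule.span_mono ?_ (of_succ_mem_span hreg x hk a)
    rintro _ ⟨u, v, rfl⟩
    exact ⟨_, ⟨u, rfl⟩, _, ⟨v, rfl⟩, rfl⟩

/-- The inner product of `gr_{x,-1}`, as a subspace of `gr_x`. -/
def grLayerInner (S : Structure n M) (x : M) : grLayer S x 1 →ₗ[ℝ] grLayer S x 1 →ₗ[ℝ] ℝ :=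
  (grInnerₗ S x).compl₁₂
    (DirectSum.component ℝ ℕ (S.GrPiece x) 1 ∘ₗ (grLayer S x 1).subtype)
    (DirectSum.component ℝ ℕ (S.GrPiece x) 1 ∘ₗ (grLayer S x 1).subtype)

theorem grLayerInner_pos (x : M) (a : grLayer S x 1) (ha : a ≠ 0) : 0 < grLayerInner S x a a := by
  obtain ⟨_, u, rfl⟩ := a
  refine grInner_pos x fun h => ha ?_
  have h' : u = 0 := (DirectSum.of_eq_same 1 u).symm.trans h
  subst h'
  exact Subtype.ext (map_zero _)

/-- The Lie ring structure of `gr_x`. -/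
abbrev grLieRing (hreg : IsEquiregular S.E) (x : M) : LieRing (S.Gr x) :=
  { (inferInstance : AddCommGroup (S.Gr x)) with
    bracket := S.grBracket x
    add_lie := grBracket_add_left hreg x
    lie_add := grBracket_add_right hreg x
    lie_self := fun a => by
      have h := grBracket_swap hreg x a a
      have key : ∀ {G : Type} [AddCommGroup G] [Module ℝ G] (a : G), a = -a → a = 0 :=
        fun a h => by
          have h2 : (2 : ℝ) • a = 0 := by
            rw [two_smul]
            nth_rw 1 [h]
            exact neg_add_cancel a
          exact (smul_eq_zero.1 h2).resolve_left two_ne_zero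
      exact key _ h
    leibniz_lie := grBracket_jacobi hreg x }

/-- The Lie algebra structure of `gr_x`. -/
abbrev grLieAlgebra (hreg : IsEquiregular S.E) (x : M) :
    @LieAlgebra ℝ (S.Gr x) _ (grLieRing hreg x) :=
  @LieAlgebra.mk ℝ (S.Gr x) _ (grLieRing hreg x) (inferInstance : Module ℝ (S.Gr x))
    fun c a b => grBracket_smul_right hreg x c a b

/-- The Carnot algebra `gr_x`. -/
def grCarnotAlgebra (hgen : IsBracketGenerating S.E) (hreg : IsEquiregular S.E) (x : M) :
    CarnotAlgebra where
  carrier := S.Gr x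
  lieRing := grLieRing hreg x
  lieAlgebra := grLieAlgebra hreg x
  finiteDimensional := by
    obtain ⟨deg, Z, U, hx, hF⟩ := exists_isAdaptedFrame S hgen hreg x
    exact Module.Finite.equiv (hF.equivGr hx)
  -- Any level at which the flag is the full tangent space works; minimality is not part of the
  -- structure.
  step := (exists_flag_eq_top hgen x).choose
  layer := grLayer S x
  layer_zero := grLayer_eq_bot
  layer_of_step_lt k hk := by
    have h := (exists_flag_eq_top hgen x).choose_spec
    have : Subsingleton (S.GrPiece x k) := subsingleton_grPiece
      ((le_top.trans h.ge).trans (flag_mono S.E (by omega) x))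
    exact grLayer_eq_bot
  isInternal := isInternal_grLayer x
  lie_mem _ _ _ ha _ hb := grBracket_mem_grLayer hreg ha hb
  span_lie _ hk := span_grBracket hreg x hk
  inner := grLayerInner S x
  inner_symm _ _ := grInner_symm x _ _
  inner_pos := grLayerInner_pos x

-- A map sending homogeneous elements to homogeneous elements of the same degree commutes with the
-- projections to the graded pieces.
omit [T2Space M] in
theorem apply_eq_apply_of {x y : M} (χ : S.Gr x ≃ₗ[ℝ] S.Gr y)
    (h : ∀ k a, ∃ b, χ (DirectSum.of _ k a) = DirectSum.of (S.GrPiece y) k b) (A : S.Gr x) (k : ℕ) :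
    χ A k = χ (DirectSum.of _ k (A k)) k := by
  induction A using DirectSum.induction_on with
  | zero => rw [map_zero, DirectSum.zero_apply, DirectSum.zero_apply, map_zero, map_zero,
      DirectSum.zero_apply]
  | add A B hA hB =>
    rw [map_add, DirectSum.add_apply, DirectSum.add_apply, map_add, map_add, DirectSum.add_apply,
      hA, hB]
  | of m a =>
    by_cases hm : k = m
    · subst hm
      rw [DirectSum.of_eq_same]
    · obtain ⟨b, hb⟩ := h m a
      rw [hb, DirectSum.of_eq_of_ne _ _ _ hm, DirectSum.of_eq_of_ne _ _ _ hm, map_zero, map_zero,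
        DirectSum.zero_apply]

theorem GrIso.isIsometry (hgen : IsBracketGenerating S.E) (hreg : IsEquiregular S.E) {x y : M}
    (φ : GrIso S x y) : S.IsIsometry (grCarnotAlgebra hgen hreg x) y φ.toEquiv where
  map_lie := φ.map_bracket
  map_layer := by
    refine le_antisymm ?_ ?_
    · rintro _ ⟨_, ⟨u, rfl⟩, rfl⟩
      obtain ⟨b, hb⟩ := φ.map_of 1 u
      exact ⟨b, hb.symm⟩
    · rintro _ ⟨b, rfl⟩
      let A := φ.toEquiv.symm (DirectSum.of _ 1 b)
      refine ⟨DirectSum.of _ 1 (A 1), ⟨_, rfl⟩, ?_⟩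
      obtain ⟨c, hc⟩ := φ.map_of 1 (A 1)
      have h1 := apply_eq_apply_of φ.toEquiv φ.map_of A 1
      rw [hc, DirectSum.of_eq_same, show φ.toEquiv A = DirectSum.of _ 1 b from
        φ.toEquiv.apply_symm_apply _, DirectSum.of_eq_same] at h1
      subst h1
      exact hc
  map_inner a b := φ.map_inner a.1 b.1

theorem hasConstantSymbol_of_isStronglyCompatible [ConnectedSpace M]
    (hgen : IsBracketGenerating S.E) (hreg : IsEquiregular S.E) {D : S.GrConnection}
    (hD : D.IsStronglyCompatible) : S.HasConstantSymbol := by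
  obtain ⟨x₀⟩ := (inferInstance : Nonempty M)
  refine ⟨grCarnotAlgebra hgen hreg x₀, fun x => ?_⟩
  obtain ⟨φ⟩ := nonempty_grIso_of_isStronglyCompatible hgen hreg hD x₀ x
  exact ⟨φ.toEquiv, φ.isIsometry hgen hreg⟩

/-- Compose one isometry with the inverse of the other. An isometry is only required to preserve
degree -1; preservation of the other degrees follows by induction, since each piece is spanned by
brackets with gr_{-1}. -/
theorem HasConstantSymbol.nonempty_grIso (hreg : IsEquiregular S.E) (h : S.HasConstantSymbol)
    (x y : M) : Nonempty (GrIso S x y) := by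
  obtain ⟨𝔤, h⟩ := h
  obtain ⟨φ, hφ⟩ := h x
  obtain ⟨ψ, hψ⟩ := h y
  let χ : S.Gr x ≃ₗ[ℝ] S.Gr y := φ.symm.trans ψ
  have hχ : ∀ a, χ (φ a) = ψ a := fun a => congrArg ψ (φ.symm_apply_apply a)
  have hbr : ∀ a b, χ (S.grBracket x a b) = S.grBracket y (χ a) (χ b) := fun a b => by
    obtain ⟨a, rfl⟩ := φ.surjective a
    obtain ⟨b, rfl⟩ := φ.surjective b
    rw [← hφ.map_lie, hχ, hχ, hχ, hψ.map_lie]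
  have hone : ∀ u : S.GrPiece x 1, ∃ a ∈ 𝔤.layer 1, φ a = DirectSum.of _ 1 u := fun u => by
    have : DirectSum.of (S.GrPiece x) 1 u ∈ (𝔤.layer 1).map φ.toLinearMap :=
      hφ.map_layer ▸ ⟨u, rfl⟩
    exact this
  have hof : ∀ k a, ∃ b, χ (DirectSum.of _ k a) = DirectSum.of (S.GrPiece y) k b := by
    intro k
    induction k with
    | zero =>
      intro a
      rw [Subsingleton.elim a 0, map_zero, map_zero]
      exact ⟨0, (map_zero _).symm⟩
    | succ k ih =>
      have h1 : ∀ u : S.GrPiece x 1, χ (DirectSum.of _ 1 u) ∈ grLayer S y 1 := fun u => by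
        obtain ⟨a, ha, he⟩ := hone u
        rw [← he, hχ]
        exact hψ.map_layer.le ⟨a, ha, rfl⟩
      intro a
      rcases Nat.eq_zero_or_pos k with rfl | hk
      · obtain ⟨b, hb⟩ := h1 a
        exact ⟨b, hb.symm⟩
      · have hle : Submodule.span ℝ {c | ∃ (u : S.GrPiece x 1) (v : S.GrPiece x k),
            S.grBracket x (DirectSum.of _ 1 u) (DirectSum.of _ k v) = c} ≤
            (grLayer S y (k + 1)).comap χ.toLinearMap := by
          rw [Submodule.span_le]
          rintro _ ⟨u, v, rfl⟩
          obtain ⟨w, hw⟩ := ih v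
          have := grBracket_mem_grLayer hreg (h1 u)
            (⟨w, hw.symm⟩ : χ (DirectSum.of _ k v) ∈ grLayer S y k)
          rw [← hbr, add_comm] at this
          exact this
        obtain ⟨b, hb⟩ := hle (of_succ_mem_span hreg x hk a)
        exact ⟨b, hb.symm⟩
  refine ⟨⟨χ, hbr, hof, fun a b => ?_⟩⟩
  rw [apply_eq_apply_of χ hof a, apply_eq_apply_of χ hof b]
  obtain ⟨a', ha', hea⟩ := hone (a 1)
  obtain ⟨b', hb', heb⟩ := hone (b 1)
  have h1 := hφ.map_inner ⟨a', ha'⟩ ⟨b', hb'⟩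
  have h2 := hψ.map_inner ⟨a', ha'⟩ ⟨b', hb'⟩
  simp only [hea, heb, DirectSum.of_eq_same] at h1
  rw [← hea, ← heb, hχ, hχ, h2, h1]

end Structure

end SubRiemannian
end

/-! ### Local connections from matrix-valued forms -/

noncomputable section

namespace SubRiemannian

open Set Filter

section Calculus

variable {n : ℕ} {M : Type*} [TopologicalSpace M] [ChartedSpace (EuclideanSpace ℝ (Fin n)) M]
  [IsManifold (𝓡 n) ∞ M]

theorem exists_coordVec_eq {x : M} (v : TangentSpace (𝓡 n) x) :
    ∃ w, coordVec x x w = v :=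
  ⟨_, Bundle.Trivialization.symmL_continuousLinearMapAt (R := ℝ) _
    (FiberBundle.mem_baseSet_trivializationAt' x) v⟩

theorem mvfderiv_clm_apply₂ {E F G : Type*} [NormedAddCommGroup E] [NormedSpace ℝ E]
    [NormedAddCommGroup F] [NormedSpace ℝ F] [NormedAddCommGroup G] [NormedSpace ℝ G]
    {T : M → E →L[ℝ] F →L[ℝ] G} {a : M → E} {b : M → F} {x : M}
    (hT : MDifferentiableAt (𝓡 n) 𝓘(ℝ, E →L[ℝ] F →L[ℝ] G) T x)
    (ha : MDifferentiableAt (𝓡 n) 𝓘(ℝ, E) a x) (hb : MDifferentiableAt (𝓡 n) 𝓘(ℝ, F) b x)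
    (v : TangentSpace (𝓡 n) x) :
    mvfderiv (𝓡 n) (fun z => T z (a z) (b z)) x v = mvfderiv (𝓡 n) T x v (a x) (b x) +
      T x (mvfderiv (𝓡 n) a x v) (b x) + T x (a x) (mvfderiv (𝓡 n) b x v) := by
  obtain ⟨w, rfl⟩ := exists_coordVec_eq v
  have hx := mem_chart_source (EuclideanSpace ℝ (Fin n)) x
  have hTab : MDifferentiableAt (𝓡 n) 𝓘(ℝ, G) (fun z => T z (a z) (b z)) x :=
    (hT.clm_apply ha).clm_apply hb
  have h0 := hasFDerivAt_comp_chart_symm hx hTab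
  have h1 := hasFDerivAt_comp_chart_symm hx hT
  have h2 := hasFDerivAt_comp_chart_symm hx ha
  have h3 := hasFDerivAt_comp_chart_symm hx hb
  have h4 := DFunLike.congr_fun (h0.unique ((h1.clm_apply h2).clm_apply h3)) w
  simp only [ContinuousLinearMap.comp_apply, Function.comp_apply, extChartAt_to_inv] at h4
  rw [h4]
  simp
  abel

end Calculus

namespace Structure

variable {n : ℕ} {M : Type*} [TopologicalSpace M] [ChartedSpace (EuclideanSpace ℝ (Fin n)) M]
  [IsManifold (𝓡 n) ∞ M] [T2Space M]

/-- The operator `N` has the properties of a strongly compatible connection over `W`. -/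
structure IsLocalConnection (S : Structure n M) (W : Set M)
    (N : VField n M → (∀ x, S.Gr x) → ∀ x, S.Gr x) : Prop where
  smooth : ∀ Y A, IsSmooth Y → S.IsSmoothGr A → ∀ x ∈ W, SmoothGrAt (N Y A) x
  add_left : ∀ Y Y' A x, N (fun z => Y z + Y' z) A x = N Y A x + N Y' A x
  smul_left : ∀ (f : M → ℝ) Y A x, N (fun z => f z • Y z) A x = f x • N Y A x
  add_right : ∀ Y A B, S.IsSmoothGr A → S.IsSmoothGr B →
    ∀ x ∈ W, N Y (fun z => A z + B z) x = N Y A x + N Y B x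
  leibniz : ∀ (f : M → ℝ) Y A, ContMDiff (𝓡 n) 𝓘(ℝ, ℝ) ∞ f → S.IsSmoothGr A →
    ∀ x ∈ W, N Y (fun z => f z • A z) x = mvfderiv (𝓡 n) f x (Y x) • A x + f x • N Y A x
  parallel : ∀ k Y A, S.IsSmoothGr A → IsInDegree k A → ∀ x ∈ W, ∀ m, m ≠ k → N Y A x m = 0
  metric : ∀ Y A B, S.IsSmoothGr A → S.IsSmoothGr B → ∀ x ∈ W,
    mvfderiv (𝓡 n) (fun z => S.grInner z (A z 1) (B z 1)) x (Y x) =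
      S.grInner x (N Y A x 1) (B x 1) + S.grInner x (A x 1) (N Y B x 1)
  bracket : ∀ Y A B, S.IsSmoothGr A → S.IsSmoothGr B → ∀ x ∈ W,
    N Y (fun z => S.grBracket z (A z) (B z)) x =
      S.grBracket x (N Y A x) (B x) + S.grBracket x (A x) (N Y B x)

end Structure

namespace IsAdaptedFrame

variable {n : ℕ} {M : Type*} [TopologicalSpace M] [ChartedSpace (EuclideanSpace ℝ (Fin n)) M]
  [IsManifold (𝓡 n) ∞ M] [T2Space M] {S : Structure n M} {deg : Fin n → ℕ}
  {Z : Fin n → VField n M} {U : Set M} (hF : IsAdaptedFrame S deg Z U)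

/-- The connection with matrix `Γ` in the frame. -/
def frameNabla (Γ : ∀ x : M, TangentSpace (𝓡 n) x →ₗ[ℝ] ((Fin n → ℝ) →L[ℝ] (Fin n → ℝ)))
    (Y : VField n M) (A : ∀ x, S.Gr x) (x : M) : S.Gr x :=
  hF.toGr x (mvfderiv (𝓡 n) (fun z => hF.ofGr z (A z)) x (Y x) + Γ x (Y x) (hF.ofGr x (A x)))

/-- The converse of `mvfderiv_tensor` and `commute_connMat`: a smooth matrix solving `infAct` T Γ =
dT and commuting with the degree operator defines a strongly compatible connection over `W`. -/
theorem isLocalConnection_frameNabla (hreg : IsEquiregular S.E) {W : Set M} (hW : IsOpen W)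
    (hWU : W ⊆ U) {Γ : ∀ x : M, TangentSpace (𝓡 n) x →ₗ[ℝ] ((Fin n → ℝ) →L[ℝ] (Fin n → ℝ))}
    (hΓ : ∀ Y, IsSmooth Y → ∀ x ∈ W,
      ContMDiffAt (𝓡 n) 𝓘(ℝ, (Fin n → ℝ) →L[ℝ] (Fin n → ℝ)) ∞ (fun z => Γ z (Y z)) x)
    (hcomm : ∀ x ∈ W, ∀ v, Commute (Γ x v) (degOp deg))
    (hinf : ∀ x ∈ W, ∀ v, infAct (hF.tensor x) (Γ x v) = mvfderiv (𝓡 n) hF.tensor x v) :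
    Structure.IsLocalConnection S W (hF.frameNabla Γ) := by
  have hWe : ∀ x ∈ W, ∀ᶠ z in 𝓝 x, z ∈ W := fun x hx => hW.mem_nhds hx
  have hc : ∀ {A : ∀ x, S.Gr x}, S.IsSmoothGr A → ∀ x ∈ W,
      ContMDiffAt (𝓡 n) 𝓘(ℝ, Fin n → ℝ) ∞ (fun z => hF.ofGr z (A z)) x := fun hA x hx =>
    hF.contMDiffAt_ofGr (hWU hx) (Structure.isSmoothGr_iff.1 hA x)
  have hd : ∀ {A : ∀ x, S.Gr x}, S.IsSmoothGr A → ∀ x ∈ W,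
      MDifferentiableAt (𝓡 n) 𝓘(ℝ, Fin n → ℝ) (fun z => hF.ofGr z (A z)) x := fun hA x hx =>
    (hc hA x hx).mdifferentiableAt (by simp)
  have hof : ∀ Y A, ∀ x ∈ W, hF.ofGr x (hF.frameNabla Γ Y A x) =
      mvfderiv (𝓡 n) (fun z => hF.ofGr z (A z)) x (Y x) + Γ x (Y x) (hF.ofGr x (A x)) :=
    fun Y A x hx => hF.ofGr_toGr (hWU hx) _
  have htens : ∀ x ∈ W, ∀ A B : S.Gr x, hF.tensor x (hF.ofGr x A) (hF.ofGr x B) =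
      (hF.ofGr x (S.grBracket x A B), S.grInner x (A 1) (B 1)) := fun x hx A B => by
    rw [hF.tensor_apply hreg, hF.toGr_ofGr (hWU hx), hF.toGr_ofGr (hWU hx)]
  have hdT : ∀ x ∈ W, MDifferentiableAt (𝓡 n)
      𝓘(ℝ, (Fin n → ℝ) →L[ℝ] (Fin n → ℝ) →L[ℝ] (Fin n → ℝ) × ℝ) hF.tensor x := fun x hx =>
    (hF.contMDiffAt_tensor hreg (hWU hx)).mdifferentiableAt (by simp)
  -- Product rule with dT replaced by the infinitesimal action: the slot terms combine with the
  -- derivatives of `A` and `B` into covariant derivatives. The leftover term acts on the bracket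
  -- only, so the two components give the bracket and metric rules.
  have hprod : ∀ Y A B, S.IsSmoothGr A → S.IsSmoothGr B → ∀ x ∈ W,
      mvfderiv (𝓡 n) (fun z => hF.tensor z (hF.ofGr z (A z)) (hF.ofGr z (B z))) x (Y x) =
      hF.tensor x (hF.ofGr x (hF.frameNabla Γ Y A x)) (hF.ofGr x (B x)) +
      hF.tensor x (hF.ofGr x (A x)) (hF.ofGr x (hF.frameNabla Γ Y B x)) -
      (Γ x (Y x) (hF.tensor x (hF.ofGr x (A x)) (hF.ofGr x (B x))).1, 0) :=
    fun Y A B hA hB x hx => by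
      rw [mvfderiv_clm_apply₂ (hdT x hx) (hd hA x hx) (hd hB x hx), ← hinf x hx, infAct_apply,
        hof Y A x hx, hof Y B x hx, map_add, map_add, add_apply]
      abel
  have hdTab : ∀ {A B : ∀ x, S.Gr x}, S.IsSmoothGr A → S.IsSmoothGr B → ∀ x ∈ W,
      MDifferentiableAt (𝓡 n) 𝓘(ℝ, (Fin n → ℝ) × ℝ)
        (fun z => hF.tensor z (hF.ofGr z (A z)) (hF.ofGr z (B z))) x := fun hA hB x hx =>
    ((hdT x hx).clm_apply (hd hA x hx)).clm_apply (hd hB x hx)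
  have hev : ∀ A B : ∀ x, S.Gr x, ∀ x ∈ W, ∀ᶠ z in 𝓝 x,
      hF.tensor z (hF.ofGr z (A z)) (hF.ofGr z (B z)) =
        (hF.ofGr z (S.grBracket z (A z) (B z)), S.grInner z (A z 1) (B z 1)) :=
    fun A B x hx => (hWe x hx).mono fun z hz => htens z hz _ _
  refine ⟨fun Y A hY hA x hx => ?_, fun Y Y' A x => ?_, fun f Y A x => ?_,
    fun Y A B hA hB x hx => ?_, fun f Y A hf hA x hx => ?_, fun k Y A hA hk x hx m hm => ?_,
    fun Y A B hA hB x hx => ?_, fun Y A B hA hB x hx => ?_⟩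
  · refine hF.smoothGrAt_toGr ((hWe x hx).mono fun z hz => ?_)
    exact (contMDiffAt_mvfderiv_apply (hc hA z hz) hY).add ((hΓ Y hY z hz).clm_apply (hc hA z hz))
  · simp only [frameNabla, map_add, add_apply]
    exact add_add_add_comm _ _ _ _
  · simp only [frameNabla, map_smul, smul_apply, map_add]
    exact (smul_add _ _ _).symm
  · have h : mvfderiv (𝓡 n) (fun z => hF.ofGr z (A z) + hF.ofGr z (B z)) x (Y x) = _ :=
      DFunLike.congr_fun (mvfderiv_add (hd hA x hx) (hd hB x hx)) (Y x)
    simp only [frameNabla, map_add, h, add_apply]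
    exact add_add_add_comm _ _ _ _
  · have h : mvfderiv (𝓡 n) (fun z => f z • hF.ofGr z (A z)) x (Y x) = _ :=
      DFunLike.congr_fun (mvfderiv_smul ((hf x).mdifferentiableAt (by simp)) (hd hA x hx)) (Y x)
    have h2 : ∀ (c : ℝ) (w w' : Fin n → ℝ), hF.toGr x (f x • w + c • hF.ofGr x (A x) + f x • w') =
        c • A x + f x • hF.toGr x (w + w') := fun c w w' => by
      have h3 : c • A x = hF.toGr x (c • hF.ofGr x (A x)) := by
        rw [map_smul, hF.toGr_ofGr (hWU hx)]
      rw [h3, ← map_smul (hF.toGr x) (f x), ← map_add (hF.toGr x)]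
      congr 1
      rw [smul_add]
      abel
    simp only [frameNabla, map_smul, h]
    exact h2 _ _ _
  · have h1 : ∀ z, degOp deg (hF.ofGr z (A z)) = (k : ℝ) • hF.ofGr z (A z) := fun z => by
      rw [Structure.eq_of_of_forall_ne (hk z), hF.degOp_ofGr_of]
    have h2 : degOp deg (mvfderiv (𝓡 n) (fun z => hF.ofGr z (A z)) x (Y x)) =
        (k : ℝ) • mvfderiv (𝓡 n) (fun z => hF.ofGr z (A z)) x (Y x) := by
      rw [← mvfderiv_clm_comp (degOp deg) (hd hA x hx)]
      simp only [h1]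
      exact mvfderiv_clm_comp ((k : ℝ) • ContinuousLinearMap.id ℝ (Fin n → ℝ)) (hd hA x hx) (Y x)
    have h3 : degOp deg (Γ x (Y x) (hF.ofGr x (A x))) = (k : ℝ) • Γ x (Y x) (hF.ofGr x (A x)) := by
      rw [← map_smul, ← h1]
      exact (DFunLike.congr_fun (hcomm x hx (Y x)) (hF.ofGr x (A x))).symm
    rw [frameNabla, hF.toGr_eq_of x (k := k) (by rw [map_add, h2, h3, smul_add])]
    exact DirectSum.of_eq_of_ne _ _ _ hm
  · have h1 := mvfderiv_clm_comp (ContinuousLinearMap.snd ℝ (Fin n → ℝ) ℝ) (hdTab hA hB x hx) (Y x)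
    rw [hprod Y A B hA hB x hx, htens x hx, htens x hx, mvfderiv_congr
      (g := fun z => S.grInner z (A z 1) (B z 1)) ((hev A B x hx).mono fun z hz => by rw [hz]; rfl)]
      at h1
    rw [h1]
    exact sub_zero _
  · have h1 := mvfderiv_clm_comp (ContinuousLinearMap.fst ℝ (Fin n → ℝ) ℝ) (hdTab hA hB x hx) (Y x)
    rw [hprod Y A B hA hB x hx, htens x hx, htens x hx, htens x hx, mvfderiv_congr
      (g := fun z => hF.ofGr z (S.grBracket z (A z) (B z)))
      ((hev A B x hx).mono fun z hz => by rw [hz]; rfl)] at h1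
    rw [frameNabla, h1, ← hF.toGr_ofGr (hWU hx) (S.grBracket x (hF.frameNabla Γ Y A x) (B x) +
      S.grBracket x (A x) (hF.frameNabla Γ Y B x)), map_add (hF.ofGr x)]
    congr 1
    exact sub_add_cancel _ _

end IsAdaptedFrame

end SubRiemannian
end

/-! ### Constant symbol gives a strongly compatible connection -/

noncomputable section

namespace SubRiemannian

open Set Filter

/-- A smooth generalized inverse of a family of constant rank that depends linearly on a
parameter. -/
theorem exists_smooth_generalized_inverse_of_linear {n : ℕ} {M : Type*} [TopologicalSpace M]
    [ChartedSpace (EuclideanSpace ℝ (Fin n)) M] {P Q R : Type*} [NormedAddCommGroup P]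
    [NormedSpace ℝ P] [FiniteDimensional ℝ P] [NormedAddCommGroup Q] [NormedSpace ℝ Q]
    [FiniteDimensional ℝ Q] [NormedAddCommGroup R] [NormedSpace ℝ R] [FiniteDimensional ℝ R]
    (Λ : R →ₗ[ℝ] P →ₗ[ℝ] Q) {f : M → R} {L : M → P →ₗ[ℝ] Q} (hL : ∀ x, L x = Λ (f x)) {x₀ : M}
    (hf : ∀ᶠ x in 𝓝 x₀, ContMDiffAt (𝓡 n) 𝓘(ℝ, R) ∞ f x)
    (hker : ∀ᶠ x in 𝓝 x₀, ∃ c : P ≃ₗ[ℝ] P, ∀ p, L x (c p) = 0 ↔ L x₀ p = 0) :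
    ∃ G : M → Q →ₗ[ℝ] P, ∀ᶠ x in 𝓝 x₀,
      (∀ B : M → Q, ContMDiffAt (𝓡 n) 𝓘(ℝ, Q) ∞ B x →
        ContMDiffAt (𝓡 n) 𝓘(ℝ, P) ∞ (fun z => G z (B z)) x) ∧
      ∀ p, L x (G x (L x p)) = L x p := by
  let Λ' : R →L[ℝ] P →L[ℝ] Q :=
    LinearMap.toContinuousLinearMap (LinearMap.toContinuousLinearMap.toLinearMap ∘ₗ Λ)
  have hΛ' : ∀ x, (Λ' (f x) : P →ₗ[ℝ] Q) = L x := fun x => (hL x).symm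
  obtain ⟨G, hG⟩ := exists_smooth_generalized_inverse (L := fun x => Λ' (f x))
    (hf.mono fun x hx => Λ'.contDiff.contMDiff.contMDiffAt.comp x hx)
    (hker.mono fun x ⟨c, hc⟩ => by
      -- The bijection `c` matches the kernels, so rank–nullity makes the rank constant.
      have hx : Module.finrank ℝ (LinearMap.ker (L x₀)) = Module.finrank ℝ (LinearMap.ker (L x)) :=
        (c.ofSubmodules _ _ (by
          ext p
          obtain ⟨q, rfl⟩ := c.surjective p
          simp [hc])).finrank_eq
      have h1 := LinearMap.finrank_range_add_finrank_ker (L x)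
      have h2 := LinearMap.finrank_range_add_finrank_ker (L x₀)
      change Module.finrank ℝ (LinearMap.range (Λ' (f x) : P →ₗ[ℝ] Q)) =
        Module.finrank ℝ (LinearMap.range (Λ' (f x₀) : P →ₗ[ℝ] Q))
      rw [hΛ', hΛ']
      omega)
  refine ⟨fun x => (G x : Q →ₗ[ℝ] P), hG.mono fun x hx => ⟨fun B hB => hx.1.clm_apply hB,
    fun p => ?_⟩⟩
  rw [← hΛ']
  exact hx.2 p

/-- A smooth family of solutions `A` of `infAct (T x) A = B` that commute with `D`. -/
theorem exists_smooth_infAct_inverse {n : ℕ} {M : Type*} [TopologicalSpace M]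
    [ChartedSpace (EuclideanSpace ℝ (Fin n)) M] {F : Type*} [NormedAddCommGroup F]
    [NormedSpace ℝ F] [FiniteDimensional ℝ F] (D : F →L[ℝ] F)
    {T : M → F →L[ℝ] F →L[ℝ] F × ℝ} {x₀ : M}
    (hT : ∀ᶠ x in 𝓝 x₀, ContMDiffAt (𝓡 n) 𝓘(ℝ, F →L[ℝ] F →L[ℝ] F × ℝ) ∞ T x)
    (hker : ∀ᶠ x in 𝓝 x₀, ∃ c : commutant D ≃ₗ[ℝ] commutant D,
      ∀ A, infActOn D (T x) (c A) = 0 ↔ infActOn D (T x₀) A = 0) :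
    ∃ G : M → (F →L[ℝ] F →L[ℝ] F × ℝ) →ₗ[ℝ] F →L[ℝ] F, ∀ᶠ x in 𝓝 x₀,
      (∀ B : M → F →L[ℝ] F →L[ℝ] F × ℝ,
        ContMDiffAt (𝓡 n) 𝓘(ℝ, F →L[ℝ] F →L[ℝ] F × ℝ) ∞ B x →
        ContMDiffAt (𝓡 n) 𝓘(ℝ, F →L[ℝ] F) ∞ (fun z => G z (B z)) x) ∧
      (∀ B, Commute (G x B) D) ∧
      ∀ A, Commute A D → infAct (T x) (G x (infAct (T x) A)) = infAct (T x) A := by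
  let Λ : (F →L[ℝ] F →L[ℝ] F × ℝ) →ₗ[ℝ] commutant D →ₗ[ℝ] (F →L[ℝ] F →L[ℝ] F × ℝ) :=
    (LinearMap.lcomp ℝ _ (commutant D).subtype) ∘ₗ infActₗ
  have hΛ : ∀ x, infActOn D (T x) = Λ (T x) := fun x => LinearMap.ext fun A => rfl
  obtain ⟨G, hG⟩ := exists_smooth_generalized_inverse_of_linear (n := n)
    (P := commutant D) (Q := F →L[ℝ] F →L[ℝ] F × ℝ) (R := F →L[ℝ] F →L[ℝ] F × ℝ) Λ hΛ hT hker
  refine ⟨fun x => (commutant D).subtype ∘ₗ G x, ?_⟩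
  filter_upwards [hG] with x hx
  exact ⟨fun B hB => (commutant D).subtypeL.contDiff.contMDiff.contMDiffAt.comp x (hx.1 B hB),
    fun B => (G x B).2, fun A hA => hx.2 ⟨A, hA⟩⟩

namespace IsAdaptedFrame

variable {n : ℕ} {M : Type*} [TopologicalSpace M] [ChartedSpace (EuclideanSpace ℝ (Fin n)) M]
  [IsManifold (𝓡 n) ∞ M] [T2Space M] {S : Structure n M} {deg : Fin n → ℕ}
  {Z : Fin n → VField n M} {U : Set M} (hF : IsAdaptedFrame S deg Z U)

/-- For constant symbol, the derivatives of the structure tensor are tangent to its orbit. -/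
theorem exists_infAct_eq_mvfderiv (hreg : IsEquiregular S.E)
    (hiso : ∀ x y, Nonempty (Structure.GrIso S x y)) {x : M} (hx : x ∈ U)
    (v : TangentSpace (𝓡 n) x) : ∃ A, Commute A (degOp deg) ∧
      infAct (hF.tensor x) A = mvfderiv (𝓡 n) hF.tensor x v := by
  obtain ⟨w, rfl⟩ := exists_coordVec_eq v
  let φ := extChartAt (𝓡 n) x
  -- A straight chart segment with velocity `w`. By constant symbol the tensor along it stays in the
  -- orbit of its initial value, so the tangency result applies.
  let p : ℝ → EuclideanSpace ℝ (Fin n) := fun t => φ x + t • w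
  have hp0 : p 0 = φ x := by simp [p]
  have hpd : HasDerivAt p w 0 := by
    have h := ((hasDerivAt_id (0 : ℝ)).smul_const w).const_add (φ x)
    rwa [one_smul] at h
  have h1 := hasFDerivAt_comp_chart_symm (mem_chart_source (EuclideanSpace ℝ (Fin n)) x)
      ((hF.contMDiffAt_tensor hreg hx).mdifferentiableAt (by simp))
  have h2 := HasFDerivAt.comp_hasDerivAt (0 : ℝ) (f := p) (by rw [hp0]; exact h1) hpd
  have hγ0 : φ.symm (p 0) = x := by rw [hp0]; exact extChartAt_to_inv x
  have hγ : Tendsto (fun t => φ.symm (p t)) (𝓝 0) (𝓝 x) := by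
    have h : ContinuousAt φ.symm (p 0) := by
      rw [hp0]
      exact continuousAt_extChartAt_symm x
    have h' := h.comp hpd.continuousAt
    rwa [ContinuousAt, Function.comp_apply, hγ0] at h'
  have h3 := exists_infAct_eq_of_hasDerivAt (D := degOp deg)
    (T := fun t => hF.tensor (φ.symm (p t))) h2
    (by rw [hγ0]; exact hF.posOn hreg hx) (by rw [hγ0]; exact hF.genBy hreg hx) (by
      rw [hγ0]
      filter_upwards [hγ.eventually (hF.eventually_mem hx)] with t ht
      exact hF.exists_isIntertwiner_of_grIso hreg hx ht (hiso x _).some)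
  rw [hγ0] at h3
  exact h3

/-- Constant symbol makes all stabilizers conjugate, hence the infinitesimal action has constant
rank and a smooth generalized inverse `G`. The form v ↦ G(dT(v)) is linear and smooth, and it solves
the equation because dT(v) lies in the image. -/
theorem exists_isLocalConnection (hF : IsAdaptedFrame S deg Z U) (hreg : IsEquiregular S.E)
    (hiso : ∀ x y, Nonempty (Structure.GrIso S x y)) {x₀ : M} (hx₀ : x₀ ∈ U) :
    ∃ W, IsOpen W ∧ x₀ ∈ W ∧ ∃ N, Structure.IsLocalConnection S W N := by
  have hker : ∀ᶠ x in 𝓝 x₀, ∃ c : commutant (degOp deg) ≃ₗ[ℝ] commutant (degOp deg),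
      ∀ A, infActOn (degOp deg) (hF.tensor x) (c A) = 0 ↔
        infActOn (degOp deg) (hF.tensor x₀) A = 0 := by
    filter_upwards [hF.eventually_mem hx₀] with x hx
    obtain ⟨h, hh⟩ := hF.exists_isIntertwiner_of_grIso hreg hx₀ hx (hiso x₀ x).some
    exact hh.exists_commutant_equiv (hF.posOn hreg hx₀) (hF.genBy hreg hx)
  obtain ⟨G, hG⟩ := exists_smooth_infAct_inverse (degOp deg)
    ((hF.eventually_mem hx₀).mono fun x hx => hF.contMDiffAt_tensor hreg hx) hker
  obtain ⟨W, hW, hWo, hxW⟩ := eventually_nhds_iff.1 (hG.and (hF.eventually_mem hx₀))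
  refine ⟨W, hWo, hxW, _, hF.isLocalConnection_frameNabla hreg hWo
    (Γ := fun x => G x ∘ₗ (mvfderiv (𝓡 n) hF.tensor x : TangentSpace (𝓡 n) x →ₗ[ℝ] _))
    (fun x hx => (hW x hx).2) (fun Y hY x hx => ?_) (fun x hx v => (hW x hx).1.2.1 _)
    (fun x hx v => ?_)⟩
  · exact (hW x hx).1.1 _
      (contMDiffAt_mvfderiv_apply (hF.contMDiffAt_tensor hreg (hW x hx).2) hY)
  · obtain ⟨A, hA, he⟩ := hF.exists_infAct_eq_mvfderiv hreg hiso (hW x hx).2 v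
    have h1 := (hW x hx).1.2.2 A hA
    rw [he] at h1
    exact h1

end IsAdaptedFrame

namespace Structure

variable {n : ℕ} {M : Type*} [TopologicalSpace M] [ChartedSpace (EuclideanSpace ℝ (Fin n)) M]
  [IsManifold (𝓡 n) ∞ M] [T2Space M] {S : Structure n M}

theorem grBracket_sum_smul_left (hreg : IsEquiregular S.E) {ι : Type*} (s : Finset ι) (r : ι → ℝ)
    (x : M) (a : ι → S.Gr x) (b : S.Gr x) :
    S.grBracket x (∑ i ∈ s, r i • a i) b = ∑ i ∈ s, r i • S.grBracket x (a i) b := by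
  simp only [grBracket_eq hreg, map_sum, map_smul, LinearMap.sum_apply, LinearMap.smul_apply]

theorem grBracket_sum_smul_right (hreg : IsEquiregular S.E) {ι : Type*} (s : Finset ι) (r : ι → ℝ)
    (x : M) (a : S.Gr x) (b : ι → S.Gr x) :
    S.grBracket x a (∑ i ∈ s, r i • b i) = ∑ i ∈ s, r i • S.grBracket x a (b i) := by
  simp only [grBracket_eq hreg, map_sum, map_smul]

omit [T2Space M] in
theorem sum_smul_apply {ι : Type*} (s : Finset ι) (r : ι → ℝ) {x : M} (a : ι → S.Gr x) (k : ℕ) :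
    (∑ i ∈ s, r i • a i) k = ∑ i ∈ s, r i • a i k := by
  rw [DFinsupp.finsetSum_apply]
  rfl

/-- The conditions on a connection are affine, so they survive weighted sums with weights of total
1; the inhomogeneous term of the Leibniz rule is where the total is used. -/
theorem exists_isStronglyCompatible_of_local [SecondCountableTopology M]
    (hreg : IsEquiregular S.E)
    (hloc : ∀ x, ∃ W, IsOpen W ∧ x ∈ W ∧ ∃ N, IsLocalConnection S W N) :
    ∃ D : S.GrConnection, D.IsStronglyCompatible := by
  choose W hWo hxW N hN using hloc
  have : LocallyCompactSpace M := ChartedSpace.locallyCompactSpace (EuclideanSpace ℝ (Fin n)) M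
  obtain ⟨ρ, hρ⟩ := SmoothPartitionOfUnity.exists_isSubordinate (𝓡 n) isClosed_univ W hWo
    (fun x _ => mem_iUnion.2 ⟨x, hxW x⟩)
  -- The sums run over the indices whose closed support contains the point. These sets can only
  -- shrink near a point, so one finite sum describes the connection on a whole neighborhood.
  have hmem : ∀ {x i}, i ∈ ρ.fintsupport x → x ∈ W i := fun hi =>
    hρ _ ((ρ.mem_fintsupport_iff _ _).1 hi)
  have hone : ∀ x, ∑ i ∈ ρ.fintsupport x, ρ i x = 1 := fun x =>
    ρ.sum_finsupport' x (mem_univ x) (ρ.finsupport_subset_fintsupport x)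
  have hleib : ∀ {G : Type} [AddCommGroup G] [Module ℝ G] (s : Finset M) (r : M → ℝ) (a : G)
      (f : ℝ) (m : M → G), ∑ i ∈ s, r i = 1 →
        ∑ i ∈ s, r i • (a + f • m i) = a + f • ∑ i ∈ s, r i • m i := fun s r a f m h => by
    simp only [smul_add, Finset.sum_add_distrib, ← Finset.sum_smul, h, one_smul, Finset.smul_sum,
      smul_comm f]
  let D : S.GrConnection :=
    { nabla := fun Y A x => ∑ i ∈ ρ.fintsupport x, ρ i x • N i Y A x
      smooth := fun Y A hY hA => isSmoothGr_iff.2 fun x₀ => by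
        refine (SmoothGrAt.sum (ρ.fintsupport x₀) fun i hi =>
          SmoothGrAt.smul ((hN i).smooth Y A hY hA x₀ (hmem hi)) (ρ i).contMDiff).congr ?_
        filter_upwards [ρ.eventually_fintsupport_subset x₀] with x hx
        refine Finset.sum_subset hx fun i _ hi => ?_
        rw [ρ.mem_fintsupport_iff] at hi
        rw [image_eq_zero_of_notMem_tsupport hi, zero_smul]
      add_left := fun Y Y' A _ _ _ x => by
        simp only [(hN _).add_left, smul_add, Finset.sum_add_distrib]
      smul_left := fun f Y A _ _ _ x => by
        simp only [(hN _).smul_left, Finset.smul_sum, smul_comm (f x)]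
      add_right := fun Y A B _ hA hB x => by
        rw [← Finset.sum_add_distrib]
        exact Finset.sum_congr rfl fun i hi => by
          rw [(hN i).add_right Y A B hA hB x (hmem hi), smul_add]
      leibniz := fun f Y A hf _ hA x => by
        refine (Finset.sum_congr rfl fun i hi => congrArg (ρ i x • ·)
          ((hN i).leibniz f Y A hf hA x (hmem hi))).trans ?_
        exact hleib _ (fun i => ρ i x) _ _ (fun i => N i Y A x) (hone x) }
  have hD : ∀ Y A x, D.nabla Y A x = ∑ i ∈ ρ.fintsupport x, ρ i x • N i Y A x :=
    fun _ _ _ => rfl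
  refine ⟨D, ⟨⟨fun k Y A _ hA hk x m hm => ?_, fun Y A B _ hA hB _ _ x => ?_⟩,
    fun Y A B _ hA hB x => ?_⟩⟩
  · rw [hD, sum_smul_apply]
    refine Finset.sum_eq_zero fun i hi => ?_
    rw [(hN i).parallel k Y A hA hk x (hmem hi) m hm, smul_zero]
  · have h1 : ∀ i ∈ ρ.fintsupport x, ρ i x * (S.grInner x (N i Y A x 1) (B x 1) +
        S.grInner x (A x 1) (N i Y B x 1)) = ρ i x *
        mvfderiv (𝓡 n) (fun z => S.grInner z (A z 1) (B z 1)) x (Y x) := fun i hi => by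
      rw [(hN i).metric Y A B hA hB x (hmem hi)]
    have h2 := Finset.sum_congr rfl h1
    rw [← Finset.sum_mul, hone, one_mul] at h2
    rw [← h2, hD, hD, sum_smul_apply, sum_smul_apply]
    simp only [← grInnerₗ_apply, map_sum, map_smul, LinearMap.sum_apply, LinearMap.smul_apply,
      mul_add, Finset.sum_add_distrib, smul_eq_mul]
  · rw [hD, hD, hD, grBracket_sum_smul_left hreg, grBracket_sum_smul_right hreg,
      ← Finset.sum_add_distrib]
    exact Finset.sum_congr rfl fun i hi => by
      rw [(hN i).bracket Y A B hA hB x (hmem hi), smul_add]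

theorem HasConstantSymbol.exists_isStronglyCompatible [SecondCountableTopology M]
    (hgen : IsBracketGenerating S.E) (hreg : IsEquiregular S.E) (h : S.HasConstantSymbol) :
    ∃ D : S.GrConnection, D.IsStronglyCompatible := by
  refine exists_isStronglyCompatible_of_local hreg fun x => ?_
  obtain ⟨deg, Z, U, hx, hF⟩ := exists_isAdaptedFrame S hgen hreg x
  exact hF.exists_isLocalConnection hreg (h.nonempty_grIso hreg) hx

end Structure

end SubRiemannian
end

theorem mainTheorem7 {n : ℕ} {M : Type*} [TopologicalSpace M]
    [ChartedSpace (EuclideanSpace ℝ (Fin n)) M] [IsManifold (𝓡 n) ∞ M]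
    [T2Space M] [SecondCountableTopology M] [ConnectedSpace M]
    (S : SubRiemannian.Structure n M)
    (hgen : SubRiemannian.IsBracketGenerating S.E) (hreg : SubRiemannian.IsEquiregular S.E) :
    (∃ D : S.GrConnection, D.IsStronglyCompatible) ↔ S.HasConstantSymbol := by
  exact ⟨fun ⟨_, hD⟩ =>
      SubRiemannian.Structure.hasConstantSymbol_of_isStronglyCompatible hgen hreg hD,
    fun h => h.exists_isStronglyCompatible hgen hreg⟩
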